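/- **Model.** A principal has funds $\tau>0$. An agent privately holds a surplus (type) $x\in[\underline x,\bar x]$, $0\le\underline x<\bar x<\infty$, distributed according to a probability measure $F$ on $\mathbb R$ whose support has minimum $\underline x$ and maximum $\bar x$. The cost functions $c_A,c_P:[0,1]\to\mathbb R$ of acquiring conclusive evidence of the type are thrice differentiable, strictly increasing and strictly convex, with $c_A(0)=c_P(0)=c_A'(0)=c_P'(0)=0$. Assume $\tau\ge c_A'(1)>c_P(1)$; for all $e\in[0,1]$, $\frac{\underline x+\tau}{c_P'(1)}+e>e(1-e)\frac{c_A'''(e)}{c_A''(e)}+1-e$; and $e\mapsto e\,c_A'(e)$ is strictly convex on $[0,1]$. A *tax mechanism* is a tuple $m=(e_A,e_P,r_A,r_P,r_\emptyset)$ of real functions on $[\underline x,\bar x]$; it is *feasible* if $e_A(y),e_P(y)\in[0,1]$ and $r_A(y),r_P(y),r_\emptyset(y)\in[0,y+\tau]$ for all $y$. Type $x$ advances some $y\in[0,x]$, covertly obtains evidence with a probability $e\in[0,1]$ of the agent's choice at cost $c_A(e)$, and chooses whether to disclose it. If the agent discloses no evidence, the principal obtains evidence with probability $e_P(y)$ (with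 probability $1$ if $y<\underline x$) at cost $c_P(e_P(y))$. If $y\ne x$ and someone provides evidence, the principal seizes $x$; otherwise the principal keeps $y$ and refunds $r_A(y)$, $r_P(y)$ or $r_\emptyset(y)$ according to whether the agent, the principal or nobody provided evidence. A *mechanism* is a feasible tax mechanism under which each type $x$ finds it optimal to advance $y=x$, exert $e=e_A(x)$ and disclose. For a mechanism $m$ let $$R_{NA}=e_Pr_P+(1-e_P)r_\emptyset,\quad \rho=e_A(r_A-R_{NA})-c_A(e_A),\quad U_m=R_{NA}+\rho,$$ $$\Pi_m(x)=x-R_{NA}(x)-\rho(x)-c_A(e_A(x))-(1-e_A(x))c_P(e_P(x)),$$ $$\lambda_m(x)=\inf_{y\in[\underline x,x]}\bigl(e_P(y)x+(1-e_P(y))(y-r_\emptyset(y))\bigr).$$ A mechanism $m$ is *tight* if every mechanism $m'$ with $\Pi_m\le\Pi_{m'}$ and $\lambda_m\le\lambda_{m'}$ pointwise satisfies $\Pi_m=\Pi_{m'}$ and $\lambda_m=\lambda_{m'}$. It is *optimal* if it maximizes $\int\Pi_m\,dF$ among all mechanisms with Borel measurable profit (and has measurable profit itself). A mechanism is a *debt-with-relief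 mechanism* if there are $y_0\in[\underline x,\bar x]$ and $\bar r\in[0,\underline x+\tau]$ such that $e_P(x)=1$, $r_P(x)=0$, $r_A(x)=\bar r$ for $x<y_0$, and $e_P(x)=0$, $r_\emptyset(x)=x-y_0$, $r_A(x)=0$ for $x\ge y_0$ (refunds that are paid with probability zero, namely $r_P$ where $e_P=0$ and $r_\emptyset$ where $e_P=1$, being irrelevant). **Theorem.** Suppose $F(\{\bar x\})=0$. If $m$ is tight and optimal, then $$\inf_{x\in[\underline x,\bar x]}U_m(x)>0,\qquad \sup_{x\in[\underline x,\bar x]}e_P(x)<1,\qquad e_P(x)>0\ \text{ for all }x\in[\underline x,\bar x).$$ Hence $m$ has random audits (that is, $0<e_P(x)<1$ for some $x$), and $[\underline x,\bar x)$ is covered by five consecutive intervals with non-empty interior on which $e_P\in(0,1)$: there are $\underline x<a<b<c<d<\bar x$ such that $U_m(x)>x-\lambda_m(x)$ for $x\in[\underline x,a)$ and $U_m(x)=x-\lambda_m(x)$ for $x\in[a,\bar x)$, while $r_P=r_\emptyset=0$ on $[\underline x,b]$; $0<r_P(x)<x+\tau$ and $r_\emptyset(x)=0$ on $(b,c)$;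 $r_P(x)=x+\tau$ and $r_\emptyset(x)=0$ on $[c,d]$; $r_P(x)=x+\tau$ and $r_\emptyset(x)>0$ on $(d,\bar x)$. Moreover, no debt-with-relief mechanism is optimal. -/

import Mathlib

open Set MeasureTheory

noncomputable section

/-- The data of the taxation problem: the principal's private funds `τ`, the lowest and highest
type (surplus of the agent), the evidence cost functions of the agent and of the principal (only
their values on `[0, 1]` matter) and the type distribution. -/
structure AuditProblem where
  τ : ℝ
  xlow : ℝ
  xhigh : ℝ
  cA : ℝ → ℝ
  cP : ℝ → ℝ
  F : Measure ℝ

/-- The `k`-th derivative of an effort cost function on its domain `[0, 1]`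
(one-sided at the two end points). -/
def costDeriv (k : ℕ) (c : ℝ → ℝ) : ℝ → ℝ := iteratedDerivWithin k c (Icc 0 1)

/-- The standing assumptions on a single cost function `c : [0, 1] → ℝ`. -/
structure IsEvidenceCost (c : ℝ → ℝ) : Prop where
  thrice_differentiable : ∀ k < 3, DifferentiableOn ℝ (costDeriv k c) (Icc 0 1)
  strictly_increasing : StrictMonoOn c (Icc 0 1)
  strictly_convex : StrictConvexOn ℝ (Icc 0 1) c
  zero : c 0 = 0
  deriv_zero : costDeriv 1 c 0 = 0

namespace AuditProblem

/-- The type space `[xlow, xhigh]`. -/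
def types (P : AuditProblem) : Set ℝ := Icc P.xlow P.xhigh

/-- The standing assumptions of the model. -/
structure IsValid (P : AuditProblem) : Prop where
  funds_pos : 0 < P.τ
  xlow_nonneg : 0 ≤ P.xlow
  xlow_lt_xhigh : P.xlow < P.xhigh
  isProbabilityMeasure : IsProbabilityMeasure P.F
  xlow_isLeast : IsLeast P.F.support P.xlow
  xhigh_isGreatest : IsGreatest P.F.support P.xhigh
  cost_agent : IsEvidenceCost P.cA
  cost_principal : IsEvidenceCost P.cP
  budget : costDeriv 1 P.cA 1 ≤ P.τ ∧ P.cP 1 < costDeriv 1 P.cA 1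
  regularity : ∀ e ∈ Icc (0 : ℝ) 1,
    e * (1 - e) * (costDeriv 3 P.cA e / costDeriv 2 P.cA e) + (1 - e)
      < (P.xlow + P.τ) / costDeriv 1 P.cP 1 + e
  rent_regularity : StrictConvexOn ℝ (Icc 0 1) (fun e => e * costDeriv 1 P.cA e)

end AuditProblem

/-- A tax mechanism: recommended agent effort, principal effort, and the refunds after evidence of
the agent, after evidence of the principal, and after no evidence, as functions of the advance
payment. Only the values at advance payments in `[xlow, xhigh]` matter. -/
structure TaxMechanism where
  eA : ℝ → ℝ
  eP : ℝ → ℝ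
  rA : ℝ → ℝ
  rP : ℝ → ℝ
  r0 : ℝ → ℝ

namespace TaxMechanism

variable (P : AuditProblem) (m : TaxMechanism)

/-- Probability with which the principal acquires evidence after the advance payment `y` if the
agent discloses none: one below the lowest type, and `eP y` otherwise. -/
def auditProb (y : ℝ) : ℝ := if y < P.xlow then 1 else m.eP y

/-- Expected payoff of type `x` who advances `y`, exerts effort `e` and discloses evidence,
if obtained, exactly when `d` is true. When `y ≠ x` all evidence, by whomever it is provided,
leads to the seizure of the full surplus `x`. -/
def agentPayoff (x y e : ℝ) (d : Bool) : ℝ :=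
  let p : ℝ := if d then e else 0
  let q : ℝ := auditProb P m y
  if y = x then
    p * (x - (y - m.rA y))
      + (1 - p) * (q * (x - (y - m.rP y)) + (1 - q) * (x - (y - m.r0 y))) - P.cA e
  else
    p * (x - x) + (1 - p) * (q * (x - x) + (1 - q) * (x - (y - m.r0 y))) - P.cA e

/-- Efforts are probabilities and refunds respect the principal's funds. -/
structure IsFeasible : Prop where
  eA_mem : ∀ y ∈ P.types, m.eA y ∈ Icc (0 : ℝ) 1
  eP_mem : ∀ y ∈ P.types, m.eP y ∈ Icc (0 : ℝ) 1
  rA_mem : ∀ y ∈ P.types, m.rA y ∈ Icc 0 (y + P.τ)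
  rP_mem : ∀ y ∈ P.types, m.rP y ∈ Icc 0 (y + P.τ)
  r0_mem : ∀ y ∈ P.types, m.r0 y ∈ Icc 0 (y + P.τ)

/-- Every type `x` finds it optimal to advance the full surplus, to exert the recommended effort
and to disclose available evidence. -/
def IsIncentiveCompatible : Prop :=
  ∀ x ∈ P.types, ∀ y ∈ Icc 0 x, ∀ e ∈ Icc (0 : ℝ) 1, ∀ d : Bool,
    agentPayoff P m x y e d ≤ agentPayoff P m x x (m.eA x) true

/-- Feasible and incentive compatible. -/
def IsMechanism : Prop := IsFeasible P m ∧ IsIncentiveCompatible P m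

/-- Expected refund of the truthful type `x` if the agent provides no evidence. -/
def refundNA (x : ℝ) : ℝ := m.eP x * m.rP x + (1 - m.eP x) * m.r0 x

/-- Extra refund, net of effort cost, of the truthful type `x` from acquiring evidence. -/
def evidenceRent (x : ℝ) : ℝ := m.eA x * (m.rA x - refundNA m x) - P.cA (m.eA x)

/-- Interim utility of type `x` from advancing the full surplus. -/
def utility (x : ℝ) : ℝ := refundNA m x + evidenceRent P m x

/-- The principal's expected profit from type `x`. -/
def profit (x : ℝ) : ℝ :=
  x - refundNA m x - evidenceRent P m x - P.cA (m.eA x) - (1 - m.eA x) * P.cP (m.eP x)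

/-- The lowest expected loss of type `x` when concealing surplus. -/
def loss (x : ℝ) : ℝ :=
  sInf ((fun y => m.eP y * x + (1 - m.eP y) * (y - m.r0 y)) '' Icc P.xlow x)

/-- `m'` is tighter than `m`. -/
def IsTighterThan (m' m : TaxMechanism) : Prop :=
  ∀ x ∈ P.types, profit P m x ≤ profit P m' x ∧ loss P m x ≤ loss P m' x

/-- `m` is a mechanism that is tighter than every mechanism that is tighter than `m`. -/
def IsTight : Prop :=
  IsMechanism P m ∧
    ∀ m' : TaxMechanism, IsMechanism P m' → IsTighterThan P m' m → IsTighterThan P m m'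

/-- The profit is a Borel function on the type space. -/
def HasMeasurableProfit : Prop := Measurable (fun x : P.types => profit P m x)

/-- The principal's expected profit. -/
def expectedProfit : ℝ := ∫ x in P.types, profit P m x ∂P.F

/-- `m` maximizes the expected profit across all mechanisms (with measurable profit). -/
def IsOptimal : Prop :=
  IsMechanism P m ∧ HasMeasurableProfit P m ∧
    ∀ m' : TaxMechanism, IsMechanism P m' → HasMeasurableProfit P m' →
      expectedProfit P m' ≤ expectedProfit P m

/-- The principal's effort is interior for at least one type. -/
def HasRandomAudits : Prop := ∃ x ∈ P.types, m.eP x ∈ Ioo (0 : ℝ) 1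

/-- The type space without the highest type is the union of five consecutive intervals with
non-empty interior, on all of which the principal's effort is interior, and which are ordered by the
instruments in use: `[xlow, a)` (SuperLow: the incentive to advance the full surplus is strict, no
refund without the agent's evidence), `[a, b]` (Low: the incentive binds, still no such refund),
`(b, c)` (Middle: interior refund after the principal's evidence), `[c, d]` (High: this refund is
maximal) and `(d, xhigh)` (SuperHigh: in addition a positive refund without any evidence). -/
structure FiveIntervalsCover (a b c d : ℝ) : Prop where
  ordered : P.xlow < a ∧ a < b ∧ b < c ∧ c < d ∧ d < P.xhigh
  interior : ∀ x ∈ Ico P.xlow P.xhigh, m.eP x ∈ Ioo (0 : ℝ) 1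
  superLow : ∀ x ∈ Ico P.xlow a, x - loss P m x < utility P m x ∧ m.rP x = 0 ∧ m.r0 x = 0
  low : ∀ x ∈ Icc a b, utility P m x = x - loss P m x ∧ m.rP x = 0 ∧ m.r0 x = 0
  middle : ∀ x ∈ Ioo b c,
    utility P m x = x - loss P m x ∧ m.rP x ∈ Ioo 0 (x + P.τ) ∧ m.r0 x = 0
  high : ∀ x ∈ Icc c d, utility P m x = x - loss P m x ∧ m.rP x = x + P.τ ∧ m.r0 x = 0
  superHigh : ∀ x ∈ Ioo d P.xhigh,
    utility P m x = x - loss P m x ∧ m.rP x = x + P.τ ∧ 0 < m.r0 x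

/-- Debt with face value `y0` and relief `r`. The refunds `rP` and `r0` are prescribed only
where they are paid with positive probability, since mechanisms that differ only in refunds that
are never paid are identified. -/
def IsDebtWithRelief : Prop :=
  IsMechanism P m ∧ ∃ y0 ∈ P.types, ∃ r ∈ Icc 0 (P.xlow + P.τ),
    (∀ x ∈ P.types, x < y0 → m.eP x = 1 ∧ m.rP x = 0 ∧ m.rA x = r) ∧
    (∀ x ∈ P.types, y0 ≤ x → m.eP x = 0 ∧ m.r0 x = x - y0 ∧ m.rA x = 0)

/-- `utility` is the payoff of a truthful and obedient agent. -/
theorem agentPayoff_truthful {x : ℝ} (hx : x ∈ P.types) :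
    agentPayoff P m x x (m.eA x) true = utility P m x := by
  have h : ¬ x < P.xlow := not_lt.mpr hx.1
  simp only [agentPayoff, auditProb, utility, evidenceRent, refundNA, h, if_true, if_false]
  ring

end TaxMechanism

end

/-! Let w(x) = x - λ(x) be the best payoff of type x from concealing surplus (`concealment`). Given
w, the types decouple: contracts form a mechanism as soon as each grants its own type x at least
w(x) and the line z ↦ (1 - e_P)(z - x + r_∅), the payoff of a higher type z who mimics x, stays
below w (`IsMechanism.isAdmissible`, `isMechanism_of_isAdmissible`). Tightness makes every contract
cost-minimal given w (`IsTight.isPointwiseOptimal`) in a problem with four unknowns: the agent's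
effort e, the audit probability p, the expected refund R without the agent's evidence, and the part
h of R that is paid without any evidence. It also makes w equal to its regular hull, since lines
with slope in [0, 1] that start below the hull and stay below w stay below the hull. So w is convex,
increasing and has slopes of at most one.

Optimality across types adds the boundary behaviour of w. Audits with small probability ε cost o(ε),
so w cannot have slope one up to the top (`concealment_slope_lt`); the same perturbation defeats
debt. This yields p > 0 below the top and w = 0 at the bottom. Low types earn a rent from acquiring
evidence, so raising w near the bottom costs nothing and saves audits; hence w leaves the bottom
with positive slope (`exists_slope_pos`).

Let p_*(x) be one minus the steepest slope, capped at one, of a line from (x, 0) below w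
(`minAudit`). It is continuous and nonincreasing, while w increases strictly from zero. Utility w(x)
is provided by the cheapest instruments available: the rent at the second-best effort, then more
effort up to the first best, then refunds after the principal's evidence. Each runs out at the zero
of a strictly decreasing gap function; these zeros are a < b < c.

Beyond c, the maximal refund at p_* and the first-best rent no longer reach w. What remains is
effort above the first best, or audits above p_*, which permit larger refunds and are used only with
h > 0. The sign of `auditMargin` decides, and the regularity assumption makes it decrease in effort.
Hence the points above c where extra audits do not pay (`IsHighPoint`) are closed downwards
(`isHighPoint_of_le`), and their maximum is d. There are such points above c because distorting
effort away from the first best has no first-order cost, unlike an audit (`exists_isHighPoint_gt`);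
and d lies below the top because audits are nearly free at the margin where p_* vanishes. -/

noncomputable section

/-! ### Inverses of increasing functions on the unit interval -/

/-- A right inverse of `f` on `f '' [0, 1]`. -/
def unitInv (f : ℝ → ℝ) : ℝ → ℝ := Function.invFunOn f (Icc 0 1)

section unitInv

variable {f : ℝ → ℝ}

theorem unitInv_spec (hc : ContinuousOn f (Icc 0 1)) (h0 : f 0 = 0) {y : ℝ}
    (hy : y ∈ Icc 0 (f 1)) : unitInv f y ∈ Icc (0 : ℝ) 1 ∧ f (unitInv f y) = y := by
  have : ∃ a ∈ Icc (0 : ℝ) 1, f a = y := by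
    have := intermediate_value_Icc (zero_le_one' ℝ) hc
    rw [h0] at this
    exact this hy
  exact ⟨Function.invFunOn_mem this, Function.invFunOn_eq this⟩

theorem unitInv_apply (hm : StrictMonoOn f (Icc 0 1)) {e : ℝ} (he : e ∈ Icc (0 : ℝ) 1) :
    unitInv f (f e) = e :=
  hm.injOn (Function.invFunOn_mem ⟨e, he, rfl⟩) he (Function.invFunOn_eq ⟨e, he, rfl⟩)

/-- Preimages of closed sets under the inverse are images of compact sets under `f`. -/
theorem unitInv_continuousOn (hc : ContinuousOn f (Icc 0 1)) (hm : StrictMonoOn f (Icc 0 1))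
    (h0 : f 0 = 0) : ContinuousOn (unitInv f) (Icc 0 (f 1)) := by
  rw [continuousOn_iff_isClosed]
  intro t ht
  refine ⟨f '' (Icc 0 1 ∩ t), ?_, ?_⟩
  · exact ((isCompact_Icc.inter_right ht).image_of_continuousOn
      (hc.mono inter_subset_left)).isClosed
  · ext y
    constructor
    · rintro ⟨h1, h2⟩
      obtain ⟨h3, h4⟩ := unitInv_spec hc h0 h2
      exact ⟨⟨_, ⟨h3, h1⟩, h4⟩, h2⟩
    · rintro ⟨⟨e, ⟨he, het⟩, rfl⟩, h2⟩
      refine ⟨?_, h2⟩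
      rw [mem_preimage, unitInv_apply hm he]
      exact het

end unitInv

/-- Mean value theorem for functions differentiable on the closed unit interval. -/
theorem exists_slope_eq_of_hasDerivWithinAt_unit {f f' : ℝ → ℝ}
    (hf : ∀ e ∈ Icc (0 : ℝ) 1, HasDerivWithinAt f (f' e) (Icc 0 1) e) {x y : ℝ}
    (hx : 0 ≤ x) (hxy : x < y) (hy : y ≤ 1) : ∃ z ∈ Ioo x y, f y - f x = f' z * (y - x) := by
  obtain ⟨z, hz, h⟩ := exists_hasDerivAt_eq_slope f f' hxy
    (fun e he => ((hf e ⟨hx.trans he.1, he.2.trans hy⟩).continuousWithinAt).mono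
      (Icc_subset_Icc hx hy))
    (fun e he => (hf e ⟨hx.trans he.1.le, he.2.le.trans hy⟩).hasDerivAt
      (Icc_mem_nhds (hx.trans_lt he.1) (he.2.trans_le hy)))
  refine ⟨z, hz, ?_⟩
  rw [h, div_mul_cancel₀]
  linarith

/-- A function with positive derivative inside the unit interval is strictly increasing. -/
theorem strictMonoOn_unit_of_deriv_pos {f f' : ℝ → ℝ}
    (hf : ∀ e ∈ Icc (0 : ℝ) 1, HasDerivWithinAt f (f' e) (Icc 0 1) e)
    (h : ∀ e ∈ Ioo (0 : ℝ) 1, 0 < f' e) : StrictMonoOn f (Icc 0 1) := by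
  intro x hx y hy hxy
  obtain ⟨z, hz, h1⟩ := exists_slope_eq_of_hasDerivWithinAt_unit hf hx.1 hxy hy.2
  have := mul_pos (h z ⟨hx.1.trans_lt hz.1, hz.2.trans_le hy.2⟩) (sub_pos.2 hxy)
  linarith

/-- The utility that an agent who exerts effort `e` at an interior optimum gets from acquiring
evidence. -/
def infoRent (c : ℝ → ℝ) (e : ℝ) : ℝ := e * costDeriv 1 c e - c e

/-- The marginal cost of implementing effort `e` when no refund is paid without evidence. -/
def virtualMarginalCost (c : ℝ → ℝ) (e : ℝ) : ℝ := costDeriv 1 c e + e * costDeriv 2 c e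

/-! ### Evidence costs -/

theorem costDeriv_zero_eq (c : ℝ → ℝ) : costDeriv 0 c = c := by
  ext e; simp [costDeriv, iteratedDerivWithin_zero]

namespace IsEvidenceCost

variable {c : ℝ → ℝ} (hc : IsEvidenceCost c)
include hc

theorem hasDerivWithinAt_costDeriv {k : ℕ} (hk : k < 3) {e : ℝ} (he : e ∈ Icc (0 : ℝ) 1) :
    HasDerivWithinAt (costDeriv k c) (costDeriv (k + 1) c e) (Icc 0 1) e := by
  have := (hc.thrice_differentiable k hk e he).hasDerivWithinAt
  have h : costDeriv (k + 1) c e = derivWithin (costDeriv k c) (Icc 0 1) e := by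
    unfold costDeriv
    rw [iteratedDerivWithin_succ]
  rwa [h]

theorem hasDerivWithinAt {e : ℝ} (he : e ∈ Icc (0 : ℝ) 1) :
    HasDerivWithinAt c (costDeriv 1 c e) (Icc 0 1) e := by
  have := hc.hasDerivWithinAt_costDeriv (k := 0) (by norm_num) he
  rwa [costDeriv_zero_eq] at this

theorem continuousOn_costDeriv {k : ℕ} (hk : k < 3) : ContinuousOn (costDeriv k c) (Icc 0 1) :=
  (hc.thrice_differentiable k hk).continuousOn

theorem continuousOn : ContinuousOn c (Icc 0 1) :=
  fun _ he => (hc.hasDerivWithinAt he).continuousWithinAt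

theorem strictMonoOn_deriv : StrictMonoOn (costDeriv 1 c) (Icc 0 1) := by
  have h1 := hc.strictly_convex.strictMonoOn_derivWithin
    (fun e he => (hc.hasDerivWithinAt he).differentiableWithinAt)
  intro x hx y hy hxy
  have := h1 hx hy hxy
  rwa [(hc.hasDerivWithinAt hx).derivWithin (uniqueDiffOn_Icc_zero_one x hx),
    (hc.hasDerivWithinAt hy).derivWithin (uniqueDiffOn_Icc_zero_one y hy)] at this

theorem deriv_nonneg {e : ℝ} (he : e ∈ Icc (0 : ℝ) 1) : 0 ≤ costDeriv 1 c e := by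
  have := hc.strictMonoOn_deriv.monotoneOn (left_mem_Icc.2 zero_le_one) he he.1
  rwa [hc.deriv_zero] at this

theorem deriv_pos {e : ℝ} (h0 : 0 < e) (h1 : e ≤ 1) : 0 < costDeriv 1 c e := by
  have := hc.strictMonoOn_deriv (left_mem_Icc.2 zero_le_one) ⟨h0.le, h1⟩ h0
  rwa [hc.deriv_zero] at this

theorem deriv_le_deriv_one {e : ℝ} (he : e ∈ Icc (0 : ℝ) 1) :
    costDeriv 1 c e ≤ costDeriv 1 c 1 :=
  hc.strictMonoOn_deriv.monotoneOn he (right_mem_Icc.2 zero_le_one) he.2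

theorem nonneg {e : ℝ} (he : e ∈ Icc (0 : ℝ) 1) : 0 ≤ c e := by
  have := hc.strictly_increasing.monotoneOn (left_mem_Icc.2 zero_le_one) he he.1
  rwa [hc.zero] at this

theorem le_one {e : ℝ} (he : e ∈ Icc (0 : ℝ) 1) : c e ≤ c 1 :=
  hc.strictly_increasing.monotoneOn he (right_mem_Icc.2 zero_le_one) he.2

theorem tangent_lt {x y : ℝ} (hx : x ∈ Icc (0 : ℝ) 1) (hy : y ∈ Icc (0 : ℝ) 1) (hxy : x ≠ y) :
    c x + costDeriv 1 c x * (y - x) < c y := by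
  have hd := fun e he => hc.hasDerivWithinAt (e := e) he
  rcases lt_or_gt_of_ne hxy with h | h
  · obtain ⟨z, hz, h1⟩ := exists_slope_eq_of_hasDerivWithinAt_unit hd hx.1 h hy.2
    have := hc.strictMonoOn_deriv hx ⟨hx.1.trans hz.1.le, hz.2.le.trans hy.2⟩ hz.1
    nlinarith
  · obtain ⟨z, hz, h1⟩ := exists_slope_eq_of_hasDerivWithinAt_unit hd hy.1 h hx.2
    have := hc.strictMonoOn_deriv ⟨hy.1.trans hz.1.le, hz.2.le.trans hx.2⟩ hx hz.2
    nlinarith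

theorem tangent_le {x y : ℝ} (hx : x ∈ Icc (0 : ℝ) 1) (hy : y ∈ Icc (0 : ℝ) 1) :
    c x + costDeriv 1 c x * (y - x) ≤ c y := by
  rcases eq_or_ne x y with rfl | h
  · simp
  · exact (hc.tangent_lt hx hy h).le

theorem le_one_of_le {y : ℝ} (hy : y ∈ Icc (0 : ℝ) 1) : c y ≤ costDeriv 1 c y * y := by
  have := hc.tangent_le hy (left_mem_Icc.2 zero_le_one)
  rw [hc.zero] at this
  linarith

/-- The effort `unitInv (costDeriv 1 c) κ` minimizes the total effort cost when failure
costs `κ`. -/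
theorem firstBest_spec {κ : ℝ} (h0 : 0 ≤ κ) (h1 : κ < costDeriv 1 c 1) :
    0 ≤ unitInv (costDeriv 1 c) κ ∧ unitInv (costDeriv 1 c) κ < 1 ∧
      costDeriv 1 c (unitInv (costDeriv 1 c) κ) = κ := by
  obtain ⟨h2, h3⟩ := unitInv_spec (hc.continuousOn_costDeriv (k := 1) (by norm_num))
    hc.deriv_zero ⟨h0, h1.le⟩
  refine ⟨h2.1, lt_of_le_of_ne h2.2 ?_, h3⟩
  intro h
  rw [h] at h3
  exact h1.ne' h3

theorem deriv_two_nonneg {e : ℝ} (he : e ∈ Icc (0 : ℝ) 1) : 0 ≤ costDeriv 2 c e := by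
  have h := hc.hasDerivWithinAt_costDeriv (k := 1) (by norm_num) he
  rw [← h.derivWithin (uniqueDiffOn_Icc_zero_one e he)]
  exact hc.strictMonoOn_deriv.monotoneOn.derivWithin_nonneg

theorem hasDerivWithinAt_infoRent {e : ℝ} (he : e ∈ Icc (0 : ℝ) 1) :
    HasDerivWithinAt (infoRent c) (e * costDeriv 2 c e) (Icc 0 1) e := by
  have h := ((hasDerivWithinAt_id e (Icc 0 1)).mul
    (hc.hasDerivWithinAt_costDeriv (k := 1) (by norm_num) he)).sub (hc.hasDerivWithinAt he)
  exact HasDerivWithinAt.congr_deriv (show HasDerivWithinAt (infoRent c) _ _ e from h)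
    (by simp)

theorem hasDerivWithinAt_rent {e : ℝ} (he : e ∈ Icc (0 : ℝ) 1) :
    HasDerivWithinAt (fun e => e * costDeriv 1 c e) (virtualMarginalCost c e) (Icc 0 1) e := by
  have h := (hasDerivWithinAt_id e (Icc 0 1)).mul
    (hc.hasDerivWithinAt_costDeriv (k := 1) (by norm_num) he)
  exact HasDerivWithinAt.congr_deriv
    (show HasDerivWithinAt (fun e => e * costDeriv 1 c e) _ _ e from h)
    (by simp [virtualMarginalCost])

theorem infoRent_zero : infoRent c 0 = 0 := by simp [infoRent, hc.zero]

theorem infoRent_continuousOn : ContinuousOn (infoRent c) (Icc 0 1) :=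
  fun _ he => (hc.hasDerivWithinAt_infoRent he).continuousWithinAt

theorem virtualMarginalCost_zero : virtualMarginalCost c 0 = 0 := by
  simp [virtualMarginalCost, hc.deriv_zero]

theorem virtualMarginalCost_continuousOn : ContinuousOn (virtualMarginalCost c) (Icc 0 1) :=
  (hc.continuousOn_costDeriv (k := 1) (by norm_num)).add
    (continuousOn_id.mul (hc.continuousOn_costDeriv (k := 2) (by norm_num)))

theorem le_virtualMarginalCost {e : ℝ} (he : e ∈ Icc (0 : ℝ) 1) :
    costDeriv 1 c e ≤ virtualMarginalCost c e := by
  have := mul_nonneg he.1 (hc.deriv_two_nonneg he)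
  simp only [virtualMarginalCost]; linarith

theorem secondBest_spec {κ : ℝ} (h0 : 0 ≤ κ) (h1 : κ < costDeriv 1 c 1) :
    unitInv (virtualMarginalCost c) κ ∈ Icc (0 : ℝ) 1 ∧
      virtualMarginalCost c (unitInv (virtualMarginalCost c) κ) = κ :=
  unitInv_spec hc.virtualMarginalCost_continuousOn hc.virtualMarginalCost_zero
    ⟨h0, h1.le.trans (hc.le_virtualMarginalCost (right_mem_Icc.2 zero_le_one))⟩

section Rent

variable (hr : StrictConvexOn ℝ (Icc 0 1) (fun e => e * costDeriv 1 c e))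
include hr

theorem virtualMarginalCost_strictMonoOn : StrictMonoOn (virtualMarginalCost c) (Icc 0 1) := by
  have h1 := hr.strictMonoOn_derivWithin
    (fun e he => (hc.hasDerivWithinAt_rent he).differentiableWithinAt)
  intro x hx y hy hxy
  have := h1 hx hy hxy
  rwa [(hc.hasDerivWithinAt_rent hx).derivWithin (uniqueDiffOn_Icc_zero_one x hx),
    (hc.hasDerivWithinAt_rent hy).derivWithin (uniqueDiffOn_Icc_zero_one y hy)] at this

/-- Strict convexity of c alone permits isolated zeros of c''; convexity of e c'(e) excludes them.
If c''(e₀) = 0, then e (c'(e₀) - c'(e)) vanishes at 0 and at e₀ although its derivative, a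
difference of values of `virtualMarginalCost`, is positive in between. -/
theorem deriv_two_pos {e₀ : ℝ} (h0 : 0 < e₀) (h1 : e₀ ≤ 1) : 0 < costDeriv 2 c e₀ := by
  have he₀ : e₀ ∈ Icc (0 : ℝ) 1 := ⟨h0.le, h1⟩
  refine lt_of_le_of_ne (hc.deriv_two_nonneg he₀) fun h2 => ?_
  have hd : ∀ e ∈ Icc (0 : ℝ) 1, HasDerivWithinAt
      (fun e => e * (costDeriv 1 c e₀ - costDeriv 1 c e))
      (virtualMarginalCost c e₀ - virtualMarginalCost c e) (Icc 0 1) e := by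
    intro e he
    have h := (hasDerivWithinAt_id e (Icc 0 1)).mul
      ((hc.hasDerivWithinAt_costDeriv (k := 1) (by norm_num) he).const_sub (costDeriv 1 c e₀))
    refine HasDerivWithinAt.congr_deriv (show HasDerivWithinAt
      (fun e => e * (costDeriv 1 c e₀ - costDeriv 1 c e)) _ _ e from h) ?_
    simp only [virtualMarginalCost, ← h2, id]
    ring
  obtain ⟨z, hz, h3⟩ := exists_slope_eq_of_hasDerivWithinAt_unit hd le_rfl h0 h1
  have h4 := hc.virtualMarginalCost_strictMonoOn hr ⟨hz.1.le, hz.2.le.trans h1⟩ he₀ hz.2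
  have h5 := mul_pos (sub_pos.2 h4) h0
  simp at h3
  rcases h3 with h | h <;> linarith

theorem infoRent_strictMonoOn : StrictMonoOn (infoRent c) (Icc 0 1) :=
  strictMonoOn_unit_of_deriv_pos (fun _ he => hc.hasDerivWithinAt_infoRent he)
    fun _ he => mul_pos he.1 (hc.deriv_two_pos hr he.1 he.2.le)

theorem infoRent_pos {e : ℝ} (h0 : 0 < e) (h1 : e ≤ 1) : 0 < infoRent c e := by
  have := hc.infoRent_strictMonoOn hr (left_mem_Icc.2 zero_le_one) ⟨h0.le, h1⟩ h0
  rwa [hc.infoRent_zero] at this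

theorem infoRent_nonneg {e : ℝ} (he : e ∈ Icc (0 : ℝ) 1) : 0 ≤ infoRent c e := by
  have := (hc.infoRent_strictMonoOn hr).monotoneOn (left_mem_Icc.2 zero_le_one) he he.1
  rwa [hc.infoRent_zero] at this

end Rent

end IsEvidenceCost

/-- On either side of a stationary point, a function with increasing derivative is strictly
monotone. -/
theorem lt_of_deriv_strictMonoOn {f f' : ℝ → ℝ}
    (hf : ∀ e ∈ Icc (0 : ℝ) 1, HasDerivWithinAt f (f' e) (Icc 0 1) e)
    (hm : StrictMonoOn f' (Icc 0 1)) {s x y κ : ℝ} (hs : s ∈ Icc (0 : ℝ) 1) (hκ : f' s = κ)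
    (hx : x ∈ Icc (0 : ℝ) 1) (hy : y ∈ Icc (0 : ℝ) 1)
    (h : s ≤ x ∧ x < y ∨ y < x ∧ x ≤ s) : f x - x * κ < f y - y * κ := by
  rcases h with ⟨h1, h2⟩ | ⟨h1, h2⟩
  · obtain ⟨z, hz, h3⟩ := exists_slope_eq_of_hasDerivWithinAt_unit hf hx.1 h2 hy.2
    have := hm hs ⟨hx.1.trans hz.1.le, hz.2.le.trans hy.2⟩ (h1.trans_lt hz.1)
    nlinarith
  · obtain ⟨z, hz, h3⟩ := exists_slope_eq_of_hasDerivWithinAt_unit hf hy.1 h1 hx.2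
    have := hm ⟨hy.1.trans hz.1.le, hz.2.le.trans hx.2⟩ hs (hz.2.trans_le h2)
    nlinarith

/-! ### The marginal value of extra audits -/

/-- The marginal effect on the principal's cost of auditing more, when the agent's utility is fixed
and the refund the principal can pay rises by `M` per unit of audit probability; up to the factor
`e * costDeriv 2 c e`. -/
def auditMargin (c : ℝ → ℝ) (a κ M e : ℝ) : ℝ :=
  a * (e * (1 - e) * costDeriv 2 c e) - (costDeriv 1 c e - κ) * M

theorem IsEvidenceCost.continuousOn_auditMargin {c : ℝ → ℝ} (hc : IsEvidenceCost c) (a κ M : ℝ) :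
    ContinuousOn (auditMargin c a κ M) (Icc 0 1) := by
  have h1 := hc.continuousOn_costDeriv (k := 1) (by norm_num)
  have h2 := hc.continuousOn_costDeriv (k := 2) (by norm_num)
  unfold auditMargin
  fun_prop

namespace AuditProblem.IsValid

variable {P : AuditProblem} (hP : P.IsValid)
include hP

theorem cost_lt_deriv {p : ℝ} (hp : p ∈ Icc (0 : ℝ) 1) : P.cP p < costDeriv 1 P.cA 1 :=
  (hP.cost_principal.le_one hp).trans_lt hP.budget.2

/-- This is where the regularity assumption enters: after division by c'' > 0, the derivative is a
((1 - 2e) + e (1 - e) c'''/c'') - M, and the bounds on `a` and `M` reduce its negativity to that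
assumption. -/
theorem auditMargin_strictAntiOn {a κ M : ℝ} (ha : 0 < a) (ha1 : a ≤ costDeriv 1 P.cP 1)
    (hM : P.xlow + P.τ ≤ M) : StrictAntiOn (auditMargin P.cA a κ M) (Icc 0 1) := by
  have hc := hP.cost_agent
  refine strictAntiOn_of_deriv_neg (convex_Icc 0 1) (hc.continuousOn_auditMargin a κ M) ?_
  intro e he
  rw [interior_Icc] at he
  have heI : e ∈ Icc (0 : ℝ) 1 := Ioo_subset_Icc_self he
  have hn : Icc (0 : ℝ) 1 ∈ nhds e := Icc_mem_nhds he.1 he.2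
  have h1 := (hc.hasDerivWithinAt_costDeriv (k := 1) (by norm_num) heI).hasDerivAt hn
  have h2 := (hc.hasDerivWithinAt_costDeriv (k := 2) (by norm_num) heI).hasDerivAt hn
  have hd : HasDerivAt (auditMargin P.cA a κ M)
      (a * ((1 - 2 * e) * costDeriv 2 P.cA e + e * (1 - e) * costDeriv 3 P.cA e)
        - costDeriv 2 P.cA e * M) e := by
    have h3 := (((((hasDerivAt_id e).mul ((hasDerivAt_id e).const_sub 1)).mul h2).const_mul a).sub
      ((h1.sub_const κ).mul_const M))
    refine HasDerivAt.congr_deriv (show HasDerivAt (auditMargin P.cA a κ M) _ e from h3) ?_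
    simp only [id, Pi.mul_apply]
    ring
  rw [hd.deriv]
  have hpos := hc.deriv_two_pos hP.rent_regularity he.1 he.2.le
  have hreg := hP.regularity e heI
  set g := costDeriv 2 P.cA e
  set t := costDeriv 3 P.cA e
  have hP1 : 0 < costDeriv 1 P.cP 1 := ha.trans_le ha1
  have hL : 0 ≤ P.xlow + P.τ := add_nonneg hP.xlow_nonneg hP.funds_pos.le
  have hQ : (1 - 2 * e) + e * (1 - e) * (t / g) < (P.xlow + P.τ) / costDeriv 1 P.cP 1 := by
    linarith
  have h4 : a * ((1 - 2 * e) + e * (1 - e) * (t / g)) < M := by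
    calc a * ((1 - 2 * e) + e * (1 - e) * (t / g))
        < a * ((P.xlow + P.τ) / costDeriv 1 P.cP 1) := mul_lt_mul_of_pos_left hQ ha
      _ ≤ costDeriv 1 P.cP 1 * ((P.xlow + P.τ) / costDeriv 1 P.cP 1) :=
        mul_le_mul_of_nonneg_right ha1 (div_nonneg hL hP1.le)
      _ = P.xlow + P.τ := by field_simp
      _ ≤ M := hM
  have h5 : t = (t / g) * g := by field_simp
  have h6 : a * ((1 - 2 * e) * g + e * (1 - e) * t) - g * M
      = g * (a * ((1 - 2 * e) + e * (1 - e) * (t / g)) - M) := by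
    rw [h5]; field_simp
  rw [h6]
  exact mul_neg_of_pos_of_neg hpos (by linarith)

end AuditProblem.IsValid

/-- A source of small deviations: a strict bound at e survives at some point strictly beside e and
before `u`. -/
theorem exists_mem_Ioo_right_lt {f : ℝ → ℝ} {a b e u y : ℝ} (hf : ContinuousOn f (Icc a b))
    (hae : a ≤ e) (heu : e < u) (hub : u ≤ b) (hy : f e < y) : ∃ t ∈ Ioo e u, f t < y := by
  have h := (hf e ⟨hae, heu.le.trans hub⟩).mono_of_mem_nhdsWithin
    (show Icc a b ∈ nhdsWithin e (Ioi e) from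
      Filter.mem_of_superset (Ioo_mem_nhdsGT heu) fun t ht =>
        ⟨hae.trans ht.1.le, ht.2.le.trans hub⟩)
  obtain ⟨t, ht1, ht2⟩ := ((h.eventually (gt_mem_nhds hy)).and (Ioo_mem_nhdsGT heu)).exists
  exact ⟨t, ht2, ht1⟩

theorem exists_mem_Ioo_left_lt {f : ℝ → ℝ} {a b e u y : ℝ} (hf : ContinuousOn f (Icc a b))
    (hau : a ≤ u) (hue : u < e) (heb : e ≤ b) (hy : f e < y) : ∃ t ∈ Ioo u e, f t < y := by
  have h := (hf e ⟨hau.trans hue.le, heb⟩).mono_of_mem_nhdsWithin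
    (show Icc a b ∈ nhdsWithin e (Iio e) from
      Filter.mem_of_superset (Ioo_mem_nhdsLT hue) fun t ht =>
        ⟨hau.trans ht.1.le, ht.2.le.trans heb⟩)
  obtain ⟨t, ht1, ht2⟩ := ((h.eventually (gt_mem_nhds hy)).and (Ioo_mem_nhdsLT hue)).exists
  exact ⟨t, ht2, ht1⟩

/-! ### Contracts for a single type -/

/-- The values of a tax mechanism at a single advance payment. -/
structure Contract where
  eA : ℝ
  eP : ℝ
  rA : ℝ
  rP : ℝ
  r0 : ℝ

namespace Contract

variable (P : AuditProblem) (c : Contract)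

/-- Expected refund without evidence of the agent. -/
def refundNA : ℝ := c.eP * c.rP + (1 - c.eP) * c.r0

/-- Utility of the truthful agent. -/
def utility : ℝ := c.refundNA + (c.eA * (c.rA - c.refundNA) - P.cA c.eA)

/-- Expected cost of the contract for the principal. -/
def cost : ℝ := c.utility P + P.cA c.eA + (1 - c.eA) * P.cP c.eP

/-- The contract is feasible for type `x`, makes the recommended effort optimal, grants at least
`w x`, and grants at most `w z` to every higher type `z` who mimics `x`. -/
structure IsAdmissible (w : ℝ → ℝ) (x : ℝ) : Prop where
  eA_mem : c.eA ∈ Icc (0 : ℝ) 1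
  eP_mem : c.eP ∈ Icc (0 : ℝ) 1
  rA_mem : c.rA ∈ Icc 0 (x + P.τ)
  rP_mem : c.rP ∈ Icc 0 (x + P.τ)
  r0_mem : c.r0 ∈ Icc 0 (x + P.τ)
  obedient : ∀ e ∈ Icc (0 : ℝ) 1, c.refundNA + (e * (c.rA - c.refundNA) - P.cA e) ≤ c.utility P
  floor : w x ≤ c.utility P
  line : ∀ z ∈ Icc x P.xhigh, (1 - c.eP) * (z - x + c.r0) ≤ w z

end Contract

/-! ### Mechanisms as families of admissible contracts -/

namespace TaxMechanism

/-- The contract offered after the advance payment `x`. -/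
def contract (m : TaxMechanism) (x : ℝ) : Contract := ⟨m.eA x, m.eP x, m.rA x, m.rP x, m.r0 x⟩

/-- The mechanism made of given contracts. -/
def ofContracts (f : ℝ → Contract) : TaxMechanism :=
  ⟨fun x => (f x).eA, fun x => (f x).eP, fun x => (f x).rA, fun x => (f x).rP, fun x => (f x).r0⟩

variable {P : AuditProblem} {m : TaxMechanism}

theorem contract_ofContracts (f : ℝ → Contract) (x : ℝ) : (ofContracts f).contract x = f x := rfl

theorem utility_contract (x : ℝ) : (m.contract x).utility P = utility P m x := rfl

theorem profit_eq (x : ℝ) : profit P m x = x - (m.contract x).cost P := by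
  simp only [profit, Contract.cost, Contract.utility, Contract.refundNA, contract, refundNA,
    evidenceRent]
  ring

/-- The highest utility that type `x` can get from concealing surplus. -/
def concealment (P : AuditProblem) (m : TaxMechanism) (x : ℝ) : ℝ := x - loss P m x

theorem bddBelow_loss (hP : P.IsValid) (hm : IsFeasible P m) {x : ℝ} (hx : x ∈ P.types) :
    BddBelow ((fun y => m.eP y * x + (1 - m.eP y) * (y - m.r0 y)) '' Icc P.xlow x) := by
  refine ⟨-P.τ, ?_⟩
  rintro _ ⟨y, hy, rfl⟩
  have hyT : y ∈ P.types := ⟨hy.1, hy.2.trans hx.2⟩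
  have h1 := hm.eP_mem y hyT
  have h2 := hm.r0_mem y hyT
  have h3 : 0 ≤ x := hP.xlow_nonneg.trans hx.1
  have h4 := hP.funds_pos
  have h5 := mul_nonneg h1.1 (show 0 ≤ x + P.τ by linarith)
  have h6 := mul_nonneg (sub_nonneg.2 h1.2) (show 0 ≤ y - m.r0 y + P.τ by linarith [h2.2])
  show -P.τ ≤ m.eP y * x + (1 - m.eP y) * (y - m.r0 y)
  nlinarith

theorem le_concealment (hP : P.IsValid) (hm : IsFeasible P m) {x z : ℝ} (hx : P.xlow ≤ x)
    (hxz : x ≤ z) (hz : z ≤ P.xhigh) :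
    (1 - m.eP x) * (z - x + m.r0 x) ≤ concealment P m z := by
  have := csInf_le (bddBelow_loss hP hm ⟨hx.trans hxz, hz⟩) ⟨x, ⟨hx, hxz⟩, rfl⟩
  have h2 : loss P m z ≤ m.eP x * z + (1 - m.eP x) * (x - m.r0 x) := this
  unfold concealment
  linarith

theorem concealment_le {x u : ℝ} (hx : P.xlow ≤ x)
    (h : ∀ y ∈ Icc P.xlow x, (1 - m.eP y) * (x - y + m.r0 y) ≤ u) : concealment P m x ≤ u := by
  have : x - u ≤ loss P m x := by
    refine le_csInf ((nonempty_Icc.2 hx).image _) ?_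
    rintro _ ⟨y, hy, rfl⟩
    have := h y hy
    show x - u ≤ m.eP y * x + (1 - m.eP y) * (y - m.r0 y)
    linarith
  unfold concealment
  linarith

theorem concealment_xlow : concealment P m P.xlow = (1 - m.eP P.xlow) * m.r0 P.xlow := by
  simp only [concealment, loss, Icc_self, image_singleton, csInf_singleton]
  ring

/-- Obedience comes from truthful deviations in effort, the floor from underreporting without effort
or disclosure, and the line from the infimum that defines `loss`. -/
theorem IsMechanism.isAdmissible (hP : P.IsValid) (hm : IsMechanism P m) {x : ℝ}
    (hx : x ∈ P.types) : (m.contract x).IsAdmissible P (concealment P m) x := by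
  have hnot : ¬ x < P.xlow := not_lt.mpr hx.1
  have hobed : ∀ e ∈ Icc (0 : ℝ) 1, (m.contract x).refundNA +
      (e * ((m.contract x).rA - (m.contract x).refundNA) - P.cA e) ≤
        (m.contract x).utility P := by
    intro e he
    have h1 := hm.2 x hx x ⟨hP.xlow_nonneg.trans hx.1, le_rfl⟩ e he true
    rw [agentPayoff_truthful P m hx] at h1
    rw [utility_contract]
    refine le_trans (le_of_eq ?_) h1
    simp only [agentPayoff, auditProb, contract, Contract.refundNA, hnot, if_true, if_false]
    ring
  have h0 : (0 : ℝ) ∈ Icc (0 : ℝ) 1 := left_mem_Icc.2 zero_le_one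
  refine ⟨hm.1.eA_mem x hx, hm.1.eP_mem x hx, hm.1.rA_mem x hx, hm.1.rP_mem x hx,
    hm.1.r0_mem x hx, hobed, ?_, ?_⟩
  · refine concealment_le hx.1 fun y hy => ?_
    have hyT : y ∈ P.types := ⟨hy.1, hy.2.trans hx.2⟩
    rcases eq_or_ne y x with rfl | hyx
    · have h1 := hobed 0 h0
      rw [hP.cost_agent.zero] at h1
      refine le_trans ?_ h1
      have h2 := mul_nonneg (hm.1.eP_mem y hyT).1 (hm.1.rP_mem y hyT).1
      simp only [contract, Contract.refundNA]
      linarith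
    · have h1 := hm.2 x hx y ⟨hP.xlow_nonneg.trans hy.1, hy.2⟩ 0 h0 false
      rw [agentPayoff_truthful P m hx] at h1
      rw [utility_contract]
      refine le_trans (le_of_eq ?_) h1
      simp only [agentPayoff, auditProb, hyx, not_lt.mpr hy.1, hP.cost_agent.zero, if_false,
        Bool.false_eq_true]
      ring
  · intro z hz
    exact le_concealment hP hm.1 hx.1 hz.1 hz.2

/-- The function `w` separates the types: a mimic's payoff is at most `w x`, and `w x` is at most
the truthful utility. It need not be the concealment payoff of `m`, only an upper bound for it, so
any convenient `w` can be used to build mechanisms. -/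
theorem isMechanism_of_isAdmissible (hP : P.IsValid) {w : ℝ → ℝ}
    (h : ∀ x ∈ P.types, (m.contract x).IsAdmissible P w x) : IsMechanism P m := by
  have h0 : (0 : ℝ) ∈ Icc (0 : ℝ) 1 := left_mem_Icc.2 zero_le_one
  refine ⟨⟨fun y hy => (h y hy).eA_mem, fun y hy => (h y hy).eP_mem, fun y hy => (h y hy).rA_mem,
    fun y hy => (h y hy).rP_mem, fun y hy => (h y hy).r0_mem⟩, ?_⟩
  intro x hx y hy e he d
  rw [agentPayoff_truthful P m hx]
  have hu := (h x hx).obedient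
  rw [utility_contract] at hu
  have hR : 0 ≤ (m.contract x).refundNA :=
    add_nonneg (mul_nonneg (h x hx).eP_mem.1 (h x hx).rP_mem.1)
      (mul_nonneg (sub_nonneg.2 (h x hx).eP_mem.2) (h x hx).r0_mem.1)
  have hu0 := hu 0 h0
  rw [hP.cost_agent.zero] at hu0
  have hce := hP.cost_agent.nonneg he
  have hnot : ¬ x < P.xlow := not_lt.mpr hx.1
  rcases eq_or_ne y x with rfl | hyx
  · cases d
    · simp only [agentPayoff, auditProb, hnot, if_true, if_false]
      simp only [contract, Contract.refundNA] at hu0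
      simp
      linarith
    · refine le_trans (le_of_eq ?_) (hu e he)
      simp only [agentPayoff, auditProb, contract, Contract.refundNA, hnot, if_true, if_false]
      ring
  · by_cases hlow : y < P.xlow
    · simp [agentPayoff, auditProb, hyx, hlow]
      linarith
    · have hyT : y ∈ P.types := ⟨not_lt.1 hlow, hy.2.trans hx.2⟩
      have h1 := ((h y hyT).line x ⟨hy.2, hx.2⟩).trans (h x hx).floor
      rw [utility_contract] at h1
      have h2 : 0 ≤ (1 - m.eP y) * (x - y + m.r0 y) :=
        mul_nonneg (sub_nonneg.2 (h y hyT).eP_mem.2)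
          (add_nonneg (sub_nonneg.2 hy.2) (h y hyT).r0_mem.1)
      have h3 : (1 - m.eP y) * (x - y + m.r0 y) ≤ utility P m x := h1
      cases d
      · simp [agentPayoff, auditProb, hyx, hlow]
        linarith
      · simp [agentPayoff, auditProb, hyx, hlow]
        have h4 := mul_nonneg he.1 h2
        linarith

theorem concealment_le_of_isAdmissible {w : ℝ → ℝ}
    (h : ∀ x ∈ P.types, (m.contract x).IsAdmissible P w x) {x : ℝ} (hx : x ∈ P.types) :
    concealment P m x ≤ w x :=
  concealment_le hx.1 fun y hy => (h y ⟨hy.1, hy.2.trans hx.2⟩).line x ⟨hy.2, hx.2⟩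

end TaxMechanism

/-! ### The reduced problem -/

/-- For type `x`, the efforts `e` of the agent and `p` of the principal and the expected refund `R`
without evidence of the agent, of which `h` is paid without any evidence, are part of an admissible
contract. -/
structure IsImplementable (P : AuditProblem) (w : ℝ → ℝ) (x e p R h : ℝ) : Prop where
  e_mem : e ∈ Icc (0 : ℝ) 1
  p_mem : p ∈ Icc (0 : ℝ) 1
  h_nonneg : 0 ≤ h
  h_le : h ≤ R
  sub_le : R - h ≤ p * (x + P.τ)
  h_le_mul : h ≤ (1 - p) * (x + P.τ)
  budget : R + costDeriv 1 P.cA e ≤ x + P.τ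
  floor : w x ≤ R + infoRent P.cA e
  line : ∀ z ∈ Icc x P.xhigh, h + (1 - p) * (z - x) ≤ w z

/-- The principal's cost in the reduced problem. -/
def reducedCost (P : AuditProblem) (e p R : ℝ) : ℝ :=
  R + e * costDeriv 1 P.cA e + (1 - e) * P.cP p

namespace AuditProblem.IsValid

variable {P : AuditProblem} (hP : P.IsValid)
include hP

theorem types_nonneg {x : ℝ} (hx : x ∈ P.types) : 0 ≤ x := hP.xlow_nonneg.trans hx.1

/-- Paying the agent `R + costDeriv 1 P.cA e` for evidence makes `e` optimal, because the agent's
problem is concave; R is split into refunds by dividing by the probabilities of payment. -/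
theorem exists_contract {w : ℝ → ℝ} {x e p R h : ℝ} (hx : x ∈ P.types)
    (H : IsImplementable P w x e p R h) :
    ∃ c : Contract, c.IsAdmissible P w x ∧ c.cost P = reducedCost P e p R := by
  have hA := hP.cost_agent
  have hxτ : 0 ≤ x + P.τ := add_nonneg (hP.types_nonneg hx) hP.funds_pos.le
  -- Division by zero is harmless: `p = 0` forces `R = h`, and in the same way `1 - p = 0` forces `h
  -- = 0`.
  have h1 : p * ((R - h) / p) = R - h := by
    rcases eq_or_ne p 0 with hp | hp
    · have h1 := H.sub_le
      have h2 := H.h_le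
      rw [hp, zero_mul] at h1
      rw [hp, zero_mul]
      linarith
    · rw [mul_div_cancel₀ _ hp]
  have h2 : (1 - p) * (h / (1 - p)) = h := by
    rcases eq_or_ne (1 - p) 0 with hp | hp
    · have h1 := H.h_le_mul
      have h2 := H.h_nonneg
      rw [hp, zero_mul] at h1
      rw [hp, zero_mul]
      linarith
    · rw [mul_div_cancel₀ _ hp]
  have hR : 0 ≤ R := H.h_nonneg.trans H.h_le
  have ha1 := hA.deriv_nonneg H.e_mem
  let c : Contract := ⟨e, p, R + costDeriv 1 P.cA e, (R - h) / p, h / (1 - p)⟩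
  have hcR : c.refundNA = R := by
    simp only [Contract.refundNA, c]
    rw [h1, h2]; ring
  have hU : c.utility P = R + infoRent P.cA e := by
    rw [Contract.utility, hcR]
    simp only [infoRent, c]
    ring
  refine ⟨c, ⟨H.e_mem, H.p_mem, ⟨add_nonneg hR ha1, H.budget⟩, ⟨?_, ?_⟩, ⟨?_, ?_⟩, ?_, ?_, ?_⟩,
    ?_⟩
  · exact div_nonneg (sub_nonneg.2 H.h_le) H.p_mem.1
  · exact div_le_of_le_mul₀ H.p_mem.1 hxτ (by linarith [H.sub_le])
  · exact div_nonneg H.h_nonneg (sub_nonneg.2 H.p_mem.2)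
  · exact div_le_of_le_mul₀ (sub_nonneg.2 H.p_mem.2) hxτ (by linarith [H.h_le_mul])
  · intro t ht
    rw [hU, hcR]
    have := hA.tangent_le H.e_mem ht
    simp only [infoRent, c]
    linarith
  · rw [hU]; exact H.floor
  · intro z hz
    have := H.line z hz
    show (1 - p) * (z - x + h / (1 - p)) ≤ w z
    rw [mul_add, h2]
    linarith
  · rw [Contract.cost, hU]
    simp only [reducedCost, infoRent, c]
    ring

end AuditProblem.IsValid

/-! ### First-order conditions for the agent's effort -/

namespace Contract.IsAdmissible

variable {P : AuditProblem} {w : ℝ → ℝ} {x : ℝ} {c : Contract}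
  (H : c.IsAdmissible P w x) (hP : P.IsValid)
include H

theorem refundNA_nonneg : 0 ≤ c.refundNA :=
  add_nonneg (mul_nonneg H.eP_mem.1 H.rP_mem.1)
    (mul_nonneg (sub_nonneg.2 H.eP_mem.2) H.r0_mem.1)

theorem refundNA_le : c.refundNA ≤ x + P.τ := by
  have h1 := mul_le_mul_of_nonneg_left H.rP_mem.2 H.eP_mem.1
  have h2 := mul_le_mul_of_nonneg_left H.r0_mem.2 (sub_nonneg.2 H.eP_mem.2)
  simp only [refundNA]
  linarith

include hP

theorem refundNA_le_utility : c.refundNA ≤ c.utility P := by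
  have := H.obedient 0 (left_mem_Icc.2 zero_le_one)
  rw [hP.cost_agent.zero] at this
  linarith

/-- Lowering effort from `c.eA` to `e` does not pay; comparing the costs by the tangent at `e`
bounds the slope of the reward. -/
theorem deriv_le_of_lt {e : ℝ} (h0 : 0 ≤ e) (h : e < c.eA) :
    costDeriv 1 P.cA e ≤ c.rA - c.refundNA := by
  have he : e ∈ Icc (0 : ℝ) 1 := ⟨h0, h.le.trans H.eA_mem.2⟩
  have h1 := H.obedient e he
  have h2 := hP.cost_agent.tangent_le he H.eA_mem
  simp only [utility] at h1
  refine le_of_mul_le_mul_right ?_ (sub_pos.2 h)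
  linarith

theorem le_deriv_of_lt {e : ℝ} (h0 : e ≤ 1) (h : c.eA < e) :
    c.rA - c.refundNA ≤ costDeriv 1 P.cA e := by
  have he : e ∈ Icc (0 : ℝ) 1 := ⟨H.eA_mem.1.trans h.le, h0⟩
  have h1 := H.obedient e he
  have h2 := hP.cost_agent.tangent_le he H.eA_mem
  simp only [utility] at h1
  refine le_of_mul_le_mul_right ?_ (sub_pos.2 h)
  linarith

theorem deriv_le (h : 0 < c.eA) : costDeriv 1 P.cA c.eA ≤ c.rA - c.refundNA := by
  by_contra! hlt
  obtain ⟨t, ht, h2⟩ := exists_mem_Ioo_left_lt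
    (hP.cost_agent.continuousOn_costDeriv (k := 1) (by norm_num)).neg le_rfl h H.eA_mem.2
    (neg_lt_neg hlt)
  have := H.deriv_le_of_lt hP ht.1.le ht.2
  rw [Pi.neg_apply] at h2
  linarith

theorem le_deriv (h : c.eA < 1) : c.rA - c.refundNA ≤ costDeriv 1 P.cA c.eA := by
  by_contra! hlt
  obtain ⟨t, ht, h2⟩ := exists_mem_Ioo_right_lt
    (hP.cost_agent.continuousOn_costDeriv (k := 1) (by norm_num)) H.eA_mem.1 h le_rfl hlt
  have := H.le_deriv_of_lt hP ht.2.le ht.1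
  linarith

theorem mul_deriv_le : c.eA * costDeriv 1 P.cA c.eA ≤ c.eA * (c.rA - c.refundNA) := by
  rcases H.eA_mem.1.eq_or_lt with h | h
  · rw [← h]; simp
  · exact mul_le_mul_of_nonneg_left (H.deriv_le hP h) h.le

theorem reducedCost_le : reducedCost P c.eA c.eP c.refundNA ≤ c.cost P := by
  have := H.mul_deriv_le hP
  simp only [reducedCost, cost, utility]
  linarith

/-- At effort one the reward may exceed marginal cost, so the rent is determined by effort only
below one. At effort zero both sides of the first-order condition are multiplied by zero. -/
theorem utility_eq (h : c.eA < 1) : c.utility P = c.refundNA + infoRent P.cA c.eA := by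
  have : c.eA * (c.rA - c.refundNA) = c.eA * costDeriv 1 P.cA c.eA := by
    refine le_antisymm ?_ (H.mul_deriv_le hP)
    exact mul_le_mul_of_nonneg_left (H.le_deriv hP h) H.eA_mem.1
  simp only [utility, infoRent, this]

theorem cost_eq (h : c.eA < 1) : c.cost P = reducedCost P c.eA c.eP c.refundNA := by
  rw [cost, H.utility_eq hP h]
  simp only [reducedCost, infoRent]
  ring

theorem isImplementable (h : c.eA < 1) :
    IsImplementable P w x c.eA c.eP c.refundNA ((1 - c.eP) * c.r0) := by
  refine ⟨H.eA_mem, H.eP_mem, mul_nonneg (sub_nonneg.2 H.eP_mem.2) H.r0_mem.1, ?_, ?_, ?_, ?_, ?_,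
    ?_⟩
  · have := mul_nonneg H.eP_mem.1 H.rP_mem.1
    simp only [refundNA]; linarith
  · have := mul_le_mul_of_nonneg_left H.rP_mem.2 H.eP_mem.1
    simp only [refundNA]; linarith
  · exact mul_le_mul_of_nonneg_left H.r0_mem.2 (sub_nonneg.2 H.eP_mem.2)
  · rcases H.eA_mem.1.eq_or_lt with h0 | h0
    · rw [← h0, hP.cost_agent.deriv_zero, add_zero]
      exact H.refundNA_le
    · have := H.deriv_le hP h0
      linarith [H.rA_mem.2]
  · rw [← H.utility_eq hP h]; exact H.floor
  · intro z hz
    have := H.line z hz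
    linarith

end Contract.IsAdmissible

theorem Contract.IsAdmissible.cost_mem {P : AuditProblem} (hP : P.IsValid) {w : ℝ → ℝ} {x : ℝ}
    {c : Contract} (H : c.IsAdmissible P w x) : c.cost P ∈ Icc 0 (x + P.τ + P.cP 1) := by
  have h1 := mul_nonneg (sub_nonneg.2 H.eA_mem.2) H.refundNA_nonneg
  have h2 := mul_nonneg H.eA_mem.1 H.rA_mem.1
  have h3 := mul_le_mul_of_nonneg_left H.refundNA_le (sub_nonneg.2 H.eA_mem.2)
  have h4 := mul_le_mul_of_nonneg_left H.rA_mem.2 H.eA_mem.1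
  have h5 := hP.cost_principal.nonneg H.eP_mem
  have h6 := hP.cost_principal.le_one H.eP_mem
  have h7 := mul_nonneg (sub_nonneg.2 H.eA_mem.2) h5
  have h8 := mul_nonneg H.eA_mem.1 h5
  simp only [Contract.cost, Contract.utility, mem_Icc]
  constructor <;> linarith

/-! ### Compactness and measurability of pointwise optima -/

/-- Restriction of the argument to `[a, b]`. -/
def clamp (a b t : ℝ) : ℝ := max a (min b t)

theorem clamp_of_mem {a b t : ℝ} (ht : t ∈ Icc a b) : clamp a b t = t := by
  rw [clamp, min_eq_right ht.2, max_eq_right ht.1]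

theorem continuous_comp_clamp {f : ℝ → ℝ} {a b : ℝ} (hab : a ≤ b) (hf : ContinuousOn f (Icc a b)) :
    Continuous (fun t => f (clamp a b t)) :=
  hf.comp_continuous (by unfold clamp; fun_prop)
    fun t => ⟨le_max_left _ _, max_le hab (min_le_left _ _)⟩

/-- A contract with a type, as a point of `ℝ⁶`. -/
def Contract.ofTuple (q : ℝ × ℝ × ℝ × ℝ × ℝ × ℝ) : Contract :=
  ⟨q.2.1, q.2.2.1, q.2.2.2.1, q.2.2.2.2.1, q.2.2.2.2.2⟩

/-- The pairs of a type and an admissible contract. -/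
def admissibleTuples (P : AuditProblem) (w : ℝ → ℝ) : Set (ℝ × ℝ × ℝ × ℝ × ℝ × ℝ) :=
  {q | q.1 ∈ P.types ∧ (Contract.ofTuple q).IsAdmissible P w q.1}

section Compact

variable {P : AuditProblem} (hP : P.IsValid) {w : ℝ → ℝ} (hw : ContinuousOn w P.types)
include hP

theorem continuousOn_cost_ofTuple :
    ContinuousOn (fun q => (Contract.ofTuple q).cost P) (admissibleTuples P w) := by
  have hA := continuous_comp_clamp zero_le_one hP.cost_agent.continuousOn
  have hB := continuous_comp_clamp zero_le_one hP.cost_principal.continuousOn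
  have : Continuous fun q : ℝ × ℝ × ℝ × ℝ × ℝ × ℝ => (Contract.ofTuple q).refundNA +
      (q.2.1 * (q.2.2.2.1 - (Contract.ofTuple q).refundNA)
        - P.cA (clamp 0 1 q.2.1)) + P.cA (clamp 0 1 q.2.1)
      + (1 - q.2.1) * P.cP (clamp 0 1 q.2.2.1) := by
    have h1 := hA.comp (continuous_fst.comp (continuous_snd (X := ℝ) (Y := ℝ × ℝ × ℝ × ℝ × ℝ)))
    have h2 := hB.comp (continuous_fst.comp (continuous_snd.comp
      (continuous_snd (X := ℝ) (Y := ℝ × ℝ × ℝ × ℝ × ℝ))))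
    simp only [Function.comp_def] at h1 h2
    simp only [Contract.refundNA, Contract.ofTuple]
    fun_prop
  refine this.continuousOn.congr ?_
  rintro q ⟨-, hq⟩
  have h1 : clamp 0 1 q.2.1 = q.2.1 := clamp_of_mem hq.eA_mem
  have h2 : clamp 0 1 q.2.2.1 = q.2.2.1 := clamp_of_mem hq.eP_mem
  simp only [h1, h2, Contract.cost, Contract.utility]
  rfl

include hw

/-- All constraints are closed inside a box. Composition with `clamp` turns functions that are
continuous only on an interval into continuous functions on the whole line. -/
theorem isCompact_admissibleTuples : IsCompact (admissibleTuples P w) := by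
  have hLH := hP.xlow_lt_xhigh.le
  have hA := continuous_comp_clamp zero_le_one hP.cost_agent.continuousOn
  have hW := continuous_comp_clamp hLH hw
  have h1 := hA.comp (continuous_fst.comp (continuous_snd (X := ℝ) (Y := ℝ × ℝ × ℝ × ℝ × ℝ)))
  have h2 := hW.comp (continuous_fst (X := ℝ) (Y := ℝ × ℝ × ℝ × ℝ × ℝ))
  have h3 : ∀ z : ℝ, Continuous fun q : ℝ × ℝ × ℝ × ℝ × ℝ × ℝ =>
      w (clamp P.xlow P.xhigh (max z q.1)) := fun z =>
    hW.comp (continuous_const.max continuous_fst)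
  simp only [Function.comp_def] at h1 h2
  let box : Set (ℝ × ℝ × ℝ × ℝ × ℝ × ℝ) := P.types ×ˢ (Icc (0 : ℝ) 1 ×ˢ (Icc (0 : ℝ) 1 ×ˢ
    (Icc 0 (P.xhigh + P.τ) ×ˢ (Icc 0 (P.xhigh + P.τ) ×ˢ Icc 0 (P.xhigh + P.τ)))))
  have hbox : IsCompact box := isCompact_Icc.prod (isCompact_Icc.prod (isCompact_Icc.prod
    (isCompact_Icc.prod (isCompact_Icc.prod isCompact_Icc))))
  let U : ℝ × ℝ × ℝ × ℝ × ℝ × ℝ → ℝ := fun q => (Contract.ofTuple q).refundNA +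
    (q.2.1 * (q.2.2.2.1 - (Contract.ofTuple q).refundNA) - P.cA (clamp 0 1 q.2.1))
  have hR : Continuous fun q => (Contract.ofTuple q).refundNA := by
    simp only [Contract.refundNA, Contract.ofTuple]; fun_prop
  have hU : Continuous U := by
    simp only [U]; fun_prop
  -- The range `Icc x P.xhigh` of the line constraint depends on the type `x = q.1`; writing `max z
  -- q.1` with `z` in the fixed type space makes the constraint an intersection of closed
  -- conditions.
  let S : Set (ℝ × ℝ × ℝ × ℝ × ℝ × ℝ) :=
    {q | q.2.2.2.1 ≤ q.1 + P.τ ∧ q.2.2.2.2.1 ≤ q.1 + P.τ ∧ q.2.2.2.2.2 ≤ q.1 + P.τ ∧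
      (∀ e ∈ Icc (0 : ℝ) 1, (Contract.ofTuple q).refundNA +
        (e * (q.2.2.2.1 - (Contract.ofTuple q).refundNA) - P.cA e) ≤ U q) ∧
      w (clamp P.xlow P.xhigh q.1) ≤ U q ∧
      ∀ z ∈ P.types, (1 - q.2.2.1) * (max z q.1 - q.1 + q.2.2.2.2.2)
        ≤ w (clamp P.xlow P.xhigh (max z q.1))}
  have hS : IsClosed S := by
    simp only [S, ofPred_and, ofPred_forall]
    refine (isClosed_le (by fun_prop) (by fun_prop)).inter ((isClosed_le (by fun_prop)
      (by fun_prop)).inter ((isClosed_le (by fun_prop) (by fun_prop)).inter (IsClosed.inter ?_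
        ((isClosed_le h2 hU).inter ?_))))
    · exact isClosed_iInter fun e => isClosed_iInter fun _ => isClosed_le (by fun_prop) hU
    · exact isClosed_iInter fun z => isClosed_iInter fun _ => isClosed_le (by fun_prop) (h3 z)
  convert hbox.inter_right hS using 1
  ext q
  constructor
  · rintro ⟨hq, H⟩
    have hx : q.1 + P.τ ≤ P.xhigh + P.τ := by linarith [hq.2]
    have hUq : U q = (Contract.ofTuple q).utility P := by
      have : clamp 0 1 q.2.1 = q.2.1 := clamp_of_mem H.eA_mem
      simp only [U, this]; rfl
    refine ⟨⟨hq, H.eA_mem, H.eP_mem, ⟨H.rA_mem.1, H.rA_mem.2.trans hx⟩,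
      ⟨H.rP_mem.1, H.rP_mem.2.trans hx⟩, ⟨H.r0_mem.1, H.r0_mem.2.trans hx⟩⟩,
      H.rA_mem.2, H.rP_mem.2, H.r0_mem.2, ?_, ?_, ?_⟩
    · rw [hUq]; exact H.obedient
    · rw [hUq, clamp_of_mem hq]; exact H.floor
    · intro z hz
      rw [clamp_of_mem ⟨hq.1.trans (le_max_right _ _), max_le hz.2 hq.2⟩]
      exact H.line _ ⟨le_max_right _ _, max_le hz.2 hq.2⟩
  · rintro ⟨⟨hq, heA, heP, hrA, hrP, hr0⟩, h4, h5, h6, h7, h8, h9⟩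
    have hUq : U q = (Contract.ofTuple q).utility P := by
      have : clamp 0 1 q.2.1 = q.2.1 := clamp_of_mem heA
      simp only [U, this]; rfl
    refine ⟨hq, heA, heP, ⟨hrA.1, h4⟩, ⟨hrP.1, h5⟩, ⟨hr0.1, h6⟩, ?_, ?_, ?_⟩
    · rw [hUq] at h7; exact h7
    · rw [hUq, clamp_of_mem hq] at h8; exact h8
    · intro z hz
      have hzT : z ∈ P.types := ⟨hq.1.trans hz.1, hz.2⟩
      have := h9 z hzT
      rwa [max_eq_left hz.1, clamp_of_mem hzT] at this

/-- Choosing the best admissible contract for each type yields a mechanism with measurable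
profit. -/
theorem exists_best_mechanism (hne : ∀ x ∈ P.types, ∃ c : Contract, c.IsAdmissible P w x) :
    ∃ m : TaxMechanism, TaxMechanism.IsMechanism P m ∧ TaxMechanism.HasMeasurableProfit P m ∧
      ∀ x ∈ P.types, ∀ c : Contract, c.IsAdmissible P w x →
        x - c.cost P ≤ TaxMechanism.profit P m x := by
  have hK := isCompact_admissibleTuples hP hw
  have hcont := continuousOn_cost_ofTuple hP (w := w)
  have hbest : ∀ x : ℝ, ∃ c : Contract, x ∈ P.types → c.IsAdmissible P w x ∧
      ∀ c' : Contract, c'.IsAdmissible P w x → c.cost P ≤ c'.cost P := by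
    intro x
    by_cases hx : x ∈ P.types
    · obtain ⟨c, hc⟩ := hne x hx
      have hKx : IsCompact (admissibleTuples P w ∩ {q | q.1 = x}) :=
        hK.inter_right (isClosed_eq continuous_fst continuous_const)
      obtain ⟨q, hq, hmin⟩ := hKx.exists_isMinOn
        ⟨(x, c.eA, c.eP, c.rA, c.rP, c.r0), ⟨hx, hc⟩, rfl⟩ (hcont.mono inter_subset_left)
      refine ⟨Contract.ofTuple q, fun _ => ⟨?_, fun c' hc' => ?_⟩⟩
      · have h2 : q.1 = x := hq.2
        rw [← h2]; exact hq.1.2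
      · exact hmin (show (x, c'.eA, c'.eP, c'.rA, c'.rP, c'.r0) ∈ _ from ⟨⟨hx, hc'⟩, rfl⟩)
    · exact ⟨⟨0, 0, 0, 0, 0⟩, fun h => absurd h hx⟩
  choose f hf using hbest
  have hfm := TaxMechanism.isMechanism_of_isAdmissible (m := TaxMechanism.ofContracts f) hP
    (fun x hx => (hf x hx).1)
  refine ⟨TaxMechanism.ofContracts f, hfm, ?_, fun x hx c hc => ?_⟩
  -- A superlevel set of the best profit is the projection of a compact set of tuples, hence closed.
  -- No measurable selection of the contracts themselves is needed.
  · refine measurable_of_Ici fun k => ?_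
    have hC : IsCompact (Prod.fst '' (admissibleTuples P w ∩
        (fun q => q.1 - (Contract.ofTuple q).cost P) ⁻¹' Ici k)) := by
      have h1 : ContinuousOn (fun q => q.1 - (Contract.ofTuple q).cost P)
          (admissibleTuples P w) := continuous_fst.continuousOn.sub hcont
      have h2 : IsCompact (admissibleTuples P w ∩
          (fun q => q.1 - (Contract.ofTuple q).cost P) ⁻¹' Ici k) :=
        hK.of_isClosed_subset (h1.preimage_isClosed_of_isClosed hK.isClosed isClosed_Ici)
          inter_subset_left
      exact h2.image continuous_fst
    convert measurable_subtype_coe hC.isClosed.measurableSet using 1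
    ext ⟨x, hx⟩
    simp only [mem_preimage, mem_Ici, TaxMechanism.profit_eq, TaxMechanism.contract_ofContracts,
      mem_image]
    constructor
    · intro h
      exact ⟨(x, (f x).eA, (f x).eP, (f x).rA, (f x).rP, (f x).r0), ⟨⟨hx, (hf x hx).1⟩, h⟩, rfl⟩
    · rintro ⟨q, ⟨⟨h1, h2⟩, h3⟩, rfl⟩
      have := (hf q.1 hx).2 _ h2
      simp only [mem_preimage, mem_Ici] at h3
      linarith
  · rw [TaxMechanism.profit_eq, TaxMechanism.contract_ofContracts]
    linarith [(hf x hx).2 c hc]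

end Compact

/-! ### Perturbations of an optimal mechanism -/

namespace TaxMechanism

variable {P : AuditProblem} {m : TaxMechanism}

theorem IsMechanism.integrableOn_profit (hP : P.IsValid) (hm : IsMechanism P m)
    (hmeas : HasMeasurableProfit P m) : IntegrableOn (profit P m) P.types P.F := by
  have := hP.isProbabilityMeasure
  have hms : MeasurableSet P.types := measurableSet_Icc
  refine Integrable.of_bound
    (aemeasurable_restrict_of_measurable_subtype hms hmeas).aestronglyMeasurable
    (P.xhigh + P.τ + P.cP 1) ?_
  filter_upwards [ae_restrict_mem hms] with x hx
  have h1 := (hm.isAdmissible hP hx).cost_mem hP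
  have h2 := hP.cost_principal.nonneg (right_mem_Icc.2 (zero_le_one' ℝ))
  have h3 := hP.funds_pos
  have h4 := hP.types_nonneg hx
  rw [Real.norm_eq_abs, profit_eq, abs_le]
  constructor <;> linarith [h1.1, h1.2, hx.2]

/-- If contracts that are admissible for some continuous function `w` improve on an optimal
mechanism by `g`, then `g` is not positive on average. -/
theorem IsOptimal.setIntegral_nonpos (hP : P.IsValid) (hF : P.F {P.xhigh} = 0)
    (hm : IsOptimal P m) {w g : ℝ → ℝ} (hw : ContinuousOn w P.types)
    (hg : IntegrableOn g P.types P.F)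
    (h : ∀ x ∈ P.types, ∃ e p R h, IsImplementable P w x e p R h ∧
      (x ≠ P.xhigh → reducedCost P e p R + g x ≤ (m.contract x).cost P)) :
    ∫ x in P.types, g x ∂P.F ≤ 0 := by
  obtain ⟨m', hm1, hm2, hm3⟩ := exists_best_mechanism hP hw fun x hx => by
    obtain ⟨e, p, R, h, h1, -⟩ := h x hx
    obtain ⟨c, hc, -⟩ := hP.exists_contract hx h1
    exact ⟨c, hc⟩
  have hint := hm.1.integrableOn_profit hP hm.2.1
  have hint' := hm1.integrableOn_profit hP hm2
  have hms : MeasurableSet P.types := measurableSet_Icc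
  have hne : ∀ᵐ x ∂(P.F.restrict P.types), x ≠ P.xhigh := by
    refine ae_restrict_of_ae ?_
    rw [ae_iff]
    simpa using hF
  have hle : ∫ x in P.types, (profit P m x + g x) ∂P.F ≤ ∫ x in P.types, profit P m' x ∂P.F := by
    refine integral_mono_ae (hint.add hg) hint' ?_
    filter_upwards [ae_restrict_mem hms, hne] with x hx hxne
    obtain ⟨e, p, R, h, h1, h2⟩ := h x hx
    obtain ⟨c, hc, hc2⟩ := hP.exists_contract hx h1
    have h3 := hm3 x hx c hc
    have h4 := h2 hxne
    rw [profit_eq]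
    rw [hc2] at h3
    linarith
  rw [integral_add hint hg] at hle
  have := hm.2.2 m' hm1 hm2
  unfold expectedProfit at this
  linarith

end TaxMechanism

/-! ### First-best and second-best efforts -/

namespace AuditProblem

/-- The agent's effort that minimizes the principal's cost if no refund is paid without the agent's
evidence and the principal's effort is `p`. -/
def secondBestEffort (P : AuditProblem) (p : ℝ) : ℝ := unitInv (virtualMarginalCost P.cA) (P.cP p)

/-- The agent's effort that minimizes the total effort cost if the principal's effort is `p`. -/
def firstBestEffort (P : AuditProblem) (p : ℝ) : ℝ := unitInv (costDeriv 1 P.cA) (P.cP p)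

namespace IsValid

variable {P : AuditProblem} (hP : P.IsValid)
include hP

theorem secondBest_mem {p : ℝ} (hp : p ∈ Icc (0 : ℝ) 1) : P.secondBestEffort p ∈ Icc (0 : ℝ) 1 :=
  (hP.cost_agent.secondBest_spec (hP.cost_principal.nonneg hp) (hP.cost_lt_deriv hp)).1

theorem virtualMarginalCost_secondBest {p : ℝ} (hp : p ∈ Icc (0 : ℝ) 1) :
    virtualMarginalCost P.cA (P.secondBestEffort p) = P.cP p :=
  (hP.cost_agent.secondBest_spec (hP.cost_principal.nonneg hp) (hP.cost_lt_deriv hp)).2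

theorem firstBest_mem {p : ℝ} (hp : p ∈ Icc (0 : ℝ) 1) : P.firstBestEffort p ∈ Icc (0 : ℝ) 1 :=
  have h := hP.cost_agent.firstBest_spec (hP.cost_principal.nonneg hp) (hP.cost_lt_deriv hp)
  ⟨h.1, h.2.1.le⟩

theorem firstBest_lt_one {p : ℝ} (hp : p ∈ Icc (0 : ℝ) 1) : P.firstBestEffort p < 1 :=
  (hP.cost_agent.firstBest_spec (hP.cost_principal.nonneg hp) (hP.cost_lt_deriv hp)).2.1

theorem deriv_firstBest {p : ℝ} (hp : p ∈ Icc (0 : ℝ) 1) :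
    costDeriv 1 P.cA (P.firstBestEffort p) = P.cP p :=
  (hP.cost_agent.firstBest_spec (hP.cost_principal.nonneg hp) (hP.cost_lt_deriv hp)).2.2

theorem secondBest_strictMonoOn : StrictMonoOn P.secondBestEffort (Icc 0 1) := by
  intro p hp p' hp' hlt
  rw [← (hP.cost_agent.virtualMarginalCost_strictMonoOn hP.rent_regularity).lt_iff_lt
    (hP.secondBest_mem hp) (hP.secondBest_mem hp'), hP.virtualMarginalCost_secondBest hp,
    hP.virtualMarginalCost_secondBest hp']
  exact hP.cost_principal.strictly_increasing hp hp' hlt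

theorem firstBest_strictMonoOn : StrictMonoOn P.firstBestEffort (Icc 0 1) := by
  intro p hp p' hp' hlt
  rw [← hP.cost_agent.strictMonoOn_deriv.lt_iff_lt
    (hP.firstBest_mem hp) (hP.firstBest_mem hp'), hP.deriv_firstBest hp,
    hP.deriv_firstBest hp']
  exact hP.cost_principal.strictly_increasing hp hp' hlt

theorem secondBest_continuousOn : ContinuousOn P.secondBestEffort (Icc 0 1) :=
  (unitInv_continuousOn hP.cost_agent.virtualMarginalCost_continuousOn
    (hP.cost_agent.virtualMarginalCost_strictMonoOn hP.rent_regularity)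
    hP.cost_agent.virtualMarginalCost_zero).comp hP.cost_principal.continuousOn fun _ hp =>
      ⟨hP.cost_principal.nonneg hp, (hP.cost_lt_deriv hp).le.trans
        (hP.cost_agent.le_virtualMarginalCost (right_mem_Icc.2 zero_le_one))⟩

theorem firstBest_continuousOn : ContinuousOn P.firstBestEffort (Icc 0 1) :=
  (unitInv_continuousOn (hP.cost_agent.continuousOn_costDeriv (k := 1) (by norm_num))
    hP.cost_agent.strictMonoOn_deriv hP.cost_agent.deriv_zero).comp
      hP.cost_principal.continuousOn fun _ hp =>
      ⟨hP.cost_principal.nonneg hp, (hP.cost_lt_deriv hp).le⟩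

theorem secondBest_zero : P.secondBestEffort 0 = 0 := by
  have h := unitInv_apply (hP.cost_agent.virtualMarginalCost_strictMonoOn hP.rent_regularity)
    (left_mem_Icc.2 zero_le_one)
  rw [hP.cost_agent.virtualMarginalCost_zero] at h
  rw [secondBestEffort, hP.cost_principal.zero, h]

theorem firstBest_zero : P.firstBestEffort 0 = 0 := by
  have h := unitInv_apply hP.cost_agent.strictMonoOn_deriv (left_mem_Icc.2 zero_le_one)
  rw [hP.cost_agent.deriv_zero] at h
  rw [firstBestEffort, hP.cost_principal.zero, h]

theorem secondBest_pos {p : ℝ} (h0 : 0 < p) (h1 : p ≤ 1) : 0 < P.secondBestEffort p := by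
  have := hP.secondBest_strictMonoOn (left_mem_Icc.2 zero_le_one) ⟨h0.le, h1⟩ h0
  rwa [hP.secondBest_zero] at this

theorem secondBest_lt_firstBest {p : ℝ} (h0 : 0 < p) (h1 : p ≤ 1) :
    P.secondBestEffort p < P.firstBestEffort p := by
  have hp : p ∈ Icc (0 : ℝ) 1 := ⟨h0.le, h1⟩
  have hs := hP.secondBest_pos h0 h1
  rw [← hP.cost_agent.strictMonoOn_deriv.lt_iff_lt (hP.secondBest_mem hp) (hP.firstBest_mem hp),
    hP.deriv_firstBest hp, ← hP.virtualMarginalCost_secondBest hp]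
  have := mul_pos hs (hP.cost_agent.deriv_two_pos hP.rent_regularity hs (hP.secondBest_mem hp).2)
  simp only [virtualMarginalCost]
  linarith

theorem secondBest_le_firstBest {p : ℝ} (hp : p ∈ Icc (0 : ℝ) 1) :
    P.secondBestEffort p ≤ P.firstBestEffort p := by
  rcases hp.1.eq_or_lt with rfl | h
  · rw [hP.secondBest_zero, hP.firstBest_zero]
  · exact (hP.secondBest_lt_firstBest h hp.2).le

theorem secondBest_lt_one {p : ℝ} (hp : p ∈ Icc (0 : ℝ) 1) : P.secondBestEffort p < 1 :=
  (hP.secondBest_le_firstBest hp).trans_lt (hP.firstBest_lt_one hp)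

theorem reducedCost_lt {p R x y : ℝ} (hp : p ∈ Icc (0 : ℝ) 1) (hx : x ∈ Icc (0 : ℝ) 1)
    (hy : y ∈ Icc (0 : ℝ) 1)
    (h : P.secondBestEffort p ≤ x ∧ x < y ∨ y < x ∧ x ≤ P.secondBestEffort p) :
    reducedCost P x p R < reducedCost P y p R := by
  have := lt_of_deriv_strictMonoOn (fun e he => hP.cost_agent.hasDerivWithinAt_rent he)
    (hP.cost_agent.virtualMarginalCost_strictMonoOn hP.rent_regularity) (hP.secondBest_mem hp)
    (hP.virtualMarginalCost_secondBest hp) hx hy h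
  simp only [reducedCost]
  linarith

theorem reducedCost_secondBest_le {p R e : ℝ} (hp : p ∈ Icc (0 : ℝ) 1) (he : e ∈ Icc (0 : ℝ) 1) :
    reducedCost P (P.secondBestEffort p) p R ≤ reducedCost P e p R := by
  rcases lt_trichotomy (P.secondBestEffort p) e with h | h | h
  · exact (hP.reducedCost_lt hp (hP.secondBest_mem hp) he (Or.inl ⟨le_rfl, h⟩)).le
  · rw [h]
  · exact (hP.reducedCost_lt hp (hP.secondBest_mem hp) he (Or.inr ⟨h, le_rfl⟩)).le

/-- Total effort costs are strictly monotone on either side of the first-best effort. -/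
theorem effortCost_lt {p x y : ℝ} (hp : p ∈ Icc (0 : ℝ) 1) (hx : x ∈ Icc (0 : ℝ) 1)
    (hy : y ∈ Icc (0 : ℝ) 1)
    (h : P.firstBestEffort p ≤ x ∧ x < y ∨ y < x ∧ x ≤ P.firstBestEffort p) :
    P.cA x + (1 - x) * P.cP p < P.cA y + (1 - y) * P.cP p := by
  have := lt_of_deriv_strictMonoOn (fun e he => hP.cost_agent.hasDerivWithinAt he)
    hP.cost_agent.strictMonoOn_deriv (hP.firstBest_mem hp) (hP.deriv_firstBest hp) hx hy h
  linarith

/-- Since the marginal cost vanishes at zero, rare audits are cheaper than any gain that is linear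
in their probability. -/
theorem exists_cost_lt_mul {t : ℝ} (ht : 0 < t) : ∃ ε ∈ Ioo (0 : ℝ) 1, P.cP ε < ε * t := by
  obtain ⟨ε, hε, h⟩ := exists_mem_Ioo_right_lt
    (hP.cost_principal.continuousOn_costDeriv (k := 1) (by norm_num)) le_rfl zero_lt_one le_rfl
    (show costDeriv 1 P.cP 0 < t by rwa [hP.cost_principal.deriv_zero])
  refine ⟨ε, hε, (hP.cost_principal.le_one_of_le (Ioo_subset_Icc_self hε)).trans_lt ?_⟩
  rw [mul_comm]
  exact mul_lt_mul_of_pos_left h hε.1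

theorem measure_types_compl : P.F P.typesᶜ = 0 :=
  measure_mono_null (compl_subset_compl.2 fun _ hx =>
    ⟨hP.xlow_isLeast.2 hx, hP.xhigh_isGreatest.2 hx⟩) Measure.measure_compl_support

theorem measure_types : P.F P.types = 1 := by
  have := hP.isProbabilityMeasure
  exact (prob_compl_eq_zero_iff measurableSet_Icc).1 hP.measure_types_compl

theorem measure_inter_types (s : Set ℝ) : P.F (s ∩ P.types) = P.F s :=
  measure_inter_conull hP.measure_types_compl

theorem setIntegral_excess_pos {x₁ : ℝ} (hx₁ : x₁ < P.xhigh) :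
    0 < ∫ x in P.types, max (x - x₁) 0 ∂P.F := by
  have := hP.isProbabilityMeasure
  have hcont : ContinuousOn (fun x => max (x - x₁) 0) P.types := by fun_prop
  have hi : IntegrableOn (fun x => max (x - x₁) 0) P.types P.F :=
    hcont.integrableOn_compact isCompact_Icc
  rw [setIntegral_pos_iff_support_of_nonneg_ae
    (Filter.Eventually.of_forall fun x => le_max_right (x - x₁) 0) hi]
  rw [hP.measure_inter_types]
  have h := (Measure.mem_support_iff_forall _).1 hP.xhigh_isGreatest.1 _ (Ioi_mem_nhds hx₁)
  refine h.trans_le (measure_mono fun x hx => ?_)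
  rw [Function.mem_support]
  exact (lt_max_of_lt_left (sub_pos.2 hx)).ne'

end IsValid

end AuditProblem

/-! ### Criteria for suboptimality, and debt with relief -/

namespace TaxMechanism

variable {P : AuditProblem} {m : TaxMechanism}

/-- Types above `x₁` have positive mass because the top lies in the support. The gain is thus linear
in ε, and it beats the loss `P.cP ε` for a suitable ε. -/
theorem IsOptimal.false_of_flatten (hP : P.IsValid) (hF : P.F {P.xhigh} = 0)
    (hm : IsOptimal P m) {x₁ : ℝ} (hx₁ : x₁ < P.xhigh)
    (h : ∀ ε ∈ Ioo (0 : ℝ) 1, ∃ w : ℝ → ℝ, ContinuousOn w P.types ∧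
      ∀ x ∈ P.types, ∃ e p R h, IsImplementable P w x e p R h ∧
        reducedCost P e p R + (ε * max (x - x₁) 0 - P.cP ε) ≤ (m.contract x).cost P) :
    False := by
  have := hP.isProbabilityMeasure
  obtain ⟨ε, hε, h1⟩ := hP.exists_cost_lt_mul (hP.setIntegral_excess_pos hx₁)
  obtain ⟨w, hw, h2⟩ := h ε hε
  have hc : ContinuousOn (fun x => max (x - x₁) 0) P.types := by fun_prop
  have hi : IntegrableOn (fun x => max (x - x₁) 0) P.types P.F :=
    hc.integrableOn_compact isCompact_Icc
  have hi' : IntegrableOn (fun _ : ℝ => P.cP ε) P.types P.F :=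
    continuousOn_const.integrableOn_compact isCompact_Icc
  have h3 := hm.setIntegral_nonpos hP hF (g := fun x => ε * max (x - x₁) 0 - P.cP ε) hw
    ((hi.const_mul ε).sub hi')
    fun x hx => by
      obtain ⟨e, p, R, h, h3, h4⟩ := h2 x hx
      exact ⟨e, p, R, h, h3, fun _ => h4⟩
  rw [integral_sub (hi.const_mul ε) hi', integral_const_mul, setIntegral_const,
    measureReal_def, hP.measure_types] at h3
  simp at h3
  linarith

/-- A gain on any right neighbourhood of the lowest type counts, because that type lies in the
support. The highest type may be worse off, being an `F`-null set. -/
theorem IsOptimal.false_of_gain (hP : P.IsValid) (hF : P.F {P.xhigh} = 0)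
    (hm : IsOptimal P m) {δ κ : ℝ} (hδ : 0 < δ) (hκ : 0 < κ) {w : ℝ → ℝ}
    (hw : ContinuousOn w P.types)
    (h : ∀ x ∈ P.types, ∃ e p R h, IsImplementable P w x e p R h ∧ (x ≠ P.xhigh →
        reducedCost P e p R + (if x < P.xlow + δ then κ else 0) ≤ (m.contract x).cost P)) :
    False := by
  have := hP.isProbabilityMeasure
  have hg : (fun x => if x < P.xlow + δ then κ else 0)
      = (Iio (P.xlow + δ)).indicator fun _ => κ := by
    ext x; simp [indicator]
  have hi : Integrable ((Iio (P.xlow + δ)).indicator fun _ => κ) P.F :=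
    (integrable_const κ).indicator measurableSet_Iio
  have h3 := hm.setIntegral_nonpos hP hF hw (hg ▸ hi.integrableOn) h
  rw [hg, setIntegral_indicator measurableSet_Iio, setIntegral_const, inter_comm,
    measureReal_def, hP.measure_inter_types] at h3
  have h4 := (Measure.mem_support_iff_forall _).1 hP.xlow_isLeast.1 _
    (Iio_mem_nhds (lt_add_of_pos_right P.xlow hδ))
  have h5 := ENNReal.toReal_pos h4.ne' (measure_ne_top _ _)
  have h6 := mul_pos h5 hκ
  rw [smul_eq_mul] at h3
  linarith

/-- It is not optimal to audit almost all types for sure. -/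
theorem IsOptimal.not_forall_audit (hP : P.IsValid) (hF : P.F {P.xhigh} = 0)
    (hm : IsOptimal P m) : ¬ ∀ x ∈ P.types, x ≠ P.xhigh → m.eP x = 1 := by
  intro hall
  have h1 : (1 : ℝ) ∈ Icc (0 : ℝ) 1 := right_mem_Icc.2 zero_le_one
  set s := P.secondBestEffort 1 with hs
  have hs0 : 0 < s := hP.secondBest_pos zero_lt_one le_rfl
  have hs1 : s < 1 := hP.secondBest_lt_one h1
  have hu := hP.cost_agent.infoRent_pos hP.rent_regularity hs0 hs1.le
  have hd : 0 < P.xhigh - P.xlow := sub_pos.2 hP.xlow_lt_xhigh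
  -- With audit probability 1 - σ and no refunds, a mimic gains at most σ times the length of the
  -- type space, which the rent at effort `s` already covers; so audits can be relaxed for free.
  set σ := min (1 / 2) (infoRent P.cA s / (P.xhigh - P.xlow)) with hσ
  have hσ0 : 0 < σ := lt_min (by norm_num) (div_pos hu hd)
  have hσ1 : σ ≤ 1 / 2 := min_le_left _ _
  have hσu : σ * (P.xhigh - P.xlow) ≤ infoRent P.cA s := by
    rw [← le_div_iff₀ hd]; exact min_le_right _ _
  have hpI : 1 - σ ∈ Icc (0 : ℝ) 1 := ⟨by linarith, by linarith⟩
  have hcP := hP.cost_principal.strictly_increasing hpI h1 (by linarith)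
  refine hm.false_of_gain hP hF hd (mul_pos (sub_pos.2 hs1) (sub_pos.2 hcP))
    (w := fun z => σ * (z - P.xlow)) (by fun_prop) fun x hx => ⟨s, 1 - σ, 0, 0, ?_, fun hne => ?_⟩
  · have hxτ : 0 ≤ x + P.τ := add_nonneg (hP.types_nonneg hx) hP.funds_pos.le
    refine ⟨⟨hs0.le, hs1.le⟩, hpI, le_rfl, le_rfl, ?_, ?_, ?_, ?_, ?_⟩
    · rw [sub_zero]; exact mul_nonneg hpI.1 hxτ
    · exact mul_nonneg (sub_nonneg.2 hpI.2) hxτ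
    · have := hP.cost_agent.deriv_le_deriv_one ⟨hs0.le, hs1.le⟩
      have := hP.budget.1
      have := hP.types_nonneg hx
      linarith
    · have := mul_le_mul_of_nonneg_left (sub_le_sub_right hx.2 P.xlow) hσ0.le
      show σ * (x - P.xlow) ≤ _
      linarith
    · intro z hz
      have := mul_le_mul_of_nonneg_left (sub_le_sub_left hx.1 z) hσ0.le
      show _ ≤ σ * (z - P.xlow)
      linarith
  · have hadm := hm.1.isAdmissible hP hx
    have h2 := hadm.reducedCost_le hP
    have h3 := hP.reducedCost_secondBest_le (R := (m.contract x).refundNA) h1 hadm.eA_mem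
    have h4 := hadm.refundNA_nonneg
    rw [show (m.contract x).eP = 1 from hall x hx hne] at h2
    rw [if_pos (by linarith [lt_of_le_of_ne hx.2 hne])]
    simp only [reducedCost, ← hs] at h2 h3 ⊢
    linarith

/-- If the face value is the top, almost all types are audited for sure. Otherwise the concealment
payoff is scaled down to (1 - ε) max(z - y₀, 0): auditing solvent types with probability ε saves ε(x
- y₀) in refunds at cost `P.cP ε`. Insolvent types stay audited for sure, and are given second-best
effort without other refunds, which costs no more. -/
theorem IsDebtWithRelief.not_isOptimal (hP : P.IsValid) (hF : P.F {P.xhigh} = 0)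
    (h : IsDebtWithRelief P m) : ¬ IsOptimal P m := by
  intro hm
  obtain ⟨-, y₀, hy₀, r, hr, hlow, hhigh⟩ := h
  rcases hy₀.2.eq_or_lt with heq | hlt
  · refine hm.not_forall_audit hP hF fun x hx hne => (hlow x hx ?_).1
    rw [heq]; exact lt_of_le_of_ne hx.2 hne
  · refine hm.false_of_flatten hP hF hlt fun ε hε => ⟨fun z => (1 - ε) * max (z - y₀) 0,
      by fun_prop, fun x hx => ?_⟩
    have hxτ : 0 ≤ x + P.τ := add_nonneg (hP.types_nonneg hx) hP.funds_pos.le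
    have hadm := hm.1.isAdmissible hP hx
    have h0 : (0 : ℝ) ∈ Icc (0 : ℝ) 1 := left_mem_Icc.2 zero_le_one
    have h2 := hadm.reducedCost_le hP
    have hcε := hP.cost_principal.nonneg (Ioo_subset_Icc_self hε)
    rcases lt_or_ge x y₀ with hxy | hxy
    · have hp : (m.contract x).eP = 1 := (hlow x hx hxy).1
      have hs := hP.secondBest_mem (right_mem_Icc.2 (zero_le_one' ℝ))
      refine ⟨P.secondBestEffort 1, 1, 0, 0, ⟨hs, ⟨zero_le_one, le_rfl⟩, le_rfl, le_rfl, ?_, ?_, ?_,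
        ?_, ?_⟩, ?_⟩
      · linarith
      · simp
      · have := hP.cost_agent.deriv_le_deriv_one hs
        have := hP.budget.1
        have := hP.types_nonneg hx
        linarith
      · show (1 - ε) * max (x - y₀) 0 ≤ _
        rw [max_eq_right (by linarith), mul_zero, zero_add]
        exact hP.cost_agent.infoRent_nonneg hP.rent_regularity hs
      · intro z _
        have := mul_nonneg (sub_pos.2 hε.2).le (le_max_right (z - y₀) 0)
        show _ ≤ (1 - ε) * max (z - y₀) 0
        linarith
      · have h3 := hP.reducedCost_secondBest_le (R := (m.contract x).refundNA)
          (right_mem_Icc.2 zero_le_one) hadm.eA_mem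
        have h4 := hadm.refundNA_nonneg
        rw [hp] at h2
        rw [max_eq_right (by linarith)]
        simp only [reducedCost] at h2 h3 ⊢
        linarith
    · obtain ⟨hp, hr0, -⟩ := hhigh x hx hxy
      have hd : 0 ≤ x - y₀ := sub_nonneg.2 hxy
      have hy0 := hP.types_nonneg hy₀
      have hτ := hP.funds_pos
      have hle : (1 - ε) * (x - y₀) ≤ x - y₀ := mul_le_of_le_one_left hd (by linarith [hε.1])
      have hnn : 0 ≤ (1 - ε) * (x - y₀) := mul_nonneg (sub_pos.2 hε.2).le hd
      -- The refund (1 - ε)(x - y₀) is paid whether or not the principal finds evidence, so the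
      -- mimics' line is (1 - ε)(z - y₀) minus the slack ε(1 - ε)(x - y₀).
      refine ⟨0, ε, (1 - ε) * (x - y₀), (1 - ε) * ((1 - ε) * (x - y₀)),
        ⟨h0, Ioo_subset_Icc_self hε, mul_nonneg (sub_pos.2 hε.2).le hnn,
          mul_le_of_le_one_left hnn (by linarith [hε.1]), ?_, ?_, ?_, ?_, ?_⟩, ?_⟩
      · have := mul_le_mul_of_nonneg_left (show (1 - ε) * (x - y₀) ≤ x + P.τ by linarith) hε.1.le
        linarith
      · exact mul_le_mul_of_nonneg_left (by linarith) (sub_pos.2 hε.2).le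
      · rw [hP.cost_agent.deriv_zero]; linarith
      · rw [hP.cost_agent.infoRent_zero, add_zero]
        show (1 - ε) * max (x - y₀) 0 ≤ _
        rw [max_eq_left hd]
      · intro z hz
        show _ ≤ (1 - ε) * max (z - y₀) 0
        rw [max_eq_left (by linarith [hz.1])]
        have := mul_le_mul_of_nonneg_left hle (sub_pos.2 hε.2).le
        linarith
      · have hR : (m.contract x).refundNA = x - y₀ := by
          simp [Contract.refundNA, contract, hp, hr0]
        have hU := hadm.refundNA_le_utility hP
        have h6 := mul_nonneg (sub_nonneg.2 hadm.eA_mem.2)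
          (hP.cost_principal.nonneg hadm.eP_mem)
        have h7 := hP.cost_agent.nonneg hadm.eA_mem
        have hcost : x - y₀ ≤ (m.contract x).cost P := by
          rw [hR] at hU
          simp only [Contract.cost]; linarith
        rw [max_eq_left hd]
        simp only [reducedCost]
        linarith

end TaxMechanism

/-- The plan `(e, p, R, h)` minimizes the principal's cost in the reduced problem. -/
structure IsPointwiseOptimal (P : AuditProblem) (w : ℝ → ℝ) (x e p R h : ℝ) : Prop where
  implementable : IsImplementable P w x e p R h
  lt_one : e < 1
  le_cost : ∀ e' p' R' h', IsImplementable P w x e' p' R' h' →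
    reducedCost P e p R ≤ reducedCost P e' p' R'

/-! ### Regular functions and the regular hull -/

/-- Convex, increasing, and with slopes of at most one on the type space. -/
structure IsRegularOn (P : AuditProblem) (w : ℝ → ℝ) : Prop where
  convexOn : ConvexOn ℝ P.types w
  monotoneOn : MonotoneOn w P.types
  sub_le_sub : ∀ y ∈ P.types, ∀ z ∈ P.types, y ≤ z → w z - w y ≤ z - y

namespace IsRegularOn

variable {P : AuditProblem} {w v : ℝ → ℝ}

theorem affine {s k : ℝ} (hs0 : 0 ≤ s) (hs1 : s ≤ 1) : IsRegularOn P (fun z => k + s * z) := by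
  refine ⟨⟨convex_Icc _ _, fun x _ y _ a b _ _ hab => le_of_eq ?_⟩, fun y _ z _ h => ?_,
    fun y _ z _ h => ?_⟩
  · simp only [smul_eq_mul]
    linear_combination -k * hab
  · have := mul_le_mul_of_nonneg_left h hs0
    show k + s * y ≤ k + s * z
    linarith
  · have := mul_le_mul_of_nonneg_right hs1 (sub_nonneg.2 h)
    linarith

theorem sup (hw : IsRegularOn P w) (hv : IsRegularOn P v) : IsRegularOn P (w ⊔ v) := by
  refine ⟨hw.convexOn.sup hv.convexOn, fun y hy z hz h => ?_, fun y hy z hz h => ?_⟩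
  · exact sup_le_sup (hw.monotoneOn hy hz h) (hv.monotoneOn hy hz h)
  · have h1 := hw.sub_le_sub y hy z hz h
    have h2 := hv.sub_le_sub y hy z hz h
    have h3 : w y ≤ (w ⊔ v) y := le_sup_left
    have h4 : v y ≤ (w ⊔ v) y := le_sup_right
    have h5 : (w ⊔ v) z ≤ (w ⊔ v) y + (z - y) :=
      sup_le (by linarith) (by linarith)
    linarith

theorem sSup {G : Set (ℝ → ℝ)} (hG : G.Nonempty) (hreg : ∀ g ∈ G, IsRegularOn P g)
    (hw : ∀ g ∈ G, ∀ z ∈ P.types, g z ≤ w z) :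
    IsRegularOn P (fun z => sSup ((fun g : ℝ → ℝ => g z) '' G)) := by
  have hb : ∀ z ∈ P.types, BddAbove ((fun g : ℝ → ℝ => g z) '' G) := by
    rintro z hz
    refine ⟨w z, ?_⟩
    rintro _ ⟨g, hg, rfl⟩
    exact hw g hg z hz
  have hle : ∀ g ∈ G, ∀ z ∈ P.types, g z ≤ SupSet.sSup ((fun g : ℝ → ℝ => g z) '' G) :=
    fun g hg z hz => le_csSup (hb z hz) ⟨g, hg, rfl⟩
  refine ⟨⟨convex_Icc _ _, fun x hx y hy a b ha hb' hab => ?_⟩, fun y hy z hz h => ?_,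
    fun y hy z hz h => ?_⟩
  · refine csSup_le (hG.image _) ?_
    rintro _ ⟨g, hg, rfl⟩
    have h1 := (hreg g hg).convexOn.2 hx hy ha hb' hab
    have h2 := mul_le_mul_of_nonneg_left (hle g hg x hx) ha
    have h3 := mul_le_mul_of_nonneg_left (hle g hg y hy) hb'
    simp only [smul_eq_mul] at h1 ⊢
    linarith
  · refine csSup_le (hG.image _) ?_
    rintro _ ⟨g, hg, rfl⟩
    exact ((hreg g hg).monotoneOn hy hz h).trans (hle g hg z hz)
  · rw [sub_le_iff_le_add]
    refine csSup_le (hG.image _) ?_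
    rintro _ ⟨g, hg, rfl⟩
    have h1 := (hreg g hg).sub_le_sub y hy z hz h
    have h2 := hle g hg y hy
    show g z ≤ _
    linarith

theorem continuousOn (hw : IsRegularOn P w) : ContinuousOn w P.types := by
  refine LipschitzOnWith.continuousOn (K := 1) (LipschitzOnWith.of_dist_le_mul fun y hy z hz => ?_)
  rw [NNReal.coe_one, one_mul, Real.dist_eq, Real.dist_eq]
  rcases le_total y z with h | h
  · have h1 := hw.sub_le_sub y hy z hz h
    have h2 := hw.monotoneOn hy hz h
    rw [abs_sub_comm, abs_sub_comm y, abs_of_nonneg (by linarith), abs_of_nonneg (by linarith)]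
    exact h1
  · have h1 := hw.sub_le_sub z hz y hy h
    have h2 := hw.monotoneOn hz hy h
    rw [abs_of_nonneg (by linarith), abs_of_nonneg (by linarith)]
    exact h1

end IsRegularOn

/-- The largest regular minorant of `w`. -/
def regularHull (P : AuditProblem) (w : ℝ → ℝ) (z : ℝ) : ℝ :=
  sSup ((fun g : ℝ → ℝ => g z) '' {g | IsRegularOn P g ∧ ∀ z ∈ P.types, g z ≤ w z})

section regularHull

variable {P : AuditProblem} {w : ℝ → ℝ} (hw0 : ∀ z ∈ P.types, 0 ≤ w z)

theorem le_regularHull {g : ℝ → ℝ} (hg : IsRegularOn P g) (h : ∀ z ∈ P.types, g z ≤ w z) {z : ℝ}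
    (hz : z ∈ P.types) : g z ≤ regularHull P w z := by
  refine le_csSup ⟨w z, ?_⟩ ⟨g, ⟨hg, h⟩, rfl⟩
  rintro _ ⟨f, hf, rfl⟩
  exact hf.2 z hz

include hw0

theorem regularHull_nonempty :
    {g | IsRegularOn P g ∧ ∀ z ∈ P.types, g z ≤ w z}.Nonempty :=
  ⟨fun z => 0 + 0 * z, IsRegularOn.affine le_rfl zero_le_one, fun z hz => by simpa using hw0 z hz⟩

theorem regularHull_nonneg {z : ℝ} (hz : z ∈ P.types) : 0 ≤ regularHull P w z := by
  have := le_regularHull (P := P) (w := w) (g := fun z => 0 + 0 * z)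
    (IsRegularOn.affine le_rfl zero_le_one) (fun z hz => by simpa using hw0 z hz) hz
  simpa using this

theorem regularHull_le {z : ℝ} (hz : z ∈ P.types) : regularHull P w z ≤ w z := by
  refine csSup_le ((regularHull_nonempty hw0).image _) ?_
  rintro _ ⟨f, hf, rfl⟩
  exact hf.2 z hz

theorem regularHull_isRegularOn : IsRegularOn P (regularHull P w) :=
  IsRegularOn.sSup (regularHull_nonempty hw0) (fun _ hg => hg.1) fun _ hg => hg.2

/-- A line that starts below the regular hull and stays below `w` stays below the regular hull. -/
theorem line_le_regularHull {s h y : ℝ} (hs0 : 0 ≤ s) (hs1 : s ≤ 1) (hy : y ∈ P.types)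
    (hh : h ≤ regularHull P w y) (hl : ∀ z ∈ Icc y P.xhigh, h + s * (z - y) ≤ w z) :
    ∀ z ∈ Icc y P.xhigh, h + s * (z - y) ≤ regularHull P w z := by
  intro z₂ hz₂
  by_contra! hlt
  have hreg := regularHull_isRegularOn hw0
  have hz₂T : z₂ ∈ P.types := ⟨hy.1.trans hz₂.1, hz₂.2⟩
  have hyz : y < z₂ := by
    refine lt_of_le_of_ne hz₂.1 fun heq => ?_
    rw [← heq, sub_self, mul_zero, add_zero] at hlt
    exact absurd hh (not_le.2 hlt)
  -- If the line exceeded the convex hull function on both sides of `y`, it would exceed it at `y`.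
  have hleft : ∀ z ∈ P.types, z < y → h + s * (z - y) ≤ regularHull P w z := by
    intro z hz hzy
    by_contra! hlt'
    have hd : 0 < z₂ - z := by linarith
    have ha : 0 ≤ (z₂ - y) / (z₂ - z) := div_nonneg (by linarith) hd.le
    have hb : 0 ≤ (y - z) / (z₂ - z) := div_nonneg (by linarith) hd.le
    have hc := hreg.convexOn.2 hz hz₂T ha hb (by field_simp; ring)
    have e1 : ((z₂ - y) / (z₂ - z)) • z + ((y - z) / (z₂ - z)) • z₂ = y := by
      simp only [smul_eq_mul]; field_simp; ring
    rw [e1] at hc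
    have h1 := mul_lt_mul_of_pos_left hlt' (div_pos (sub_pos.2 hyz) hd)
    have h2 := mul_lt_mul_of_pos_left hlt (div_pos (sub_pos.2 hzy) hd)
    have e2 : (z₂ - y) / (z₂ - z) * (h + s * (z - y)) + (y - z) / (z₂ - z) * (h + s * (z₂ - y))
        = h := by
      field_simp; ring
    simp only [smul_eq_mul] at hc
    linarith
  -- The maximum of the hull and the line is a regular minorant of `w`, so it does not exceed the
  -- largest one.
  have hg := le_regularHull (w := w) (hreg.sup (IsRegularOn.affine (k := h - s * y) hs0 hs1))
    (fun z hz => by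
      refine sup_le (regularHull_le hw0 hz) ?_
      rcases lt_or_ge z y with hzy | hzy
      · have := hleft z hz hzy
        have := regularHull_le hw0 hz
        show h - s * y + s * z ≤ w z
        linarith
      · have := hl z ⟨hzy, hz.2⟩
        show h - s * y + s * z ≤ w z
        linarith) hz₂T
  have h3 : h - s * y + s * z₂ ≤ regularHull P w z₂ := le_trans le_sup_right hg
  linarith

end regularHull

/-! ### Consequences of tightness -/

namespace TaxMechanism

variable {P : AuditProblem} {m : TaxMechanism}

theorem loss_le_iff {m' : TaxMechanism} {x : ℝ} :
    loss P m x ≤ loss P m' x ↔ concealment P m' x ≤ concealment P m x := by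
  unfold concealment
  constructor <;> intro h <;> linarith

theorem IsMechanism.concealment_nonneg (hP : P.IsValid) (hm : IsMechanism P m) {x : ℝ}
    (hx : x ∈ P.types) : 0 ≤ concealment P m x := by
  refine le_trans ?_ (le_concealment hP hm.1 hx.1 le_rfl hx.2)
  rw [sub_self, zero_add]
  exact mul_nonneg (sub_nonneg.2 (hm.1.eP_mem x hx).2) (hm.1.r0_mem x hx).1

/-- Replacing the contract of `x` alone by a cheaper admissible one keeps all contracts admissible
for the same concealment payoff, and hence gives a tighter mechanism with a higher profit at `x`. -/
theorem IsTight.cost_le (hP : P.IsValid) (hm : IsTight P m) {x : ℝ} (hx : x ∈ P.types)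
    {c : Contract} (hc : c.IsAdmissible P (concealment P m) x) :
    (m.contract x).cost P ≤ c.cost P := by
  by_contra! hlt
  let f : ℝ → Contract := fun y => if y = x then c else m.contract y
  have hf : ∀ y ∈ P.types, ((ofContracts f).contract y).IsAdmissible P (concealment P m) y := by
    intro y hy
    rw [contract_ofContracts]
    by_cases hyx : y = x
    · simp only [f, hyx, if_true]; exact hc
    · simp only [f, hyx, if_false]; exact hm.1.isAdmissible hP hy
  have h1 := hm.2 _ (isMechanism_of_isAdmissible hP hf) fun y hy => by
    refine ⟨?_, loss_le_iff.2 (concealment_le_of_isAdmissible hf hy)⟩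
    rw [profit_eq, profit_eq, contract_ofContracts]
    by_cases hyx : y = x
    · simp only [f, hyx, if_true]; linarith
    · simp only [f, hyx, if_false]; exact le_rfl
  have h2 := (h1 x hx).1
  rw [profit_eq, profit_eq, contract_ofContracts] at h2
  simp only [f, if_true] at h2
  linarith

/-- Full effort wastes resources: since `P.cP 1` is below the agent's marginal cost at one, auditing
for sure and reducing effort to the first best at unchanged utility is cheaper. Certain audits leave
nothing to mimics. -/
theorem IsTight.eA_lt_one (hP : P.IsValid) (hm : IsTight P m) {x : ℝ} (hx : x ∈ P.types) :
    m.eA x < 1 := by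
  by_contra! hge
  have hadm := hm.1.isAdmissible hP hx
  have hA := hP.cost_agent
  have h1 : (1 : ℝ) ∈ Icc (0 : ℝ) 1 := right_mem_Icc.2 zero_le_one
  have he : (m.contract x).eA = 1 := le_antisymm hadm.eA_mem.2 hge
  set s := P.firstBestEffort 1
  have hs := hP.firstBest_mem h1
  have hs1 : s < 1 := hP.firstBest_lt_one h1
  set U := (m.contract x).utility P with hU
  set R := (m.contract x).refundNA
  have hUeq : U = (m.contract x).rA - P.cA 1 := by
    rw [hU, Contract.utility, he]; ring
  have ht : P.cA s + costDeriv 1 P.cA s * (1 - s) < P.cA 1 := hA.tangent_lt hs h1 hs1.ne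
  have hR : infoRent P.cA s ≤ U := by
    have h3 := hadm.deriv_le_of_lt hP hs.1 (by rw [he]; exact hs1)
    have h4 := hadm.refundNA_nonneg
    have h5 := mul_le_mul_of_nonneg_left h3 hs.1
    have h6 := hadm.obedient s hs
    simp only [infoRent]
    linarith
  have himp : IsImplementable P (concealment P m) x s 1 (U - infoRent P.cA s) 0 := by
    have hbud : U - infoRent P.cA s + costDeriv 1 P.cA s ≤ x + P.τ := by
      have := hadm.rA_mem.2
      simp only [infoRent]
      linarith
    refine ⟨hs, h1, le_rfl, by linarith, ?_, by simp, hbud, ?_, ?_⟩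
    · have := hA.deriv_nonneg hs
      linarith
    · have := hadm.floor
      linarith
    · intro z hz
      have := hm.1.concealment_nonneg hP (x := z) ⟨hx.1.trans hz.1, hz.2⟩
      linarith
  obtain ⟨c, hc, hcost⟩ := hP.exists_contract hx himp
  have h2 := hm.cost_le hP hx hc
  have h3 : costDeriv 1 P.cA s = P.cP 1 := hP.deriv_firstBest h1
  rw [h3] at ht
  rw [hcost, Contract.cost, ← hU, he] at h2
  simp only [reducedCost, infoRent] at h2
  linarith

theorem IsTight.isPointwiseOptimal (hP : P.IsValid) (hm : IsTight P m) {x : ℝ}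
    (hx : x ∈ P.types) : IsPointwiseOptimal P (concealment P m) x (m.eA x) (m.eP x)
      (refundNA m x) ((1 - m.eP x) * m.r0 x) := by
  have hadm := hm.1.isAdmissible hP hx
  have h1 := hm.eA_lt_one hP hx
  refine ⟨hadm.isImplementable hP h1, h1, fun e' p' R' h' himp => ?_⟩
  obtain ⟨c, hc, hcost⟩ := hP.exists_contract hx himp
  have h2 := hm.cost_le hP hx hc
  rw [hcost, hadm.cost_eq hP h1] at h2
  exact h2

theorem IsTight.utility_eq (hP : P.IsValid) (hm : IsTight P m) {x : ℝ} (hx : x ∈ P.types) :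
    utility P m x = refundNA m x + infoRent P.cA (m.eA x) :=
  (hm.1.isAdmissible hP hx).utility_eq hP (hm.eA_lt_one hP hx)

theorem IsTight.cost_eq (hP : P.IsValid) (hm : IsTight P m) {x : ℝ} (hx : x ∈ P.types) :
    (m.contract x).cost P = reducedCost P (m.eA x) (m.eP x) (refundNA m x) :=
  (hm.1.isAdmissible hP hx).cost_eq hP (hm.eA_lt_one hP hx)

/-- All contracts can be adjusted to the hull at no extra cost: efforts stay, and the refund without
any evidence falls by the excess of `h` over the hull. The line is then admissible by
`line_le_regularHull`, and tightness forbids a strict improvement of the loss. -/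
theorem IsTight.concealment_eq_regularHull (hP : P.IsValid) (hm : IsTight P m) {x : ℝ}
    (hx : x ∈ P.types) : concealment P m x = regularHull P (concealment P m) x := by
  set w := concealment P m with hw
  have hw0 : ∀ z ∈ P.types, 0 ≤ w z := fun z hz => hm.1.concealment_nonneg hP hz
  have hex : ∀ y : ℝ, ∃ c : Contract, y ∈ P.types → c.IsAdmissible P (regularHull P w) y ∧
      c.cost P ≤ (m.contract y).cost P := by
    intro y
    by_cases hy : y ∈ P.types
    · have himp := (hm.isPointwiseOptimal hP hy).implementable
      rw [← hw] at himp
      set h := (1 - m.eP y) * m.r0 y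
      set R := refundNA m y with hR
      set Δ := max 0 (h - regularHull P w y)
      have hΔ0 : 0 ≤ Δ := le_max_left _ _
      have hΔ : h - regularHull P w y ≤ Δ := le_max_right _ _
      have hv := regularHull_nonneg hw0 hy
      have hΔh : Δ ≤ h := max_le himp.h_nonneg (by linarith)
      have hI := hP.cost_agent.infoRent_nonneg hP.rent_regularity himp.e_mem
      have himp' : IsImplementable P (regularHull P w) y (m.eA y) (m.eP y) (R - Δ) (h - Δ) := by
        refine ⟨himp.e_mem, himp.p_mem, by linarith, by linarith [himp.h_le], ?_, ?_, ?_, ?_, ?_⟩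
        · linarith [himp.sub_le]
        · linarith [himp.h_le_mul]
        · linarith [himp.budget]
        -- Without a reduction the old floor suffices; with one, the reduced `h` equals the hull and
        -- `R` is at least `h`.
        · rcases max_choice 0 (h - regularHull P w y) with h1 | h1
          · have h2 : Δ = 0 := h1
            linarith [himp.floor, regularHull_le hw0 hy]
          · have h2 : Δ = h - regularHull P w y := h1
            linarith [himp.h_le]
        · refine line_le_regularHull hw0 (sub_nonneg.2 himp.p_mem.2)
            (by linarith [himp.p_mem.1]) hy (by linarith) fun z hz => ?_
          linarith [himp.line z hz]
      obtain ⟨c, hc, hcost⟩ := hP.exists_contract hy himp'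
      refine ⟨c, fun _ => ⟨hc, ?_⟩⟩
      rw [hcost, hm.cost_eq hP hy, ← hR]
      simp only [reducedCost]
      linarith
    · exact ⟨⟨0, 0, 0, 0, 0⟩, fun h => absurd h hy⟩
  choose f hf using hex
  have hadm : ∀ y ∈ P.types, ((ofContracts f).contract y).IsAdmissible P (regularHull P w) y :=
    fun y hy => (hf y hy).1
  have h1 := hm.2 _ (isMechanism_of_isAdmissible hP hadm) fun y hy => by
    refine ⟨?_, loss_le_iff.2 ((concealment_le_of_isAdmissible hadm hy).trans
      (regularHull_le hw0 hy))⟩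
    rw [profit_eq, profit_eq, contract_ofContracts]
    linarith [(hf y hy).2]
  refine le_antisymm ?_ (regularHull_le hw0 hx)
  exact (loss_le_iff.1 (h1 x hx).2).trans (concealment_le_of_isAdmissible hadm hx)

theorem IsTight.isRegularOn (hP : P.IsValid) (hm : IsTight P m) :
    IsRegularOn P (concealment P m) := by
  have h := regularHull_isRegularOn (P := P) (w := concealment P m)
    fun z hz => hm.1.concealment_nonneg hP hz
  have heq : ∀ z ∈ P.types, concealment P m z = regularHull P (concealment P m) z :=
    fun z hz => hm.concealment_eq_regularHull hP hz
  refine ⟨h.convexOn.congr fun z hz => (heq z hz).symm, fun y hy z hz hyz => ?_,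
    fun y hy z hz hyz => ?_⟩
  · rw [heq y hy, heq z hz]; exact h.monotoneOn hy hz hyz
  · rw [heq y hy, heq z hz]; exact h.sub_le_sub y hy z hz hyz

end TaxMechanism

/-! ### Optimality conditions of the reduced problem -/

theorem reducedCost_eq (P : AuditProblem) (e p R : ℝ) :
    reducedCost P e p R = R + infoRent P.cA e + (P.cA e + (1 - e) * P.cP p) := by
  simp only [reducedCost, infoRent]; ring

/-- The difference is c(e) + (1 - e) c'(e). Hence replacing rent by refund at fixed utility, with
less effort, respects the principal's budget. -/
theorem IsEvidenceCost.deriv_sub_infoRent_le {c : ℝ → ℝ} (hc : IsEvidenceCost c) {t e : ℝ}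
    (ht : t ∈ Icc (0 : ℝ) 1) (he : e ∈ Icc (0 : ℝ) 1) (hte : t ≤ e) :
    costDeriv 1 c t - infoRent c t ≤ costDeriv 1 c e - infoRent c e := by
  have h1 := hc.tangent_le ht he
  have h2 := mul_le_mul_of_nonneg_right (hc.strictMonoOn_deriv.monotoneOn ht he hte)
    (sub_nonneg.2 he.2)
  simp only [infoRent]
  linarith

namespace IsPointwiseOptimal

variable {P : AuditProblem} {w : ℝ → ℝ} {x e p R h : ℝ}
  (H : IsPointwiseOptimal P w x e p R h) (hP : P.IsValid)
include H

theorem refund_nonneg : 0 ≤ R := H.implementable.h_nonneg.trans H.implementable.h_le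

/-- A slack floor would allow all refunds without the agent's evidence to be scaled down. -/
theorem floor_eq_of_pos (hR : 0 < R) : w x = R + infoRent P.cA e := by
  have I := H.implementable
  refine le_antisymm I.floor ?_
  by_contra! hlt
  set θ := min 1 ((R + infoRent P.cA e - w x) / R)
  have hθ0 : 0 < θ := lt_min zero_lt_one (div_pos (by linarith) hR)
  have hθ1 : θ ≤ 1 := min_le_left _ _
  have hθ : θ * R ≤ R + infoRent P.cA e - w x := by
    rw [← le_div_iff₀ hR]; exact min_le_right _ _
  have h1 : θ * h ≤ θ * R := mul_le_mul_of_nonneg_left I.h_le hθ0.le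
  have h2 : 0 ≤ θ * h := mul_nonneg hθ0.le I.h_nonneg
  have h3 : θ * h ≤ h := mul_le_of_le_one_left I.h_nonneg hθ1
  have h4 : 0 < θ * R := mul_pos hθ0 hR
  have himp : IsImplementable P w x e p (R - θ * R) (h - θ * h) := by
    refine ⟨I.e_mem, I.p_mem, by linarith, ?_, ?_, ?_, ?_, by linarith, ?_⟩
    · have := mul_le_mul_of_nonneg_left I.h_le (sub_nonneg.2 hθ1)
      linarith
    · linarith [I.sub_le]
    · linarith [I.h_le_mul]
    · linarith [I.budget]
    · intro z hz
      linarith [I.line z hz]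
  have := H.le_cost _ _ _ _ himp
  simp only [reducedCost] at this
  linarith

include hP

theorem le_of_isImplementable {p' h' : ℝ} (H' : IsImplementable P w x e p' R h') : p ≤ p' := by
  by_contra! hlt
  have h1 := H.le_cost _ _ _ _ H'
  have h2 := hP.cost_principal.strictly_increasing H'.p_mem H.implementable.p_mem hlt
  have h3 := mul_lt_mul_of_pos_left h2 (sub_pos.2 H.lt_one)
  simp only [reducedCost] at h1
  linarith

/-- Refunds without any evidence encourage mimics, so they come last. If the refund after the
principal's evidence had room, part of `h` could be shifted to it at constant `R`; lowering `h` by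
η(x̄ - x) permits η fewer audits, which saves cost as e < 1. -/
theorem refund_eq_of_h_pos (hx : x ∈ P.types) (hh : 0 < h) (hp : 0 < p) :
    R = h + p * (x + P.τ) := by
  have I := H.implementable
  refine le_antisymm (by linarith [I.sub_le]) ?_
  by_contra! hlt
  have hHτ : 0 < P.xhigh + P.τ := by linarith [hP.types_nonneg hx, hP.funds_pos, hx.2]
  set η := min p (min (h / (P.xhigh + P.τ)) ((h + p * (x + P.τ) - R) / (P.xhigh + P.τ)))
  have hη0 : 0 < η := lt_min hp (lt_min (div_pos hh hHτ) (div_pos (by linarith) hHτ))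
  have hη1 : η ≤ p := min_le_left _ _
  have hη2 : η * (P.xhigh + P.τ) ≤ h := by
    rw [← le_div_iff₀ hHτ]; exact (min_le_right _ _).trans (min_le_left _ _)
  have hη3 : η * (P.xhigh + P.τ) ≤ h + p * (x + P.τ) - R := by
    rw [← le_div_iff₀ hHτ]; exact (min_le_right _ _).trans (min_le_right _ _)
  have hxτ : 0 ≤ η * (x + P.τ) :=
    mul_nonneg hη0.le (by linarith [hP.types_nonneg hx, hP.funds_pos])
  have hHx : 0 ≤ η * (P.xhigh - x) := mul_nonneg hη0.le (sub_nonneg.2 hx.2)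
  have himp : IsImplementable P w x e (p - η) R (h - η * (P.xhigh - x)) := by
    refine ⟨I.e_mem, ⟨by linarith, by linarith [I.p_mem.2]⟩, by linarith, by linarith [I.h_le],
      by linarith, by linarith [I.h_le_mul], I.budget, I.floor, fun z hz => ?_⟩
    have h1 := I.line z hz
    have h2 := mul_le_mul_of_nonneg_left hz.2 hη0.le
    linarith
  linarith [H.le_of_isImplementable hP himp]

/-- Audits beyond what deters mimics have the sole purpose of making refunds possible. If h = 0 and
`R` had room, audits could be cut directly. If h = 0 and `R` is maximal, a little of `R` can be
relabelled as `h` at the same cost, and the relabelled plan violates `refund_eq_of_h_pos`. -/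
theorem refund_eq_of_slack (hx : x ∈ P.types) (hwx : w x ≤ x) (hmono : MonotoneOn w P.types)
    {s : ℝ} (hs1 : s ≤ 1) (hps : 1 - p < s) (hl : ∀ z ∈ Icc x P.xhigh, s * (z - x) ≤ w z) :
    R = h + p * (x + P.τ) ∧ 0 < h := by
  have I := H.implementable
  have hp : 0 < p := by linarith
  have hxτ : 0 < x + P.τ := by linarith [hP.types_nonneg hx, hP.funds_pos]
  have hR : R = h + p * (x + P.τ) := by
    rcases I.h_nonneg.eq_or_lt with h0 | h0
    · refine le_antisymm (by linarith [I.sub_le]) ?_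
      by_contra! hlt
      set η := min p (min (s - (1 - p)) ((h + p * (x + P.τ) - R) / (x + P.τ)))
      have hη0 : 0 < η := lt_min hp (lt_min (by linarith) (div_pos (by linarith) hxτ))
      have hη1 : η ≤ p := min_le_left _ _
      have hη2 : η ≤ s - (1 - p) := (min_le_right _ _).trans (min_le_left _ _)
      have hη3 : η * (x + P.τ) ≤ h + p * (x + P.τ) - R := by
        rw [← le_div_iff₀ hxτ]; exact (min_le_right _ _).trans (min_le_right _ _)
      have himp : IsImplementable P w x e (p - η) R h := by
        refine ⟨I.e_mem, ⟨by linarith, by linarith [I.p_mem.2]⟩, I.h_nonneg, I.h_le,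
          by linarith, ?_, I.budget, I.floor, fun z hz => ?_⟩
        · have := mul_nonneg hη0.le hxτ.le
          linarith [I.h_le_mul]
        · have h1 := hl z hz
          have h2 := mul_le_mul_of_nonneg_right (show 1 - (p - η) ≤ s by linarith)
            (sub_nonneg.2 hz.1)
          linarith
      linarith [H.le_of_isImplementable hP himp]
    · exact H.refund_eq_of_h_pos hP hx h0 hp
  refine ⟨hR, lt_of_le_of_ne I.h_nonneg fun h0 => ?_⟩
  have hRpos : 0 < R := by
    rw [hR, ← h0, zero_add]; exact mul_pos hp hxτ
  have hw := H.floor_eq_of_pos hRpos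
  have hI := hP.cost_agent.infoRent_nonneg hP.rent_regularity I.e_mem
  have hp1 : p < 1 := by
    by_contra! hge
    have := mul_le_mul_of_nonneg_right hge hxτ.le
    linarith [hP.funds_pos]
  have hs0 : 0 < s := by linarith [I.p_mem.2]
  have hσ : (1 - p) / s < 1 := (div_lt_one hs0).2 hps
  -- With σ = (1 - p)/s < 1, the new line is at most (1 - σ) w(x) + σ w(z), hence at most w(z) by
  -- monotonicity.
  set ξ := min ((1 - (1 - p) / s) * w x) (min R ((1 - p) * (x + P.τ)))
  have hξ0 : 0 < ξ := lt_min (mul_pos (by linarith) (by linarith))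
    (lt_min hRpos (mul_pos (by linarith) hxτ))
  have hξ1 : ξ ≤ (1 - (1 - p) / s) * w x := min_le_left _ _
  have hξ2 : ξ ≤ R := (min_le_right _ _).trans (min_le_left _ _)
  have hξ3 : ξ ≤ (1 - p) * (x + P.τ) := (min_le_right _ _).trans (min_le_right _ _)
  have himp : IsImplementable P w x e p R ξ := by
    refine ⟨I.e_mem, I.p_mem, hξ0.le, hξ2, by linarith, hξ3, I.budget, I.floor, fun z hz => ?_⟩
    have h1 := mul_le_mul_of_nonneg_left (hl z hz) (div_nonneg (by linarith : 0 ≤ 1 - p) hs0.le)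
    have h2 : (1 - p) / s * (s * (z - x)) = (1 - p) * (z - x) := by field_simp
    have h3 := mul_le_mul_of_nonneg_left (hmono hx ⟨hx.1.trans hz.1, hz.2⟩ hz.1)
      (show 0 ≤ 1 - (1 - p) / s by linarith)
    linarith
  have := IsPointwiseOptimal.refund_eq_of_h_pos ⟨himp, H.lt_one, H.le_cost⟩ hP hx hξ0 hp
  linarith

theorem refund_le (hx : x ∈ P.types) (hwx : w x ≤ x) : R ≤ x := by
  rcases H.refund_nonneg.eq_or_lt with h0 | h0
  · rw [← h0]; exact hP.types_nonneg hx
  · have := H.floor_eq_of_pos h0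
    have := hP.cost_agent.infoRent_nonneg hP.rent_regularity H.implementable.e_mem
    linarith

/-- Raising effort up to the second best lowers cost and relaxes the floor. The budget does not bind
since `R ≤ x` and marginal effort costs are at most `P.τ`. -/
theorem secondBest_le (hx : x ∈ P.types) (hwx : w x ≤ x) : P.secondBestEffort p ≤ e := by
  by_contra! hlt
  have I := H.implementable
  have hs := hP.secondBest_mem I.p_mem
  have himp : IsImplementable P w x (P.secondBestEffort p) p R h := by
    refine ⟨hs, I.p_mem, I.h_nonneg, I.h_le, I.sub_le, I.h_le_mul, ?_, ?_, I.line⟩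
    · linarith [H.refund_le hP hx hwx, hP.cost_agent.deriv_le_deriv_one hs, hP.budget.1]
    · have := hP.cost_agent.infoRent_strictMonoOn hP.rent_regularity I.e_mem hs hlt
      linarith [I.floor]
  have h1 := H.le_cost _ _ _ _ himp
  have h2 := hP.reducedCost_lt (R := R) I.p_mem hs I.e_mem (Or.inr ⟨hlt, le_rfl⟩)
  linarith

theorem of_floor_lt (hU : w x < R + infoRent P.cA e) : R = 0 ∧ e ≤ P.secondBestEffort p := by
  have I := H.implementable
  constructor
  · refine le_antisymm ?_ H.refund_nonneg
    by_contra! hR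
    exact hU.ne (H.floor_eq_of_pos hR)
  · by_contra! hlt
    have hs := hP.secondBest_mem I.p_mem
    obtain ⟨t, ht, h1⟩ := exists_mem_Ioo_left_lt hP.cost_agent.infoRent_continuousOn.neg hs.1 hlt
      I.e_mem.2 (show (-infoRent P.cA) e < R - w x by rw [Pi.neg_apply]; linarith)
    rw [Pi.neg_apply] at h1
    have htI : t ∈ Icc (0 : ℝ) 1 := ⟨hs.1.trans ht.1.le, ht.2.le.trans I.e_mem.2⟩
    have himp : IsImplementable P w x t p R h := by
      refine ⟨htI, I.p_mem, I.h_nonneg, I.h_le, I.sub_le, I.h_le_mul, ?_, by linarith, I.line⟩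
      have := hP.cost_agent.strictMonoOn_deriv htI I.e_mem ht.2
      linarith [I.budget]
    have h2 := H.le_cost _ _ _ _ himp
    have h3 := hP.reducedCost_lt (R := R) I.p_mem htI I.e_mem (Or.inl ⟨ht.1.le, ht.2⟩)
    linarith

/-- At fixed utility only total effort costs matter: when a refund is paid, below first-best effort
some of it is better replaced by rent. -/
theorem firstBest_le (hx : x ∈ P.types) (hwx : w x ≤ x) (hR : 0 < R) :
    P.firstBestEffort p ≤ e := by
  by_contra! hlt
  have I := H.implementable
  have hs := hP.firstBest_mem I.p_mem
  obtain ⟨t, ht, h1⟩ := exists_mem_Ioo_right_lt hP.cost_agent.infoRent_continuousOn I.e_mem.1 hlt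
    hs.2 (show infoRent P.cA e < R + infoRent P.cA e by linarith)
  have htI : t ∈ Icc (0 : ℝ) 1 := ⟨I.e_mem.1.trans ht.1.le, ht.2.le.trans hs.2⟩
  have hmono := hP.cost_agent.infoRent_strictMonoOn hP.rent_regularity I.e_mem htI ht.1
  set R' := R + infoRent P.cA e - infoRent P.cA t with hR'
  have himp : IsImplementable P w x t p R' (min h R') := by
    refine ⟨htI, I.p_mem, le_min I.h_nonneg (by linarith), min_le_right _ _, ?_,
      (min_le_left _ _).trans I.h_le_mul, ?_, by linarith [I.floor], fun z hz => ?_⟩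
    · rcases min_choice h R' with h2 | h2
      · rw [h2]; linarith [I.sub_le]
      · rw [h2, sub_self]
        exact mul_nonneg I.p_mem.1 (by linarith [hP.types_nonneg hx, hP.funds_pos])
    · linarith [H.refund_le hP hx hwx, hP.cost_agent.deriv_le_deriv_one htI, hP.budget.1]
    · linarith [I.line z hz, min_le_left h R']
  have h2 := H.le_cost _ _ _ _ himp
  have h3 := hP.effortCost_lt I.p_mem htI I.e_mem (Or.inr ⟨ht.1, ht.2.le⟩)
  rw [reducedCost_eq, reducedCost_eq] at h2
  linarith

/-- The reverse substitution: above first-best effort, rent is better replaced by a refund after the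
principal's evidence, as long as that refund has room. -/
theorem le_firstBest (hR : R < h + p * (x + P.τ)) : e ≤ P.firstBestEffort p := by
  by_contra! hlt
  have I := H.implementable
  have hs := hP.firstBest_mem I.p_mem
  obtain ⟨t, ht, h1⟩ := exists_mem_Ioo_left_lt hP.cost_agent.infoRent_continuousOn.neg hs.1 hlt
    I.e_mem.2 (show (-infoRent P.cA) e < h + p * (x + P.τ) - R - infoRent P.cA e by
      rw [Pi.neg_apply]; linarith)
  rw [Pi.neg_apply] at h1
  have htI : t ∈ Icc (0 : ℝ) 1 := ⟨hs.1.trans ht.1.le, ht.2.le.trans I.e_mem.2⟩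
  have hmono := hP.cost_agent.infoRent_strictMonoOn hP.rent_regularity htI I.e_mem ht.2
  have himp : IsImplementable P w x t p (R + infoRent P.cA e - infoRent P.cA t) h := by
    refine ⟨htI, I.p_mem, I.h_nonneg, by linarith [I.h_le], by linarith, I.h_le_mul, ?_,
      by linarith [I.floor], I.line⟩
    linarith [I.budget, hP.cost_agent.deriv_sub_infoRent_le htI I.e_mem ht.2.le]
  have h2 := H.le_cost _ _ _ _ himp
  have h3 := hP.effortCost_lt I.p_mem htI I.e_mem (Or.inl ⟨ht.1.le, ht.2⟩)
  rw [reducedCost_eq, reducedCost_eq] at h2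
  linarith

/-- Without audits the line has slope one and the slope condition gives h < w(x), so utility must
come in part from costly effort. Lowering effort to t and replacing the lost rent by the maximal
refund after an audit needs a probability of order e - t, whose cost is o(e - t), while the saving
in effort cost is of first order. -/
theorem p_pos (hx : x ∈ P.types) (hslope : w P.xhigh - w x < P.xhigh - x) :
    0 < p := by
  have I := H.implementable
  have hA := hP.cost_agent
  refine lt_of_le_of_ne I.p_mem.1 fun hp => ?_
  have hRh : R = h := by
    have := I.sub_le
    rw [← hp, zero_mul] at this
    linarith [I.h_le]
  have h1 := I.line P.xhigh ⟨hx.2, le_rfl⟩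
  rw [← hp] at h1
  have he0 : 0 < e := by
    refine lt_of_le_of_ne I.e_mem.1 fun h0 => ?_
    have := I.floor
    rw [← h0, hA.infoRent_zero] at this
    linarith
  have hfloor : w x = R + infoRent P.cA e := by
    refine le_antisymm I.floor ?_
    by_contra! hlt
    have := (H.of_floor_lt hP hlt).2
    rw [← hp, hP.secondBest_zero] at this
    linarith
  have ha1 := hA.deriv_pos he0 I.e_mem.2
  set d := x + P.τ - R with hd
  have hd0 : 0 < d := by linarith [I.budget]
  have hxτ : 0 < x + P.τ := by linarith [hP.types_nonneg hx, hP.funds_pos]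
  -- `B` bounds the derivative of the rent, so the audit probability η defined below is at most
  -- (B/d)(e - t).
  obtain ⟨B, hB⟩ := isCompact_Icc.exists_bound_of_continuousOn (s := Icc (0 : ℝ) 1)
    (continuousOn_id.mul (hA.continuousOn_costDeriv (k := 2) (by norm_num)))
  obtain ⟨u, hu, hu1⟩ := exists_mem_Ioo_left_lt hA.infoRent_continuousOn.neg le_rfl he0
    I.e_mem.2 (show (-infoRent P.cA) e < d - infoRent P.cA e by rw [Pi.neg_apply]; linarith)
  rw [Pi.neg_apply] at hu1
  have hsub : Icc u e ⊆ Icc (0 : ℝ) 1 := Icc_subset_Icc hu.1.le I.e_mem.2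
  have hmono := hA.infoRent_strictMonoOn hP.rent_regularity
  have hηmem : ∀ t ∈ Icc u e, (infoRent P.cA e - infoRent P.cA t) / d ∈ Icc (0 : ℝ) 1 := by
    intro t ht
    have h2 := hmono.monotoneOn (hsub ht) I.e_mem ht.2
    have h3 := hmono.monotoneOn (hsub ⟨le_rfl, hu.2.le⟩) (hsub ht) ht.1
    exact ⟨div_nonneg (by linarith) hd0.le, (div_le_one hd0).2 (by linarith)⟩
  have hηcont : ContinuousOn (fun t => (infoRent P.cA e - infoRent P.cA t) / d) (Icc u e) :=
    (continuousOn_const.sub (hA.infoRent_continuousOn.mono hsub)).div_const d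
  have hFcont : ContinuousOn (fun t => B / d * costDeriv 1 P.cP
      ((infoRent P.cA e - infoRent P.cA t) / d) - costDeriv 1 P.cA t) (Icc u e) :=
    (continuousOn_const.mul ((hP.cost_principal.continuousOn_costDeriv (k := 1)
      (by norm_num)).comp hηcont hηmem)).sub
      ((hA.continuousOn_costDeriv (k := 1) (by norm_num)).mono hsub)
  obtain ⟨t, ht, hlt⟩ := exists_mem_Ioo_left_lt hFcont le_rfl hu.2 le_rfl (y := 0) (by
    simp only [sub_self, zero_div, hP.cost_principal.deriv_zero]; linarith)
  have htI := hsub (Ioo_subset_Icc_self ht)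
  have hη := hηmem t (Ioo_subset_Icc_self ht)
  set η := (infoRent P.cA e - infoRent P.cA t) / d with hηdef
  have hηd : η * d = infoRent P.cA e - infoRent P.cA t := div_mul_cancel₀ _ hd0.ne'
  have hh0 := mul_nonneg hη.1 I.h_nonneg
  have himp : IsImplementable P w x t η (R + infoRent P.cA e - infoRent P.cA t)
      ((1 - η) * h) := by
    refine ⟨htI, hη, mul_nonneg (sub_nonneg.2 hη.2) I.h_nonneg, ?_, ?_, ?_, ?_, by linarith,
      fun z hz => ?_⟩
    · have := mul_nonneg hη.1 hd0.le
      linarith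
    · rw [hRh] at hd ⊢
      rw [hd] at hηd
      linarith
    · exact mul_le_mul_of_nonneg_left (by linarith [hA.deriv_nonneg I.e_mem])
        (sub_nonneg.2 hη.2)
    · linarith [I.budget, hA.deriv_sub_infoRent_le htI I.e_mem ht.2.le]
    · have h2 := I.line z hz
      rw [← hp] at h2
      have h3 := mul_nonneg hη.1 (add_nonneg I.h_nonneg (sub_nonneg.2 hz.1))
      linarith
  have h2 := H.le_cost _ _ _ _ himp
  rw [reducedCost_eq, reducedCost_eq, ← hp, hP.cost_principal.zero] at h2
  have h3 : (1 - t) * P.cP η ≤ P.cP η :=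
    mul_le_of_le_one_left (hP.cost_principal.nonneg hη) (by linarith [htI.1])
  have h4 := hP.cost_principal.le_one_of_le hη
  have h5 := hA.tangent_le htI I.e_mem
  obtain ⟨ξ, hξ, h6⟩ := exists_slope_eq_of_hasDerivWithinAt_unit
    (fun _ he => hA.hasDerivWithinAt_infoRent he) htI.1 ht.2 I.e_mem.2
  have hξI : ξ ∈ Icc (0 : ℝ) 1 := ⟨htI.1.trans hξ.1.le, hξ.2.le.trans I.e_mem.2⟩
  have h7 : ξ * costDeriv 2 P.cA ξ ≤ B := le_trans (le_abs_self _) (hB ξ hξI)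
  have hte : 0 < e - t := sub_pos.2 ht.2
  have h8 : η ≤ B / d * (e - t) := by
    rw [hηdef, h6, div_mul_eq_mul_div]
    exact div_le_div_of_nonneg_right (mul_le_mul_of_nonneg_right h7 hte.le) hd0.le
  have h9 := mul_le_mul_of_nonneg_left h8 (hP.cost_principal.deriv_nonneg hη)
  have h10 := mul_lt_mul_of_pos_right hlt hte
  linarith

end IsPointwiseOptimal

/-! ### The shape of the optimal concealment payoff -/

namespace TaxMechanism

variable {P : AuditProblem} {m : TaxMechanism}

/-- The slope of the concealment payoff stays below one before the highest type: otherwise taxing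
the highest types a bit more and auditing a bit more raises the profit. -/
theorem IsTight.concealment_slope_lt (hP : P.IsValid) (hF : P.F {P.xhigh} = 0) (hm : IsTight P m)
    (ho : IsOptimal P m) {x₁ : ℝ} (hx₁ : x₁ ∈ P.types) (hlt : x₁ < P.xhigh) :
    concealment P m P.xhigh - concealment P m x₁ < P.xhigh - x₁ := by
  by_contra! hge
  set w := concealment P m with hw
  have hreg : IsRegularOn P w := hm.isRegularOn hP
  have hHT : P.xhigh ∈ P.types := ⟨hP.xlow_lt_xhigh.le, le_rfl⟩
  -- As no slope exceeds one, an average slope of one forces `w` to be affine up to the top, and it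
  -- can be flattened there to slope 1 - ε.
  have haff : ∀ z ∈ Icc x₁ P.xhigh, w z = w x₁ + (z - x₁) := by
    intro z hz
    have hzT : z ∈ P.types := ⟨hx₁.1.trans hz.1, hz.2⟩
    have h1 := hreg.sub_le_sub x₁ hx₁ z hzT hz.1
    have h2 := hreg.sub_le_sub z hzT _ hHT hz.2
    linarith
  refine ho.false_of_flatten hP hF hlt fun ε hε => ⟨fun z => w z - ε * max (z - x₁) 0,
    hreg.continuousOn.sub (by fun_prop), fun x hx => ?_⟩
  have hopt := hm.isPointwiseOptimal hP hx
  have I := hopt.implementable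
  rw [hm.cost_eq hP hx]
  rw [← hw] at hopt I
  set e := m.eA x
  set p := m.eP x
  set R := refundNA m x
  set h := (1 - m.eP x) * m.r0 x
  have hxτ : 0 ≤ x + P.τ := add_nonneg (hP.types_nonneg hx) hP.funds_pos.le
  have hεI : ε ∈ Icc (0 : ℝ) 1 := Ioo_subset_Icc_self hε
  have hcε := hP.cost_principal.nonneg hεI
  have hcp := hP.cost_principal.nonneg I.p_mem
  have he1 : 0 ≤ 1 - e := sub_nonneg.2 I.e_mem.2
  rcases le_or_gt x x₁ with hxx | hxx
  · have hmax : max (x - x₁) 0 = 0 := max_eq_right (by linarith)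
    have hline : ∀ p' h' : ℝ, p ≤ p' → ε ≤ p' → h' ≤ h → ∀ z ∈ Icc x P.xhigh,
        h' + (1 - p') * (z - x) ≤ w z - ε * max (z - x₁) 0 := by
      intro p' h' hpp hεp hh z hz
      have h1 := mul_le_mul_of_nonneg_right hpp (sub_nonneg.2 hz.1)
      rcases le_or_gt z x₁ with hzx | hzx
      · rw [max_eq_right (by linarith), mul_zero, sub_zero]
        linarith [I.line z hz]
      · rw [max_eq_left (by linarith), haff z ⟨hzx.le, hz.2⟩]
        have h2 := I.line x₁ ⟨hxx, hlt.le⟩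
        have h3 := mul_le_mul_of_nonneg_right hpp (sub_nonneg.2 hxx)
        have h4 := mul_le_mul_of_nonneg_right hεp (sub_nonneg.2 hzx.le)
        linarith
    have hfl : w x - ε * max (x - x₁) 0 ≤ R + infoRent P.cA e := by
      rw [hmax, mul_zero, sub_zero]; exact I.floor
    rcases le_or_gt ε p with hεp | hεp
    · refine ⟨e, p, R, h, ⟨I.e_mem, I.p_mem, I.h_nonneg, I.h_le, I.sub_le, I.h_le_mul, I.budget,
        hfl, hline p h le_rfl hεp le_rfl⟩, ?_⟩
      rw [hmax]; linarith
    · have hp1 : 0 < 1 - p := by linarith [hε.2]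
      -- For lower types, audits below ε are raised to ε; scaling `h` by this ratio keeps the refund
      -- per event without evidence fixed.
      have hq : (1 - ε) / (1 - p) ≤ 1 := (div_le_one hp1).2 (by linarith)
      have hq0 : 0 ≤ (1 - ε) / (1 - p) := div_nonneg (by linarith [hε.2]) hp1.le
      have hq2 : (1 - ε) / (1 - p) * (1 - p) = 1 - ε := div_mul_cancel₀ _ hp1.ne'
      set q := (1 - ε) / (1 - p)
      have hqh : q * h ≤ h := mul_le_of_le_one_left I.h_nonneg hq
      have h5 := mul_le_mul_of_nonneg_left I.h_le_mul hq0
      have h6 := mul_le_mul_of_nonneg_left I.h_le_mul (sub_nonneg.2 hq)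
      have h7 : q * ((1 - p) * (x + P.τ)) = (1 - ε) * (x + P.τ) := by rw [← mul_assoc, hq2]
      refine ⟨e, ε, R, q * h, ⟨I.e_mem, hεI, mul_nonneg hq0 I.h_nonneg, hqh.trans I.h_le, ?_, ?_,
        I.budget, hfl, hline ε _ hεp.le le_rfl hqh⟩, ?_⟩
      · linarith [I.sub_le]
      · linarith
      · rw [hmax]
        have h8 := mul_nonneg I.e_mem.1 hcε
        have h9 := mul_nonneg he1 hcp
        simp only [reducedCost]
        linarith
  · have hwx := haff x ⟨hxx.le, hx.2⟩
    have hw0 : 0 ≤ w x₁ := hm.1.concealment_nonneg hP hx₁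
    have hmax : max (x - x₁) 0 = x - x₁ := max_eq_left (by linarith)
    have hIR := hP.cost_agent.infoRent_nonneg hP.rent_regularity I.e_mem
    set v := w x - ε * max (x - x₁) 0 with hv
    have hv' : v = w x₁ + (1 - ε) * (x - x₁) := by rw [hv, hmax, hwx]; ring
    have h10 := mul_nonneg (sub_pos.2 hε.2).le (sub_pos.2 hxx).le
    have hεx := mul_nonneg hε.1.le (sub_pos.2 hxx).le
    have hv0 : 0 ≤ v := by linarith
    have hvw : v ≤ w x := by rw [hv, hmax]; linarith
    have hvx : v ≤ x + P.τ := by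
      have h1 := hP.cost_agent.nonneg I.e_mem
      have h2 := mul_nonneg (sub_nonneg.2 I.e_mem.2) (hP.cost_agent.deriv_nonneg I.e_mem)
      have h3 := I.budget
      have h4 := I.floor
      simp only [infoRent] at h4
      linarith
    refine ⟨0, ε, v, (1 - ε) * v, ⟨left_mem_Icc.2 zero_le_one, hεI,
      mul_nonneg (sub_pos.2 hε.2).le hv0, mul_le_of_le_one_left hv0 (by linarith [hε.1]), ?_,
      mul_le_mul_of_nonneg_left hvx (sub_pos.2 hε.2).le, ?_, ?_, ?_⟩, ?_⟩
    · have := mul_le_mul_of_nonneg_left hvx hε.1.le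
      linarith
    · rw [hP.cost_agent.deriv_zero, add_zero]; exact hvx
    · rw [hP.cost_agent.infoRent_zero, add_zero]
    · intro z hz
      rw [max_eq_left (by linarith [hz.1]), haff z ⟨hxx.le.trans hz.1, hz.2⟩]
      have := mul_nonneg hε.1.le hv0
      linarith
    · have h1 := hP.cost_agent.nonneg I.e_mem
      have h2 := mul_nonneg he1 hcp
      rw [reducedCost_eq P e p R]
      simp only [reducedCost]
      rw [hmax] at hv ⊢
      linarith [I.floor]

/-- The lowest type can only mimic itself, so w = h there. If h were positive, the binding floor
would give R ≤ h, whereas the refund after the principal's evidence would be maximal and paid with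
positive probability. -/
theorem IsTight.concealment_xlow_eq_zero (hP : P.IsValid) (hF : P.F {P.xhigh} = 0)
    (hm : IsTight P m) (ho : IsOptimal P m) : concealment P m P.xlow = 0 := by
  have hLT : P.xlow ∈ P.types := ⟨le_rfl, hP.xlow_lt_xhigh.le⟩
  refine le_antisymm ?_ (hm.1.concealment_nonneg hP hLT)
  by_contra! hpos
  have H := hm.isPointwiseOptimal hP hLT
  have hw : concealment P m P.xlow = (1 - m.eP P.xlow) * m.r0 P.xlow := concealment_xlow
  have hR : 0 < refundNA m P.xlow := by linarith [H.implementable.h_le]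
  have h1 := H.floor_eq_of_pos hR
  have h2 := hP.cost_agent.infoRent_nonneg hP.rent_regularity H.implementable.e_mem
  have hp := H.p_pos hP hLT
    (hm.concealment_slope_lt hP hF ho hLT hP.xlow_lt_xhigh)
  have h3 := H.refund_eq_of_h_pos hP hLT (by rwa [← hw]) hp
  have h4 := mul_pos hp (add_pos_of_nonneg_of_pos hP.xlow_nonneg hP.funds_pos)
  linarith

theorem IsTight.concealment_le_self (hP : P.IsValid) (hF : P.F {P.xhigh} = 0)
    (hm : IsTight P m) (ho : IsOptimal P m) {x : ℝ} (hx : x ∈ P.types) :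
    concealment P m x ≤ x := by
  have h1 := (hm.isRegularOn hP).sub_le_sub _ ⟨le_rfl, hP.xlow_lt_xhigh.le⟩ x hx hx.1
  rw [hm.concealment_xlow_eq_zero hP hF ho] at h1
  linarith [hP.xlow_nonneg]

/-- The concealment payoff has a positive slope at the lowest type: otherwise raising it there is
free because low types get a rent from acquiring evidence, and it saves audits. -/
theorem IsTight.exists_slope_pos (hP : P.IsValid) (hF : P.F {P.xhigh} = 0)
    (hm : IsTight P m) (ho : IsOptimal P m) :
    ∃ s : ℝ, 0 < s ∧ ∀ z ∈ P.types, s * (z - P.xlow) ≤ concealment P m z := by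
  by_contra! hno
  set w := concealment P m with hw
  have hreg : IsRegularOn P w := hm.isRegularOn hP
  have hLT : P.xlow ∈ P.types := ⟨le_rfl, hP.xlow_lt_xhigh.le⟩
  have hHT : P.xhigh ∈ P.types := ⟨hP.xlow_lt_xhigh.le, le_rfl⟩
  have hd : 0 < P.xhigh - P.xlow := sub_pos.2 hP.xlow_lt_xhigh
  have hw0 : ∀ z ∈ P.types, 0 ≤ w z := fun z hz => hm.1.concealment_nonneg hP hz
  have hI : ∀ x ∈ P.types, IsImplementable P w x (m.eA x) (m.eP x) (refundNA m x)
      ((1 - m.eP x) * m.r0 x) := fun x hx => (hm.isPointwiseOptimal hP hx).implementable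
  -- If `w` vanishes at the top, every lower type is audited for sure.
  rcases (hw0 _ hHT).eq_or_lt with hwH | hwH
  · refine ho.not_forall_audit hP hF fun x hx hne => ?_
    have h1 := (hI x hx).line P.xhigh ⟨hx.2, le_rfl⟩
    rw [← hwH] at h1
    have h2 : 0 < P.xhigh - x := sub_pos.2 (lt_of_le_of_ne hx.2 hne)
    have h3 := (hI x hx).h_nonneg
    refine le_antisymm (hI x hx).p_mem.2 ?_
    by_contra! h4
    have := mul_pos (sub_pos.2 h4) h2
    linarith
  -- Slopes below one make `w` positive at `P.xhigh - w P.xhigh`, and slopes of at most one keep it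
  -- positive slightly to the left.
  have hz₁ : ∃ z₁ ∈ P.types, z₁ < P.xhigh - w P.xhigh ∧ 0 < w z₁ := by
    have h1 := hm.concealment_slope_lt hP hF ho hLT hP.xlow_lt_xhigh
    rw [hm.concealment_xlow_eq_zero hP hF ho, ← hw] at h1
    set l := P.xhigh - w P.xhigh with hl
    have hlT : l ∈ P.types := ⟨by linarith, by linarith⟩
    have h2 := hm.concealment_slope_lt hP hF ho hlT (by linarith)
    rw [← hw] at h2
    have hwl : 0 < w l := by linarith
    have hzT : max P.xlow (l - w l / 2) ∈ P.types :=
      ⟨le_max_left _ _, max_le hLT.2 (by linarith [hlT.2])⟩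
    have hzl : max P.xlow (l - w l / 2) < l := max_lt (by linarith) (by linarith)
    refine ⟨_, hzT, hzl, ?_⟩
    have h3 := hreg.sub_le_sub _ hzT l hlT hzl.le
    linarith [le_max_right P.xlow (l - w l / 2)]
  obtain ⟨z₁, hz₁T, hz₁l, hwz₁⟩ := hz₁
  have hHz : 0 < P.xhigh - z₁ := by linarith
  -- The first term bounds the audits of types up to `z₁` from below, via the line constraint at the
  -- top; the cap 1/2 ensures `p₀ ≤ 1 - σ / 2` for the σ chosen later.
  set p₀ := min (1 - w P.xhigh / (P.xhigh - z₁)) (1 / 2) with hp₀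
  have hp₀0 : 0 < p₀ := by
    refine lt_min (sub_pos.2 ((div_lt_one hHz).2 (by linarith))) (by norm_num)
  have hp₀h : p₀ ≤ 1 / 2 := min_le_right _ _
  have hp₀I : p₀ ∈ Icc (0 : ℝ) 1 := ⟨hp₀0.le, by linarith⟩
  have hs₀ := hP.secondBest_mem hp₀I
  have hρ := hP.cost_agent.infoRent_strictMonoOn hP.rent_regularity
  set u₀ := infoRent P.cA (P.secondBestEffort p₀) with hu₀
  have hu₀0 : 0 < u₀ := hP.cost_agent.infoRent_pos hP.rent_regularity
    (hP.secondBest_pos hp₀0 hp₀I.2) hs₀.2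
  have hU : ∀ x ∈ P.types, x ≤ z₁ → u₀ ≤ refundNA m x + infoRent P.cA (m.eA x) := by
    intro x hx hxz
    have hpx : p₀ ≤ m.eP x := by
      have h1 := (hI x hx).line P.xhigh ⟨hx.2, le_rfl⟩
      have h2 := (hI x hx).h_nonneg
      have h3 : 1 - m.eP x ≤ w P.xhigh / (P.xhigh - z₁) := by
        rw [le_div_iff₀ hHz]
        have h4 := mul_le_mul_of_nonneg_left (sub_le_sub_left hxz P.xhigh)
          (sub_nonneg.2 (hI x hx).p_mem.2)
        linarith
      linarith [min_le_left (1 - w P.xhigh / (P.xhigh - z₁)) (1 / 2)]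
    have h5 := (hm.isPointwiseOptimal hP hx).secondBest_le hP hx
      (hm.concealment_le_self hP hF ho hx)
    have h6 := hP.secondBest_strictMonoOn.monotoneOn hp₀I (hI x hx).p_mem hpx
    have h7 := hρ.monotoneOn hs₀ (hI x hx).e_mem (h6.trans h5)
    linarith [(hm.isPointwiseOptimal hP hx).refund_nonneg]
  -- The line of slope σ from the lowest type lies below the utilities already granted: below `u₀`
  -- up to `z₁` and below `w z₁` afterwards. Hence `w` can be raised to it.
  set σ := min 1 (min u₀ (w z₁) / (P.xhigh - P.xlow)) with hσ
  have hσ0 : 0 < σ := lt_min zero_lt_one (div_pos (lt_min hu₀0 hwz₁) hd)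
  have hσ1 : σ ≤ 1 := min_le_left _ _
  have hσd : σ * (P.xhigh - P.xlow) ≤ min u₀ (w z₁) := by
    rw [← le_div_iff₀ hd]; exact min_le_right _ _
  have hσz : ∀ z ∈ P.types, σ * (z - P.xlow) ≤ min u₀ (w z₁) := fun z hz =>
    (mul_le_mul_of_nonneg_left (sub_le_sub_right hz.2 _) hσ0.le).trans hσd
  -- At `z₂` the old `w` is so low that types below `P.xlow + δ` are audited with probability at
  -- least 1 - σ/2, while 1 - σ suffices for the raised `w`.
  obtain ⟨z₂, hz₂T, hz₂⟩ := hno (σ / 2) (by linarith)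
  set δ := z₂ - P.xlow - w z₂ / (σ / 2) with hδ
  have hδ0 : 0 < δ := by
    rw [hδ, sub_pos, div_lt_iff₀ (by linarith)]
    linarith
  have hδz : w z₂ = σ / 2 * (z₂ - P.xlow - δ) := by
    rw [hδ]; field_simp; ring
  have hp1I : 1 - σ / 2 ∈ Icc (0 : ℝ) 1 := ⟨by linarith, by linarith⟩
  have hp2I : 1 - σ ∈ Icc (0 : ℝ) 1 := ⟨by linarith, by linarith⟩
  have hs1 := hP.secondBest_mem hp1I
  set s₁ := P.secondBestEffort (1 - σ / 2) with hs₁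
  have hκ : 0 < (1 - s₁) * (P.cP (1 - σ / 2) - P.cP (1 - σ)) :=
    mul_pos (sub_pos.2 (hP.secondBest_lt_one hp1I))
      (sub_pos.2 (hP.cost_principal.strictly_increasing hp2I hp1I (by linarith)))
  refine ho.false_of_gain hP hF hδ0 hκ (w := fun z => max (w z) (σ * (z - P.xlow)))
    (ContinuousOn.sup hreg.continuousOn (by fun_prop)) fun x hx => ?_
  rw [hm.cost_eq hP hx]
  have I := hI x hx
  by_cases hxδ : x < P.xlow + δ
  · have hxτ : 0 ≤ x + P.τ := add_nonneg (hP.types_nonneg hx) hP.funds_pos.le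
    have hw2 := hw0 _ hz₂T
    have hxz₂ : x < z₂ := by
      rw [hδz] at hw2
      have := nonneg_of_mul_nonneg_right hw2 (by linarith)
      linarith
    have hu₁ : u₀ ≤ infoRent P.cA s₁ := hρ.monotoneOn hs₀ hs1
      (hP.secondBest_strictMonoOn.monotoneOn hp₀I hp1I (by linarith))
    refine ⟨s₁, 1 - σ, 0, 0, ⟨hs1, hp2I, le_rfl, le_rfl, ?_, ?_, ?_, ?_, ?_⟩, fun _ => ?_⟩
    · rw [sub_zero]; exact mul_nonneg hp2I.1 hxτ
    · exact mul_nonneg (sub_nonneg.2 hp2I.2) hxτ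
    · linarith [hP.cost_agent.deriv_le_deriv_one hs1, hP.budget.1, hP.types_nonneg hx]
    · have h1 := (hσz x hx).trans (min_le_left _ _)
      have h2 := (hσz z₂ hz₂T).trans (min_le_left _ _)
      have h3 := hreg.monotoneOn hx hz₂T hxz₂.le
      have h4 := mul_nonneg hσ0.le (sub_nonneg.2 hz₂T.1)
      rw [zero_add]
      exact max_le (by linarith) (by linarith)
    · intro z hz
      refine le_trans ?_ (le_max_right _ _)
      have := mul_le_mul_of_nonneg_left (sub_le_sub_left hx.1 z) hσ0.le
      linarith
    · rw [if_pos hxδ]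
      have hpx : 1 - σ / 2 ≤ m.eP x := by
        have h1 := I.line z₂ ⟨hxz₂.le, hz₂T.2⟩
        have h2 := I.h_nonneg
        have h3 := mul_le_mul_of_nonneg_left (show z₂ - P.xlow - δ ≤ z₂ - x by linarith)
          (show 0 ≤ σ / 2 by linarith)
        have h4 : 1 - m.eP x ≤ σ / 2 :=
          le_of_mul_le_mul_right (by linarith) (sub_pos.2 hxz₂)
        linarith
      have h5 := hP.reducedCost_secondBest_le (R := 0) hp1I I.e_mem
      have h6 := mul_le_mul_of_nonneg_left
        (hP.cost_principal.strictly_increasing.monotoneOn hp1I I.p_mem hpx)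
        (sub_nonneg.2 I.e_mem.2)
      have h7 := (hm.isPointwiseOptimal hP hx).refund_nonneg
      rw [← hs₁] at h5
      simp only [reducedCost] at h5 ⊢
      linarith
  · refine ⟨m.eA x, m.eP x, refundNA m x, (1 - m.eP x) * m.r0 x, ⟨I.e_mem, I.p_mem, I.h_nonneg,
      I.h_le, I.sub_le, I.h_le_mul, I.budget, max_le I.floor ?_, fun z hz =>
        (I.line z hz).trans (le_max_left _ _)⟩, fun _ => ?_⟩
    · rcases le_total x z₁ with h1 | h1
      · exact ((hσz x hx).trans (min_le_left _ _)).trans (hU x hx h1)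
      · have h2 := hreg.monotoneOn hz₁T hx h1
        linarith [(hσz x hx).trans (min_le_right _ _), I.floor]
    · rw [if_neg hxδ, add_zero]

end TaxMechanism

/-! ### The minimal audit probability -/

/-- The properties of the concealment payoff in a tight and optimal mechanism. -/
structure IsOptimalProfile (P : AuditProblem) (w : ℝ → ℝ) : Prop extends IsRegularOn P w where
  map_xlow : w P.xlow = 0
  slope_lt_one : ∀ x ∈ P.types, x < P.xhigh → w P.xhigh - w x < P.xhigh - x
  exists_slope_pos : ∃ s : ℝ, 0 < s ∧ ∀ z ∈ P.types, s * (z - P.xlow) ≤ w z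

theorem TaxMechanism.IsTight.isOptimalProfile {P : AuditProblem} {m : TaxMechanism}
    (hP : P.IsValid) (hF : P.F {P.xhigh} = 0) (hm : IsTight P m) (ho : IsOptimal P m) :
    IsOptimalProfile P (concealment P m) :=
  ⟨hm.isRegularOn hP, hm.concealment_xlow_eq_zero hP hF ho,
    fun _ hx hlt => hm.concealment_slope_lt hP hF ho hx hlt, hm.exists_slope_pos hP hF ho⟩

/-- The largest slope of a line through `(x, 0)` that stays below `w`: one minus the smallest audit
probability that deters higher types from mimicking `x` if `x` gets no refund without evidence. -/
def maxSlope (P : AuditProblem) (w : ℝ → ℝ) (x : ℝ) : ℝ :=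
  sSup {s | s ∈ Icc (0 : ℝ) 1 ∧ ∀ z ∈ Icc x P.xhigh, s * (z - x) ≤ w z}

/-- The smallest audit probability that deters higher types from mimicking `x` if `x` gets no
refund without evidence. -/
def minAudit (P : AuditProblem) (w : ℝ → ℝ) (x : ℝ) : ℝ := 1 - maxSlope P w x

namespace IsOptimalProfile

variable {P : AuditProblem} {w : ℝ → ℝ} (hw : IsOptimalProfile P w) (hP : P.IsValid)

include hP in
theorem _root_.AuditProblem.IsValid.xlow_mem : P.xlow ∈ P.types := ⟨le_rfl, hP.xlow_lt_xhigh.le⟩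

include hP in
theorem _root_.AuditProblem.IsValid.xhigh_mem : P.xhigh ∈ P.types := ⟨hP.xlow_lt_xhigh.le, le_rfl⟩

include hw

theorem nonneg {x : ℝ} (hx : x ∈ P.types) : 0 ≤ w x := by
  obtain ⟨s, hs, h⟩ := hw.exists_slope_pos
  exact (mul_nonneg hs.le (sub_nonneg.2 hx.1)).trans (h x hx)

theorem pos {x : ℝ} (hx : x ∈ P.types) (hlt : P.xlow < x) : 0 < w x := by
  obtain ⟨s, hs, h⟩ := hw.exists_slope_pos
  exact (mul_pos hs (sub_pos.2 hlt)).trans_le (h x hx)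

include hP

/-- Chords of the convex function `w` from its zero at the lowest type have increasing slopes; the
product form avoids division at that type. -/
theorem mul_le_mul_of_le {x y : ℝ} (hx : x ∈ P.types) (hy : y ∈ P.types) (hxy : x ≤ y) :
    w x * (y - P.xlow) ≤ (x - P.xlow) * w y := by
  rcases (hx.1.trans hxy).eq_or_lt with h0 | h0
  · have h1 : x = P.xlow := le_antisymm (hxy.trans h0.ge) hx.1
    rw [h1, hw.map_xlow]; simp
  · have hd : 0 < y - P.xlow := sub_pos.2 h0
    have ha : 0 ≤ (y - x) / (y - P.xlow) := div_nonneg (sub_nonneg.2 hxy) hd.le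
    have hb : 0 ≤ (x - P.xlow) / (y - P.xlow) := div_nonneg (sub_nonneg.2 hx.1) hd.le
    have h1 := hw.convexOn.2 hP.xlow_mem hy ha hb (by field_simp; ring)
    have h2 : ((y - x) / (y - P.xlow)) • P.xlow + ((x - P.xlow) / (y - P.xlow)) • y = x := by
      simp only [smul_eq_mul]; field_simp; ring
    rw [h2, hw.map_xlow, smul_zero, zero_add, smul_eq_mul, div_mul_eq_mul_div,
      le_div_iff₀ hd] at h1
    exact h1

theorem strictMonoOn : StrictMonoOn w P.types := by
  intro x hx y hy hxy
  have h1 := hw.mul_le_mul_of_le hP hx hy hxy.le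
  have h2 := hw.pos hy (hx.1.trans_lt hxy)
  have h3 : (x - P.xlow) * w y < (y - P.xlow) * w y := mul_lt_mul_of_pos_right (by linarith) h2
  refine lt_of_mul_lt_mul_right (a := y - P.xlow) ?_ (by linarith [hx.1])
  linarith

theorem le_self {x : ℝ} (hx : x ∈ P.types) : w x ≤ x := by
  have h1 := hw.sub_le_sub _ hP.xlow_mem x hx hx.1
  rw [hw.map_xlow] at h1
  linarith [hP.xlow_nonneg]

omit hP in
theorem maxSlope_set_nonempty {x : ℝ} (hx : x ∈ P.types) :
    {s | s ∈ Icc (0 : ℝ) 1 ∧ ∀ z ∈ Icc x P.xhigh, s * (z - x) ≤ w z}.Nonempty :=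
  ⟨0, left_mem_Icc.2 zero_le_one, fun z hz => by
    rw [zero_mul]; exact hw.nonneg ⟨hx.1.trans hz.1, hz.2⟩⟩

omit hw hP in
theorem le_maxSlope {x s : ℝ} (hs : s ∈ Icc (0 : ℝ) 1)
    (h : ∀ z ∈ Icc x P.xhigh, s * (z - x) ≤ w z) : s ≤ maxSlope P w x :=
  le_csSup ⟨1, fun _ ht => ht.1.2⟩ ⟨hs, h⟩

omit hP in
theorem maxSlope_mem {x : ℝ} (hx : x ∈ P.types) : maxSlope P w x ∈ Icc (0 : ℝ) 1 :=
  ⟨le_maxSlope (left_mem_Icc.2 zero_le_one) fun z hz => by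
    rw [zero_mul]; exact hw.nonneg ⟨hx.1.trans hz.1, hz.2⟩,
    csSup_le (hw.maxSlope_set_nonempty hx) fun _ ht => ht.1.2⟩

omit hP in
theorem maxSlope_line {x : ℝ} (hx : x ∈ P.types) {z : ℝ} (hz : z ∈ Icc x P.xhigh) :
    maxSlope P w x * (z - x) ≤ w z := by
  rcases hz.1.eq_or_lt with h | h
  · rw [← h, sub_self, mul_zero]; exact hw.nonneg hx
  · rw [← le_div_iff₀ (sub_pos.2 h)]
    refine csSup_le (hw.maxSlope_set_nonempty hx) fun t ht => ?_
    rw [le_div_iff₀ (sub_pos.2 h)]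
    exact ht.2 z hz

omit hP in
theorem maxSlope_mono {x y : ℝ} (hx : x ∈ P.types) (hxy : x ≤ y) :
    maxSlope P w x ≤ maxSlope P w y := by
  refine le_maxSlope (hw.maxSlope_mem hx) fun z hz => ?_
  have h1 := hw.maxSlope_line hx ⟨hxy.trans hz.1, hz.2⟩
  have h2 := mul_le_mul_of_nonneg_left (sub_le_sub_left hxy z) (hw.maxSlope_mem hx).1
  linarith

omit hP in
theorem maxSlope_xlow_pos : 0 < maxSlope P w P.xlow := by
  obtain ⟨s, hs, h⟩ := hw.exists_slope_pos
  refine (lt_min hs zero_lt_one).trans_le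
    (le_maxSlope ⟨(lt_min hs zero_lt_one).le, min_le_right _ _⟩ fun z hz => ?_)
  exact (mul_le_mul_of_nonneg_right (min_le_left _ _) (sub_nonneg.2 hz.1)).trans (h z hz)

theorem maxSlope_pos {x : ℝ} (hx : x ∈ P.types) : 0 < maxSlope P w x :=
  (hw.maxSlope_xlow_pos).trans_le (hw.maxSlope_mono hP.xlow_mem hx.1)

omit hP in
theorem maxSlope_lt_one {x : ℝ} (hx : x ∈ P.types) (h : x < P.xhigh - w P.xhigh) :
    maxSlope P w x < 1 := by
  have h1 := hw.maxSlope_line hx ⟨hx.2, le_rfl⟩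
  by_contra! h2
  have := mul_le_mul_of_nonneg_right h2 (sub_nonneg.2 hx.2)
  linarith

theorem maxSlope_eq_one {x : ℝ} (hx : x ∈ P.types) (h : P.xhigh - w P.xhigh ≤ x) :
    maxSlope P w x = 1 := by
  refine le_antisymm (hw.maxSlope_mem hx).2 (le_maxSlope (right_mem_Icc.2 zero_le_one) ?_)
  intro z hz
  have := hw.sub_le_sub z ⟨hx.1.trans hz.1, hz.2⟩ _ hP.xhigh_mem hz.2
  linarith

/-- A steepest line below the cap must touch `w`: by compactness a positive minimal distance would
leave room for a larger slope. -/
theorem exists_contact {x : ℝ} (hx : x ∈ P.types) (h : maxSlope P w x < 1) :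
    ∃ z ∈ Icc x P.xhigh, w z = maxSlope P w x * (z - x) := by
  have hsub : Icc x P.xhigh ⊆ P.types := Icc_subset_Icc_left hx.1
  have hcont : ContinuousOn (fun z => w z - maxSlope P w x * (z - x)) (Icc x P.xhigh) :=
    (hw.continuousOn.mono hsub).sub (by fun_prop)
  obtain ⟨z, hz, hmin⟩ := isCompact_Icc.exists_isMinOn (nonempty_Icc.2 hx.2) hcont
  refine ⟨z, hz, le_antisymm ?_ (hw.maxSlope_line hx hz)⟩
  by_contra! hlt
  have hd : 0 < P.xhigh - P.xlow := sub_pos.2 hP.xlow_lt_xhigh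
  set f := w z - maxSlope P w x * (z - x) with hf
  set η := min (1 - maxSlope P w x) (f / (P.xhigh - P.xlow))
  have hη0 : 0 < η := lt_min (by linarith) (div_pos (by linarith) hd)
  have hη1 : η ≤ 1 - maxSlope P w x := min_le_left _ _
  have hη2 : η * (P.xhigh - P.xlow) ≤ f := by
    rw [← le_div_iff₀ hd]; exact min_le_right _ _
  have := le_maxSlope (P := P) (w := w) (x := x) (s := maxSlope P w x + η)
    ⟨by linarith [(hw.maxSlope_mem hx).1], by linarith⟩ fun y hy => by
      have h1 : f ≤ w y - maxSlope P w x * (y - x) := hmin hy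
      have h2 := mul_le_mul_of_nonneg_left
        (show y - x ≤ P.xhigh - P.xlow by linarith [hy.2, hx.1]) hη0.le
      linarith
  linarith

theorem maxSlope_strictMono {x y : ℝ} (hx : x ∈ P.types) (hy : y ∈ P.types) (hxy : x < y)
    (h : maxSlope P w y < 1) : maxSlope P w x < maxSlope P w y := by
  obtain ⟨z, hz, hz2⟩ := hw.exists_contact hP hy h
  have h1 := hw.maxSlope_line hx ⟨hxy.le.trans hz.1, hz.2⟩
  have h2 := mul_lt_mul_of_pos_left (sub_lt_sub_left hxy z) (hw.maxSlope_pos hP hy)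
  have h3 : 0 < z - x := by linarith [hz.1]
  refine lt_of_mul_lt_mul_right (a := z - x) ?_ h3.le
  linarith

omit hP in
-- From above, a point that violates a steeper line still does so after a small shift of the base.
-- From below, a line moved to a base slightly to the left fits again after its slope is scaled by a
-- factor near one, as `w` is bounded away from zero there.
theorem continuousOn_maxSlope : ContinuousOn (maxSlope P w) P.types := by
  rw [Metric.continuousOn_iff]
  intro x hx ε hε
  have hupper : ∃ δ > 0, ∀ y ∈ P.types, y < x + δ → maxSlope P w y < maxSlope P w x + ε := by
    rcases (hw.maxSlope_mem hx).2.eq_or_lt with h1 | h1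
    · exact ⟨1, one_pos, fun y hy _ => by linarith [(hw.maxSlope_mem hy).2]⟩
    · have hη : 0 < min ε (1 - maxSlope P w x) := lt_min hε (by linarith)
      set η := min ε (1 - maxSlope P w x)
      have hη1 : η ≤ ε := min_le_left _ _
      have hη2 : η ≤ 1 - maxSlope P w x := min_le_right _ _
      have hex : ∃ z ∈ Icc x P.xhigh, w z < (maxSlope P w x + η) * (z - x) := by
        by_contra! hno
        have := le_maxSlope (P := P) (w := w) (x := x) (s := maxSlope P w x + η)
          ⟨by linarith [(hw.maxSlope_mem hx).1], by linarith⟩ hno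
        linarith
      obtain ⟨z, hz, hlt⟩ := hex
      have hs : 0 < maxSlope P w x + η := by linarith [(hw.maxSlope_mem hx).1]
      have hz0 := hw.nonneg ⟨hx.1.trans hz.1, hz.2⟩
      refine ⟨z - x - w z / (maxSlope P w x + η), ?_, fun y hy hyδ => ?_⟩
      · rw [gt_iff_lt, sub_pos, div_lt_iff₀ hs]; linarith
      · have h2 : w z / (maxSlope P w x + η) < z - y := by linarith
        rw [div_lt_iff₀ hs] at h2
        have hzy : 0 < z - y := by linarith [div_nonneg hz0 hs.le]
        have h3 := hw.maxSlope_line hy ⟨by linarith, hz.2⟩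
        have h4 : maxSlope P w y < maxSlope P w x + η :=
          lt_of_mul_lt_mul_right (a := z - y) (by linarith) hzy.le
        linarith
  have hlower : ∃ δ > 0, ∀ y ∈ P.types, x - δ < y → maxSlope P w x - ε < maxSlope P w y := by
    rcases hx.1.eq_or_lt with h1 | h1
    · refine ⟨1, one_pos, fun y hy _ => ?_⟩
      have := hw.maxSlope_mono hx (h1.symm.trans_le hy.1)
      linarith
    · set v := (P.xlow + x) / 2 with hv
      have hvT : v ∈ P.types := ⟨by linarith, by linarith [hx.2]⟩
      have hw0 : 0 < w v := hw.pos hvT (by linarith)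
      refine ⟨min (x - v) (min (w v) (ε * w v)),
        lt_min (by linarith) (lt_min hw0 (mul_pos hε hw0)), fun y hy hyδ => ?_⟩
      rcases le_or_gt x y with hxy | hxy
      · have := hw.maxSlope_mono hx hxy
        linarith
      · have hd1 : x - y < x - v := by linarith [min_le_left (x - v) (min (w v) (ε * w v))]
        have hd2 : x - y < w v := by
          linarith [min_le_right (x - v) (min (w v) (ε * w v)), min_le_left (w v) (ε * w v)]
        have hd3 : x - y < ε * w v := by
          linarith [min_le_right (x - v) (min (w v) (ε * w v)), min_le_right (w v) (ε * w v)]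
        have hd : 0 < w v + (x - y) := by linarith
        -- Moving the base from x to y lifts the line by at most x - y; this factor absorbs the lift
        -- wherever `w` is at least `w v`.
        set θ := w v / (w v + (x - y)) with hθ
        have hθ0 : 0 < θ := div_pos hw0 hd
        have hθ1 : θ ≤ 1 := (div_le_one hd).2 (by linarith)
        have hθ2 : θ * (w v + (x - y)) = w v := div_mul_cancel₀ _ hd.ne'
        have hs := hw.maxSlope_mem hx
        set s := maxSlope P w x
        have hθs : θ * s ≤ 1 := mul_le_one₀ hθ1 hs.1 hs.2
        have h2 : θ * s ≤ maxSlope P w y := by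
          refine le_maxSlope ⟨mul_nonneg hθ0.le hs.1, hθs⟩ fun z hz => ?_
          have hzT : z ∈ P.types := ⟨hy.1.trans hz.1, hz.2⟩
          have hvz : w v ≤ w z := hw.monotoneOn hvT hzT (by linarith [hz.1])
          rcases le_or_gt z x with hzx | hzx
          · have := mul_le_mul_of_nonneg_right hθs (sub_nonneg.2 hz.1)
            linarith
          · have h3 := hw.maxSlope_line hx ⟨hzx.le, hz.2⟩
            have h4 : s * (x - y) ≤ x - y := mul_le_of_le_one_left (by linarith) hs.2
            have h5 := mul_le_mul_of_nonneg_left (show s * (z - y) ≤ w z + (x - y) by linarith)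
              hθ0.le
            have h6 := mul_le_mul_of_nonneg_right hθ1 (sub_nonneg.2 hvz)
            linarith
        have h7 : (1 - θ) * w v ≤ x - y := by
          have h8 := mul_le_mul_of_nonneg_right hθ1 (sub_pos.2 hxy).le
          linarith
        have h9 : 1 - θ < ε := lt_of_mul_lt_mul_right (a := w v) (by linarith) hw0.le
        have h10 := mul_le_mul_of_nonneg_left hs.2 (sub_nonneg.2 hθ1)
        linarith
  obtain ⟨δ₁, hδ₁, h1⟩ := hupper
  obtain ⟨δ₂, hδ₂, h2⟩ := hlower
  refine ⟨min δ₁ δ₂, lt_min hδ₁ hδ₂, fun y hy hyx => ?_⟩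
  rw [Real.dist_eq, abs_lt] at hyx ⊢
  have h3 := h1 y hy (by linarith [min_le_left δ₁ δ₂])
  have h4 := h2 y hy (by linarith [min_le_right δ₁ δ₂])
  constructor <;> linarith

theorem minAudit_mem {x : ℝ} (hx : x ∈ P.types) : minAudit P w x ∈ Ico (0 : ℝ) 1 := by
  have h1 := hw.maxSlope_mem hx
  have h2 := hw.maxSlope_pos hP hx
  simp only [minAudit]
  constructor <;> linarith [h1.2]

theorem minAudit_mem_Icc {x : ℝ} (hx : x ∈ P.types) : minAudit P w x ∈ Icc (0 : ℝ) 1 :=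
  Ico_subset_Icc_self (hw.minAudit_mem hP hx)

omit hP in
theorem minAudit_antitone {x y : ℝ} (hx : x ∈ P.types) (hxy : x ≤ y) :
    minAudit P w y ≤ minAudit P w x := by
  have := hw.maxSlope_mono hx hxy
  simp only [minAudit]
  linarith

omit hP in
theorem minAudit_pos {x : ℝ} (hx : x ∈ P.types) (h : x < P.xhigh - w P.xhigh) :
    0 < minAudit P w x := sub_pos.2 (hw.maxSlope_lt_one hx h)

theorem lt_of_minAudit_pos {x : ℝ} (hx : x ∈ P.types) (h : 0 < minAudit P w x) :
    x < P.xhigh - w P.xhigh := by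
  by_contra! h1
  have := hw.maxSlope_eq_one hP hx h1
  simp only [minAudit] at h
  linarith

omit hP in
theorem continuousOn_minAudit : ContinuousOn (minAudit P w) P.types :=
  continuousOn_const.sub (hw.continuousOn_maxSlope)

/-- The type above which audits are not needed to deter mimicking. -/
theorem threshold_mem : P.xhigh - w P.xhigh ∈ Ioo P.xlow P.xhigh := by
  have h1 := hw.slope_lt_one _ hP.xlow_mem hP.xlow_lt_xhigh
  have h2 := hw.pos hP.xhigh_mem hP.xlow_lt_xhigh
  rw [hw.map_xlow] at h1
  constructor <;> linarith

end IsOptimalProfile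

/-! ### The gap functions and their zeros -/

/-- The rent at the second-best effort, net of the concealment payoff. -/
def lowGap (P : AuditProblem) (w : ℝ → ℝ) (x : ℝ) : ℝ :=
  infoRent P.cA (P.secondBestEffort (minAudit P w x)) - w x

/-- The rent at the first-best effort, net of the concealment payoff. -/
def middleGap (P : AuditProblem) (w : ℝ → ℝ) (x : ℝ) : ℝ :=
  infoRent P.cA (P.firstBestEffort (minAudit P w x)) - w x

/-- The highest utility at the first-best effort without a refund after no evidence, net of the
concealment payoff, relative to the highest refund. -/
def highGap (P : AuditProblem) (w : ℝ → ℝ) (x : ℝ) : ℝ :=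
  minAudit P w x + middleGap P w x / (x + P.τ)

namespace IsOptimalProfile

variable {P : AuditProblem} {w : ℝ → ℝ} (hw : IsOptimalProfile P w) (hP : P.IsValid)
include hw hP

theorem infoRent_firstBest_antitone {x y : ℝ} (hx : x ∈ P.types) (hy : y ∈ P.types)
    (hxy : x ≤ y) : infoRent P.cA (P.firstBestEffort (minAudit P w y)) ≤
      infoRent P.cA (P.firstBestEffort (minAudit P w x)) :=
  (hP.cost_agent.infoRent_strictMonoOn hP.rent_regularity).monotoneOn
    (hP.firstBest_mem (hw.minAudit_mem_Icc hP hy)) (hP.firstBest_mem (hw.minAudit_mem_Icc hP hx))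
    (hP.firstBest_strictMonoOn.monotoneOn (hw.minAudit_mem_Icc hP hy) (hw.minAudit_mem_Icc hP hx)
      (hw.minAudit_antitone hx hxy))

theorem infoRent_secondBest_antitone {x y : ℝ} (hx : x ∈ P.types) (hy : y ∈ P.types)
    (hxy : x ≤ y) : infoRent P.cA (P.secondBestEffort (minAudit P w y)) ≤
      infoRent P.cA (P.secondBestEffort (minAudit P w x)) :=
  (hP.cost_agent.infoRent_strictMonoOn hP.rent_regularity).monotoneOn
    (hP.secondBest_mem (hw.minAudit_mem_Icc hP hy))
    (hP.secondBest_mem (hw.minAudit_mem_Icc hP hx))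
    (hP.secondBest_strictMonoOn.monotoneOn (hw.minAudit_mem_Icc hP hy)
      (hw.minAudit_mem_Icc hP hx) (hw.minAudit_antitone hx hxy))

theorem lowGap_strictAntiOn : StrictAntiOn (lowGap P w) P.types := by
  intro x hx y hy hxy
  have h1 := hw.strictMonoOn hP hx hy hxy
  have h2 := hw.infoRent_secondBest_antitone hP hx hy hxy.le
  simp only [lowGap]
  linarith

theorem middleGap_strictAntiOn : StrictAntiOn (middleGap P w) P.types := by
  intro x hx y hy hxy
  have h1 := hw.strictMonoOn hP hx hy hxy
  have h2 := hw.infoRent_firstBest_antitone hP hx hy hxy.le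
  simp only [middleGap]
  linarith

/-- The ratio is w(x)/(x - x̲), nondecreasing by convexity, times (x - x̲)/(x + τ), strictly
increasing since x̲ + τ > 0. -/
theorem div_strictMonoOn : StrictMonoOn (fun x => w x / (x + P.τ)) P.types := by
  intro x hx y hy hxy
  have hx0 : 0 < x + P.τ := by linarith [hP.types_nonneg hx, hP.funds_pos]
  have hy0 : 0 < y + P.τ := by linarith [hP.types_nonneg hy, hP.funds_pos]
  have h1 := mul_le_mul_of_nonneg_right (hw.mul_le_mul_of_le hP hx hy hxy.le) hy0.le
  have h2 := hw.pos hy (hx.1.trans_lt hxy)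
  have h3 : 0 < w y * ((y - x) * (P.xlow + P.τ)) :=
    mul_pos h2 (mul_pos (by linarith) (by linarith [hP.xlow_nonneg, hP.funds_pos]))
  show w x / (x + P.τ) < w y / (y + P.τ)
  rw [div_lt_div_iff₀ hx0 hy0]
  refine lt_of_mul_lt_mul_right (a := y - P.xlow) ?_ (by linarith [hx.1])
  linarith

theorem highGap_strictAntiOn : StrictAntiOn (highGap P w) P.types := by
  intro x hx y hy hxy
  have hx0 : 0 < x + P.τ := by linarith [hP.types_nonneg hx, hP.funds_pos]
  have h1 : w x / (x + P.τ) < w y / (y + P.τ) := hw.div_strictMonoOn hP hx hy hxy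
  have h2 := hw.minAudit_antitone hx hxy.le
  have h3 : infoRent P.cA (P.firstBestEffort (minAudit P w y)) / (y + P.τ) ≤
      infoRent P.cA (P.firstBestEffort (minAudit P w x)) / (x + P.τ) :=
    div_le_div₀ (hP.cost_agent.infoRent_nonneg hP.rent_regularity
      (hP.firstBest_mem (hw.minAudit_mem_Icc hP hx)))
      (hw.infoRent_firstBest_antitone hP hx hy hxy.le) hx0 (by linarith)
  simp only [highGap, middleGap, sub_div]
  linarith

theorem continuousOn_lowGap : ContinuousOn (lowGap P w) P.types :=
  ((hP.cost_agent.infoRent_continuousOn.comp hP.secondBest_continuousOn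
    fun _ hp => hP.secondBest_mem hp).comp (hw.continuousOn_minAudit)
      fun _ hx => hw.minAudit_mem_Icc hP hx).sub hw.continuousOn

theorem continuousOn_middleGap : ContinuousOn (middleGap P w) P.types :=
  ((hP.cost_agent.infoRent_continuousOn.comp hP.firstBest_continuousOn
    fun _ hp => hP.firstBest_mem hp).comp (hw.continuousOn_minAudit)
      fun _ hx => hw.minAudit_mem_Icc hP hx).sub hw.continuousOn

theorem continuousOn_highGap : ContinuousOn (highGap P w) P.types :=
  (hw.continuousOn_minAudit).add ((hw.continuousOn_middleGap hP).div (by fun_prop)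
    fun x hx => by linarith [hP.types_nonneg hx, hP.funds_pos])

/-- All gaps are negative at the threshold where minimal audits vanish. The order of the zeros is
automatic: the low gap is positive at the bottom, where w = 0; at its zero the middle gap is
positive, since first-best exceeds second-best effort; at the zero of that, the high gap equals the
minimal audit probability. -/
theorem exists_lowGap_middleGap_highGap_eq_zero : ∃ a b c : ℝ, P.xlow < a ∧ a < b ∧ b < c ∧
    c < P.xhigh - w P.xhigh ∧ lowGap P w a = 0 ∧ middleGap P w b = 0 ∧ highGap P w c = 0 := by
  obtain ⟨hl1, hl2⟩ := hw.threshold_mem hP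
  set l := P.xhigh - w P.xhigh with hl
  have hlT : l ∈ P.types := ⟨hl1.le, hl2.le⟩
  have hA := hP.cost_agent
  have hp0 : minAudit P w l = 0 := by
    rw [minAudit, hw.maxSlope_eq_one hP hlT le_rfl, sub_self]
  have hwl := hw.pos hlT hl1
  have hzero : ∀ f : ℝ → ℝ, ContinuousOn f P.types → ∀ y ∈ P.types, y < l → 0 < f y → f l < 0 →
      ∃ z ∈ Ioo y l, f z = 0 := by
    intro f hf y hy hyl h1 h2
    have := intermediate_value_Ioo' hyl.le (hf.mono (Icc_subset_Icc hy.1 hl2.le))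
    exact this ⟨h2, h1⟩
  have hLl : 0 < minAudit P w P.xlow := hw.minAudit_pos hP.xlow_mem hl1
  obtain ⟨a, ha, ha0⟩ := hzero _ (hw.continuousOn_lowGap hP) P.xlow hP.xlow_mem hl1 (by
      rw [lowGap, hw.map_xlow, sub_zero]
      exact hA.infoRent_pos hP.rent_regularity
        (hP.secondBest_pos hLl (hw.minAudit_mem hP hP.xlow_mem).2.le)
        (hP.secondBest_mem (hw.minAudit_mem_Icc hP hP.xlow_mem)).2) (by
      rw [lowGap, hp0, hP.secondBest_zero, hA.infoRent_zero]; linarith)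
  have haT : a ∈ P.types := ⟨ha.1.le, ha.2.le.trans hl2.le⟩
  have hm : middleGap P w l < 0 := by
    rw [middleGap, hp0, hP.firstBest_zero, hA.infoRent_zero]; linarith
  obtain ⟨b, hb, hb0⟩ := hzero _ (hw.continuousOn_middleGap hP) a haT ha.2 (by
      have h1 := hA.infoRent_strictMonoOn hP.rent_regularity
        (hP.secondBest_mem (hw.minAudit_mem_Icc hP haT))
        (hP.firstBest_mem (hw.minAudit_mem_Icc hP haT))
        (hP.secondBest_lt_firstBest (hw.minAudit_pos haT ha.2) (hw.minAudit_mem hP haT).2.le)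
      simp only [lowGap] at ha0
      rw [middleGap]
      linarith) hm
  have hbT : b ∈ P.types := ⟨by linarith [ha.1, hb.1], hb.2.le.trans hl2.le⟩
  have hlτ : 0 < l + P.τ := by linarith [hP.types_nonneg hlT, hP.funds_pos]
  obtain ⟨c, hc, hc0⟩ := hzero _ (hw.continuousOn_highGap hP) b hbT hb.2 (by
      rw [highGap, hb0, zero_div, add_zero]
      exact hw.minAudit_pos hbT hb.2) (by
      rw [highGap, hp0, zero_add]
      exact div_neg_of_neg_of_pos hm hlτ)
  exact ⟨a, b, c, ha.1, hb.1, hc.1, hc.2, ha0, hb0, hc0⟩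

end IsOptimalProfile

/-! ### Which instruments an optimal plan uses -/

namespace IsPointwiseOptimal

variable {P : AuditProblem} {w : ℝ → ℝ} {x e p R h : ℝ}
  (H : IsPointwiseOptimal P w x e p R h) (hw : IsOptimalProfile P w) (hP : P.IsValid)
include H hw hP

omit hw hP in
theorem minAudit_le : minAudit P w x ≤ p := by
  have I := H.implementable
  have := IsOptimalProfile.le_maxSlope (P := P) (w := w) (x := x) (s := 1 - p)
    ⟨sub_nonneg.2 I.p_mem.2, by linarith [I.p_mem.1]⟩ fun z hz => by
      linarith [I.line z hz, I.h_nonneg]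
  simp only [minAudit]
  linarith

theorem of_minAudit_lt (hx : x ∈ P.types) (hlt : minAudit P w x < p) :
    R = h + p * (x + P.τ) ∧ 0 < h :=
  H.refund_eq_of_slack hP hx (hw.le_self hP hx) hw.monotoneOn (hw.maxSlope_mem hx).2
    (by simp only [minAudit] at hlt; linarith) fun _ hz => hw.maxSlope_line hx hz

/-- At the minimal audit probability the mimics' line already touches `w`, which leaves no room for
`h`. -/
theorem h_eq_zero (hx : x ∈ P.types) (hp : p = minAudit P w x) (h0 : 0 < p) : h = 0 := by
  have I := H.implementable
  have h1 : maxSlope P w x < 1 := by simp only [minAudit] at hp; linarith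
  obtain ⟨z, hz, h2⟩ := hw.exists_contact hP hx h1
  have h3 := I.line z hz
  rw [h2, hp] at h3
  simp only [minAudit] at h3
  linarith [I.h_nonneg]

theorem eq_minAudit_of_refund_zero (hx : x ∈ P.types) (hR : R = 0) : p = minAudit P w x := by
  refine le_antisymm ?_ H.minAudit_le
  by_contra! hlt
  obtain ⟨h1, h2⟩ := H.of_minAudit_lt hw hP hx hlt
  have := mul_nonneg H.implementable.p_mem.1
    (show 0 ≤ x + P.τ by linarith [hP.types_nonneg hx, hP.funds_pos])
  linarith

/-- A slack floor forces zero refunds, minimal audits and at most second-best effort. Conversely,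
effort is at least the second best for minimal audits, so a positive gap is a lower bound for the
slack. -/
theorem floor_lt_iff (hx : x ∈ P.types) : w x < R + infoRent P.cA e ↔ 0 < lowGap P w x := by
  have I := H.implementable
  have hρ := hP.cost_agent.infoRent_strictMonoOn hP.rent_regularity
  constructor
  · intro hlt
    obtain ⟨hR, he⟩ := H.of_floor_lt hP hlt
    have hp := H.eq_minAudit_of_refund_zero hw hP hx hR
    have h1 := hρ.monotoneOn I.e_mem (hP.secondBest_mem I.p_mem) he
    rw [lowGap, ← hp]
    linarith
  · intro hpos
    have h1 := hP.secondBest_strictMonoOn.monotoneOn (hw.minAudit_mem_Icc hP hx) I.p_mem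
      H.minAudit_le
    have h2 := H.secondBest_le hP hx (hw.le_self hP hx)
    have h3 := hρ.monotoneOn (hP.secondBest_mem (hw.minAudit_mem_Icc hP hx)) I.e_mem (h1.trans h2)
    simp only [lowGap] at hpos
    linarith [H.refund_nonneg]

theorem infoRent_firstBest_le (hx : x ∈ P.types) (hR : 0 < R) :
    infoRent P.cA (P.firstBestEffort (minAudit P w x)) ≤ infoRent P.cA e := by
  have I := H.implementable
  refine (hP.cost_agent.infoRent_strictMonoOn hP.rent_regularity).monotoneOn
    (hP.firstBest_mem (hw.minAudit_mem_Icc hP hx)) I.e_mem ?_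
  exact (hP.firstBest_strictMonoOn.monotoneOn (hw.minAudit_mem_Icc hP hx) I.p_mem
    H.minAudit_le).trans (H.firstBest_le hP hx (hw.le_self hP hx) hR)

/-- Without refunds, effort must supply `w` and is at most the first best; with a refund, effort is
at least the first best and the floor binds. -/
theorem refund_eq_zero_iff (hx : x ∈ P.types) (hp : 0 < p) : R = 0 ↔ 0 ≤ middleGap P w x := by
  have I := H.implementable
  have hρ := hP.cost_agent.infoRent_strictMonoOn hP.rent_regularity
  have hxτ : 0 < x + P.τ := by linarith [hP.types_nonneg hx, hP.funds_pos]
  constructor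
  · intro hR
    have hpe := H.eq_minAudit_of_refund_zero hw hP hx hR
    have h1 := H.le_firstBest hP (by
      rw [hR]; exact add_pos_of_nonneg_of_pos I.h_nonneg (mul_pos hp hxτ))
    have h2 := hρ.monotoneOn I.e_mem (hP.firstBest_mem I.p_mem) h1
    rw [middleGap, ← hpe]
    linarith [I.floor]
  · intro h0
    refine le_antisymm ?_ H.refund_nonneg
    by_contra! hR
    have h1 := H.infoRent_firstBest_le hw hP hx hR
    have h2 := H.floor_eq_of_pos hR
    simp only [middleGap] at h0
    linarith

/-- The binding floor and first-best rent leave a refund below its maximum at minimal audits,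
whereas excess audits would require it to exceed that maximum. -/
theorem of_highGap_pos (hx : x ∈ P.types) (hp : 0 < p) (hm : middleGap P w x < 0)
    (hh : 0 < highGap P w x) :
    p = minAudit P w x ∧ h = 0 ∧ 0 < R ∧ R < p * (x + P.τ) := by
  have hxτ : 0 < x + P.τ := by linarith [hP.types_nonneg hx, hP.funds_pos]
  have hR : 0 < R := by
    refine lt_of_le_of_ne H.refund_nonneg fun h0 => ?_
    linarith [(H.refund_eq_zero_iff hw hP hx hp).1 h0.symm]
  have h1 := H.infoRent_firstBest_le hw hP hx hR
  have h2 := H.floor_eq_of_pos hR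
  have h3 : R < minAudit P w x * (x + P.τ) := by
    have h4 := mul_pos hh hxτ
    rw [highGap, add_mul, div_mul_cancel₀ _ hxτ.ne'] at h4
    simp only [middleGap] at h4
    linarith
  have hpe : p = minAudit P w x := by
    refine le_antisymm ?_ H.minAudit_le
    by_contra! hlt
    obtain ⟨h5, h6⟩ := H.of_minAudit_lt hw hP hx hlt
    have := mul_lt_mul_of_pos_right hlt hxτ
    linarith
  exact ⟨hpe, H.h_eq_zero hw hP hx hpe hp, hR, by rwa [hpe]⟩

theorem refund_of_highGap_nonpos (hx : x ∈ P.types) (hp : 0 < p) (hm : middleGap P w x < 0)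
    (hh : highGap P w x ≤ 0) : R = h + p * (x + P.τ) ∧ w x = R + infoRent P.cA e := by
  have I := H.implementable
  have hxτ : 0 < x + P.τ := by linarith [hP.types_nonneg hx, hP.funds_pos]
  have hR : 0 < R := by
    refine lt_of_le_of_ne H.refund_nonneg fun h0 => ?_
    linarith [(H.refund_eq_zero_iff hw hP hx hp).1 h0.symm]
  have hfl := H.floor_eq_of_pos hR
  refine ⟨?_, hfl⟩
  rcases H.minAudit_le.eq_or_lt with hpe | hlt
  · refine le_antisymm (by linarith [I.sub_le]) ?_
    by_contra! hlt
    have h1 := H.le_firstBest hP hlt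
    have h2 := (hP.cost_agent.infoRent_strictMonoOn hP.rent_regularity).monotoneOn I.e_mem
      (hP.firstBest_mem I.p_mem) h1
    have h3 := H.h_eq_zero hw hP hx hpe.symm hp
    have h4 := mul_nonpos_of_nonpos_of_nonneg hh hxτ.le
    rw [highGap, add_mul, div_mul_cancel₀ _ hxτ.ne', middleGap, hpe] at h4
    linarith
  · exact (H.of_minAudit_lt hw hP hx hlt).1

end IsPointwiseOptimal

/-! ### High points: where extra audits do not pay -/

/-- The concealment payoff of `x` net of the highest refund with minimal audits and without a
refund after no evidence. -/
def residualRent (P : AuditProblem) (w : ℝ → ℝ) (x : ℝ) : ℝ := w x - minAudit P w x * (x + P.τ)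

/-- With the minimal audit probability and the highest refund after the principal's evidence, a
higher audit probability does not pay at the margin. -/
def IsHighPoint (P : AuditProblem) (w : ℝ → ℝ) (x : ℝ) : Prop :=
  ∃ z ∈ Icc x P.xhigh, w z = maxSlope P w x * (z - x) ∧ ∃ e ∈ Icc (0 : ℝ) 1,
    infoRent P.cA e = residualRent P w x ∧
    0 ≤ auditMargin P.cA (costDeriv 1 P.cP (minAudit P w x)) (P.cP (minAudit P w x)) (z + P.τ) e

namespace IsOptimalProfile

variable {P : AuditProblem} {w : ℝ → ℝ} (hw : IsOptimalProfile P w) (hP : P.IsValid)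
include hP

omit hP in
theorem _root_.auditMargin_le_auditMargin {c : ℝ → ℝ} (hc : IsEvidenceCost c)
    (hr : StrictConvexOn ℝ (Icc 0 1) (fun e => e * costDeriv 1 c e)) {a a' κ κ' M M' e : ℝ}
    (he : e ∈ Icc (0 : ℝ) 1) (ha : a' ≤ a) (hκ : κ' ≤ κ) (hM : M ≤ M') (hM0 : 0 ≤ M')
    (hκe : κ ≤ costDeriv 1 c e) : auditMargin c a' κ' M' e ≤ auditMargin c a κ M e := by
  have h1 : 0 ≤ e * (1 - e) * costDeriv 2 c e := by
    rcases he.1.eq_or_lt with h | h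
    · rw [← h]; simp
    · exact mul_nonneg (mul_nonneg he.1 (sub_nonneg.2 he.2)) (hc.deriv_two_pos hr h he.2).le
  have h2 := mul_le_mul_of_nonneg_right ha h1
  have h3 := mul_le_mul_of_nonneg_left hM (sub_nonneg.2 hκe)
  have h4 := mul_le_mul_of_nonneg_right hκ hM0
  simp only [auditMargin]
  linarith

theorem infoRent_firstBest_le_residualRent {x : ℝ} (hx : x ∈ P.types)
    (hh : highGap P w x ≤ 0) :
    infoRent P.cA (P.firstBestEffort (minAudit P w x)) ≤ residualRent P w x := by
  have hxτ : 0 < x + P.τ := by linarith [hP.types_nonneg hx, hP.funds_pos]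
  have h4 := mul_nonpos_of_nonpos_of_nonneg hh hxτ.le
  rw [highGap, add_mul, div_mul_cancel₀ _ hxτ.ne', middleGap] at h4
  simp only [residualRent]
  linarith

include hw

/-- It is the product of x + τ and w(x)/(x + τ) - p_*(x), both nondecreasing, and nonnegative once
the high gap is not positive. -/
theorem residualRent_mono {x y : ℝ} (hx : x ∈ P.types) (hy : y ∈ P.types) (hxy : x ≤ y)
    (hh : highGap P w x ≤ 0) : residualRent P w x ≤ residualRent P w y := by
  have hxτ : 0 < x + P.τ := by linarith [hP.types_nonneg hx, hP.funds_pos]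
  have hyτ : 0 < y + P.τ := by linarith
  have h0 : 0 ≤ residualRent P w x :=
    (hP.cost_agent.infoRent_nonneg hP.rent_regularity
      (hP.firstBest_mem (hw.minAudit_mem_Icc hP hx))).trans
        (infoRent_firstBest_le_residualRent hP hx hh)
  have e1 : residualRent P w x = (x + P.τ) * (w x / (x + P.τ) - minAudit P w x) := by
    rw [mul_sub, mul_div_cancel₀ _ hxτ.ne', residualRent]; ring
  have e2 : residualRent P w y = (y + P.τ) * (w y / (y + P.τ) - minAudit P w y) := by
    rw [mul_sub, mul_div_cancel₀ _ hyτ.ne', residualRent]; ring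
  have h1 : w x / (x + P.τ) ≤ w y / (y + P.τ) := (hw.div_strictMonoOn hP).monotoneOn hx hy hxy
  have h2 := hw.minAudit_antitone hx hxy
  have h3 : 0 ≤ w x / (x + P.τ) - minAudit P w x := by
    rw [e1] at h0
    exact nonneg_of_mul_nonneg_right h0 hxτ
  rw [e1, e2]
  exact mul_le_mul (by linarith) (by linarith) h3 hyτ.le

omit hP in
theorem continuousOn_residualRent : ContinuousOn (residualRent P w) P.types :=
  hw.continuousOn.sub (hw.continuousOn_minAudit.mul (by fun_prop))

/-- At zero minimal audits, the cost and the marginal cost of auditing vanish while effort is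
positive, so extra audits would pay. -/
theorem minAudit_pos_of_isHighPoint {x : ℝ} (hx : x ∈ P.types) (hlt : P.xlow < x)
    (h : IsHighPoint P w x) : 0 < minAudit P w x := by
  obtain ⟨z, hz, -, e, he, he2, hD⟩ := h
  have hp := hw.minAudit_mem hP hx
  refine lt_of_le_of_ne hp.1 fun h0 => ?_
  rw [residualRent, ← h0, zero_mul, sub_zero] at he2
  have he0 : 0 < e := by
    refine lt_of_le_of_ne he.1 fun h1 => ?_
    rw [← h1, hP.cost_agent.infoRent_zero] at he2
    exact absurd he2 (hw.pos hx hlt).ne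
  rw [← h0, hP.cost_principal.deriv_zero, hP.cost_principal.zero, auditMargin] at hD
  have := mul_pos (hP.cost_agent.deriv_pos he0 he.2)
    (show 0 < z + P.τ by linarith [hP.types_nonneg hx, hP.funds_pos, hz.1])
  linarith

/-- Everything moves in favour of less auditing when the type falls: required effort falls, minimal
audits and their marginal cost rise, and the contact point moves left, so an audit permits a smaller
refund. The margin responds monotonically to each change, given effort above the first best. -/
theorem isHighPoint_of_le {x y : ℝ} (hx : x ∈ P.types) (hy : y ∈ P.types) (hlt : P.xlow < x)
    (hxy : x ≤ y) (hh : highGap P w x ≤ 0) (h : IsHighPoint P w y) : IsHighPoint P w x := by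
  have hpy := hw.minAudit_pos_of_isHighPoint hP hy (hlt.trans_le hxy) h
  have hpx := hpy.trans_le (hw.minAudit_antitone hx hxy)
  obtain ⟨z', hz', hcz', e', he', he2', hD'⟩ := h
  have hA := hP.cost_agent
  have hres := hw.residualRent_mono hP hx hy hxy hh
  have hfb := infoRent_firstBest_le_residualRent hP hx hh
  have hpxI := hw.minAudit_mem_Icc hP hx
  have hpyI := hw.minAudit_mem_Icc hP hy
  have hfbI := hP.firstBest_mem hpxI
  have hρ := hA.infoRent_strictMonoOn hP.rent_regularity
  have h0 : 0 ≤ residualRent P w x := (hA.infoRent_nonneg hP.rent_regularity hfbI).trans hfb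
  obtain ⟨he, he2⟩ := unitInv_spec hA.infoRent_continuousOn hA.infoRent_zero
    (y := residualRent P w x) ⟨h0, hres.trans (he2' ▸ hρ.monotoneOn he'
      (right_mem_Icc.2 zero_le_one) he'.2)⟩
  set e := unitInv (infoRent P.cA) (residualRent P w x)
  have hee' : e ≤ e' := (hρ.le_iff_le he he').1 (by rw [he2, he2']; exact hres)
  have hfbe : P.firstBestEffort (minAudit P w x) ≤ e := (hρ.le_iff_le hfbI he).1 (by rwa [he2])
  have hsy : maxSlope P w y < 1 := by simp only [minAudit] at hpy; linarith
  have hsx : maxSlope P w x < 1 := by simp only [minAudit] at hpx; linarith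
  rcases hxy.eq_or_lt with rfl | hxy'
  · exact ⟨z', hz', hcz', e', he', he2', hD'⟩
  obtain ⟨z, hz, hcz⟩ := hw.exists_contact hP hx hsx
  have hzz' : z ≤ z' := by
    rcases le_or_gt z y with h1 | h1
    · exact h1.trans hz'.1
    · have h2 := hw.maxSlope_line hx ⟨hxy.trans hz'.1, hz'.2⟩
      have h3 := hw.maxSlope_line hy ⟨h1.le, hz.2⟩
      have h4 := hw.maxSlope_strictMono hP hx hy hxy' hsy
      by_contra! h5
      have h6 := mul_pos (sub_pos.2 h4) (sub_pos.2 h5)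
      linarith
  have hκ : P.cP (minAudit P w x) ≤ costDeriv 1 P.cA e := by
    rw [← hP.deriv_firstBest hpxI]
    exact hA.strictMonoOn_deriv.monotoneOn hfbI he hfbe
  have hz0 : P.xlow + P.τ ≤ z + P.τ := by linarith [hx.1, hz.1]
  have hL : 0 ≤ P.xlow + P.τ := by linarith [hP.xlow_nonneg, hP.funds_pos]
  refine ⟨z, hz, hcz, e, he, he2, hD'.trans ?_⟩
  have hanti := hP.auditMargin_strictAntiOn (a := costDeriv 1 P.cP (minAudit P w y))
    (κ := P.cP (minAudit P w y)) (M := z' + P.τ) (hP.cost_principal.deriv_pos hpy hpyI.2)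
    (hP.cost_principal.deriv_le_deriv_one hpyI) (by linarith)
  refine (hanti.antitoneOn he he' hee').trans ?_
  have hpp := hw.minAudit_antitone hx hxy
  exact auditMargin_le_auditMargin hA hP.rent_regularity he
    (hP.cost_principal.strictMonoOn_deriv.monotoneOn hpyI hpxI hpp)
    (hP.cost_principal.strictly_increasing.monotoneOn hpyI hpxI hpp) (by linarith) (by linarith) hκ

/-- Projection of a compact set of triples: type, contact point and effort. Contact points need not
be unique, so they are kept as a variable. -/
theorem isCompact_isHighPoint {c : ℝ} (hc : c ∈ P.types) :
    IsCompact {x | x ∈ Icc c P.xhigh ∧ IsHighPoint P w x} := by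
  have hA := hP.cost_agent
  let box : Set (ℝ × ℝ × ℝ) := Icc c P.xhigh ×ˢ (P.types ×ˢ Icc (0 : ℝ) 1)
  have hbox : IsCompact box := isCompact_Icc.prod (isCompact_Icc.prod isCompact_Icc)
  have hx : ContinuousOn (fun q : ℝ × ℝ × ℝ => q.1) box := continuousOn_fst
  have hz : ContinuousOn (fun q : ℝ × ℝ × ℝ => q.2.1) box := by fun_prop
  have he : ContinuousOn (fun q : ℝ × ℝ × ℝ => q.2.2) box := by fun_prop
  have hxT : MapsTo (fun q : ℝ × ℝ × ℝ => q.1) box P.types :=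
    fun q hq => ⟨hc.1.trans hq.1.1, hq.1.2⟩
  have hzT : MapsTo (fun q : ℝ × ℝ × ℝ => q.2.1) box P.types := fun q hq => hq.2.1
  have heT : MapsTo (fun q : ℝ × ℝ × ℝ => q.2.2) box (Icc 0 1) := fun q hq => hq.2.2
  have hpT : MapsTo (fun q : ℝ × ℝ × ℝ => minAudit P w q.1) box (Icc 0 1) :=
    fun q hq => hw.minAudit_mem_Icc hP (hxT hq)
  have hwz := hw.continuousOn.comp hz hzT
  have hs := hw.continuousOn_maxSlope.comp hx hxT
  have hp := hw.continuousOn_minAudit.comp hx hxT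
  have hres := hw.continuousOn_residualRent.comp hx hxT
  have hρ := hA.infoRent_continuousOn.comp he heT
  have ha1 := (hA.continuousOn_costDeriv (k := 1) (by norm_num)).comp he heT
  have ha2 := (hA.continuousOn_costDeriv (k := 2) (by norm_num)).comp he heT
  have hc1 := (hP.cost_principal.continuousOn_costDeriv (k := 1) (by norm_num)).comp hp hpT
  have hc0 := hP.cost_principal.continuousOn.comp hp hpT
  simp only [Function.comp_def] at hwz hs hp hres hρ ha1 ha2 hc1 hc0
  have hf : ContinuousOn (fun q : ℝ × ℝ × ℝ => (q.2.1 - q.1,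
      w q.2.1 - maxSlope P w q.1 * (q.2.1 - q.1), infoRent P.cA q.2.2 - residualRent P w q.1,
      auditMargin P.cA (costDeriv 1 P.cP (minAudit P w q.1)) (P.cP (minAudit P w q.1))
        (q.2.1 + P.τ) q.2.2)) box := by
    unfold auditMargin
    have h1 := hz.sub hx
    exact h1.prodMk ((hwz.sub (hs.mul h1)).prodMk ((hρ.sub hres).prodMk
      ((hc1.mul ((he.mul (continuousOn_const.sub he)).mul ha2)).sub
        ((ha1.sub hc0).mul (hz.add continuousOn_const)))))
  have hK := hbox.of_isClosed_subset (hf.preimage_isClosed_of_isClosed hbox.isClosed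
    (isClosed_Ici.prod (isClosed_singleton.prod (isClosed_singleton.prod isClosed_Ici)) :
      IsClosed (Ici (0 : ℝ) ×ˢ (({0} : Set ℝ) ×ˢ (({0} : Set ℝ) ×ˢ Ici (0 : ℝ))))))
    inter_subset_left
  convert hK.image continuous_fst using 1
  ext x
  constructor
  · rintro ⟨hx, z, hz, h1, e, he, h2, h3⟩
    exact ⟨(x, z, e), ⟨⟨hx, ⟨hc.1.trans (hx.1.trans hz.1), hz.2⟩, he⟩, sub_nonneg.2 hz.1,
      sub_eq_zero.2 h1, sub_eq_zero.2 h2, h3⟩, rfl⟩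
  · rintro ⟨q, ⟨⟨hx, hz, he⟩, h0, h1, h2, h3⟩, rfl⟩
    exact ⟨hx, q.2.1, ⟨sub_nonneg.1 h0, hz.2⟩, sub_eq_zero.1 h1, q.2.2, he, sub_eq_zero.1 h2, h3⟩

/-- At `c` the required effort is the first best, so the gain from distorting it less vanishes and
the margin is positive. This persists to the right by continuity, even with the largest conceivable
contact point, the top. -/
theorem exists_isHighPoint_gt {c : ℝ} (hc : c ∈ P.types) (hcl : c < P.xhigh - w P.xhigh)
    (hc0 : highGap P w c = 0) : ∃ x, c < x ∧ x ≤ P.xhigh ∧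
      IsHighPoint P w x := by
  have hA := hP.cost_agent
  have hρ := hA.infoRent_strictMonoOn hP.rent_regularity
  have hl := hw.threshold_mem hP
  have hpc := hw.minAudit_pos hc hcl
  have hpcI := hw.minAudit_mem_Icc hP hc
  have hfbI := hP.firstBest_mem hpcI
  have hcτ : 0 < c + P.τ := by linarith [hP.types_nonneg hc, hP.funds_pos]
  have hresc : residualRent P w c = infoRent P.cA (P.firstBestEffort (minAudit P w c)) := by
    have h4 : highGap P w c * (c + P.τ) = 0 := by rw [hc0, zero_mul]
    rw [highGap, add_mul, div_mul_cancel₀ _ hcτ.ne', middleGap] at h4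
    simp only [residualRent]
    linarith
  obtain ⟨u, hu, hu1⟩ := exists_mem_Ioo_right_lt hw.continuousOn_residualRent hc.1 hcl hl.2.le
    (show residualRent P w c < infoRent P.cA 1 by
      rw [hresc]
      exact hρ hfbI (right_mem_Icc.2 zero_le_one) (hP.firstBest_lt_one hpcI))
  have hsub : Icc c u ⊆ P.types := Icc_subset_Icc hc.1 (hu.2.le.trans hl.2.le)
  have hgap : ∀ x ∈ Icc c u, highGap P w x ≤ 0 := fun x hx =>
    ((hw.highGap_strictAntiOn hP).antitoneOn hc (hsub hx) hx.1).trans hc0.le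
  have hmem : MapsTo (residualRent P w) (Icc c u) (Icc 0 (infoRent P.cA 1)) := by
    intro x hx
    have h1 := infoRent_firstBest_le_residualRent hP (hsub hx) (hgap x hx)
    have h2 := hw.residualRent_mono hP (hsub hx) (hsub ⟨hu.1.le, le_rfl⟩) hx.2 (hgap x hx)
    exact ⟨(hA.infoRent_nonneg hP.rent_regularity
      (hP.firstBest_mem (hw.minAudit_mem_Icc hP (hsub hx)))).trans h1, h2.trans hu1.le⟩
  have hE : ContinuousOn (fun x => unitInv (infoRent P.cA) (residualRent P w x)) (Icc c u) :=
    (unitInv_continuousOn hA.infoRent_continuousOn hρ hA.infoRent_zero).comp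
      (hw.continuousOn_residualRent.mono hsub) hmem
  have hET : MapsTo (fun x => unitInv (infoRent P.cA) (residualRent P w x)) (Icc c u)
      (Icc 0 1) := fun x hx =>
    (unitInv_spec hA.infoRent_continuousOn hA.infoRent_zero (hmem hx)).1
  have hpT : MapsTo (minAudit P w) (Icc c u) (Icc 0 1) :=
    fun x hx => hw.minAudit_mem_Icc hP (hsub hx)
  have hp := hw.continuousOn_minAudit.mono hsub
  have ha1 := (hA.continuousOn_costDeriv (k := 1) (by norm_num)).comp hE hET
  have ha2 := (hA.continuousOn_costDeriv (k := 2) (by norm_num)).comp hE hET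
  have hc1 := (hP.cost_principal.continuousOn_costDeriv (k := 1) (by norm_num)).comp hp hpT
  have hc0 := hP.cost_principal.continuousOn.comp hp hpT
  simp only [Function.comp_def] at ha1 ha2 hc1 hc0
  have hD : ContinuousOn (fun x => -auditMargin P.cA (costDeriv 1 P.cP (minAudit P w x))
      (P.cP (minAudit P w x)) (P.xhigh + P.τ) (unitInv (infoRent P.cA) (residualRent P w x)))
      (Icc c u) := by
    unfold auditMargin
    fun_prop
  obtain ⟨x, hx, hDx⟩ := exists_mem_Ioo_right_lt hD le_rfl hu.1 le_rfl (y := 0) (by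
    rw [hresc, unitInv_apply hρ hfbI, auditMargin, hP.deriv_firstBest hpcI, sub_self, zero_mul,
      sub_zero, neg_lt_zero]
    have hfb0 : 0 < P.firstBestEffort (minAudit P w c) :=
      (hP.secondBest_pos hpc hpcI.2).trans (hP.secondBest_lt_firstBest hpc hpcI.2)
    exact mul_pos (hP.cost_principal.deriv_pos hpc hpcI.2) (mul_pos (mul_pos hfb0
      (sub_pos.2 (hP.firstBest_lt_one hpcI))) (hA.deriv_two_pos hP.rent_regularity hfb0 hfbI.2)))
  have hxI := Ioo_subset_Icc_self hx
  have hxT := hsub hxI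
  obtain ⟨he, he2⟩ := unitInv_spec hA.infoRent_continuousOn hA.infoRent_zero (hmem hxI)
  set e := unitInv (infoRent P.cA) (residualRent P w x)
  have hpxI := hw.minAudit_mem_Icc hP hxT
  have hfbe : P.firstBestEffort (minAudit P w x) ≤ e :=
    (hρ.le_iff_le (hP.firstBest_mem hpxI) he).1 (by
      rw [he2]; exact infoRent_firstBest_le_residualRent hP hxT (hgap x hxI))
  have hκ : P.cP (minAudit P w x) ≤ costDeriv 1 P.cA e := by
    rw [← hP.deriv_firstBest hpxI]
    exact hA.strictMonoOn_deriv.monotoneOn (hP.firstBest_mem hpxI) he hfbe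
  obtain ⟨z, hz, hcz⟩ := hw.exists_contact hP hxT
    (hw.maxSlope_lt_one hxT (by linarith [hx.2, hu.2]))
  refine ⟨x, hx.1, hxT.2, z, hz, hcz, e, he, he2, ?_⟩
  have h1 := auditMargin_le_auditMargin hA hP.rent_regularity he
    (le_refl (costDeriv 1 P.cP (minAudit P w x))) (le_refl (P.cP (minAudit P w x)))
    (show z + P.τ ≤ P.xhigh + P.τ by linarith [hz.2])
    (by linarith [hP.types_nonneg hP.xhigh_mem, hP.funds_pos]) hκ
  linarith

end IsOptimalProfile

namespace IsPointwiseOptimal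

variable {P : AuditProblem} {w : ℝ → ℝ} {x e p R h : ℝ}
  (H : IsPointwiseOptimal P w x e p R h) (hw : IsOptimalProfile P w) (hP : P.IsValid)
include H hw hP

/-- The local condition excludes all larger audit probabilities at once. With p > p_*, the contact
point bounds the additional refund by (p - p_*)(z + τ); returning to minimal audits, maximal refund
and effort `e₀` is then strictly cheaper. -/
theorem eq_minAudit_of_isHighPoint (hx : x ∈ P.types) (hlt : P.xlow < x)
    (hhigh : IsHighPoint P w x) : p = minAudit P w x := by
  have hp0 := hw.minAudit_pos_of_isHighPoint hP hx hlt hhigh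
  obtain ⟨z, hz, hcz, e₀, he₀, he2, hD⟩ := hhigh
  refine le_antisymm ?_ H.minAudit_le
  by_contra! hltp
  have I := H.implementable
  have hA := hP.cost_agent
  have hρ := hA.infoRent_strictMonoOn hP.rent_regularity
  obtain ⟨hR, hh⟩ := H.of_minAudit_lt hw hP hx hltp
  have hxτ : 0 < x + P.τ := by linarith [hP.types_nonneg hx, hP.funds_pos]
  have hRpos : 0 < R := by
    have := mul_nonneg I.p_mem.1 hxτ.le
    linarith
  have hfl := H.floor_eq_of_pos hRpos
  set p₀ := minAudit P w x with hp₀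
  have hp₀I : p₀ ∈ Icc (0 : ℝ) 1 := hw.minAudit_mem_Icc hP hx
  set M := z + P.τ with hM
  have hMpos : 0 < M := by linarith [hz.1]
  simp only [residualRent] at he2
  rw [← hp₀] at he2
  have hh2 : h ≤ (p - p₀) * (z - x) := by
    have h1 := I.line z hz
    rw [hcz, show maxSlope P w x = 1 - p₀ by simp only [hp₀, minAudit]; ring] at h1
    linarith
  have hρM : infoRent P.cA e₀ - infoRent P.cA e ≤ M * (p - p₀) := by
    rw [hM]; linarith
  have himp : IsImplementable P w x e₀ p₀ (p₀ * (x + P.τ)) 0 := by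
    have h1 : 0 ≤ p₀ * (x + P.τ) := mul_nonneg hp₀I.1 hxτ.le
    refine ⟨he₀, hp₀I, le_rfl, h1, by linarith, mul_nonneg (sub_nonneg.2 hp₀I.2) hxτ.le, ?_,
      by linarith, fun y hy => ?_⟩
    · linarith [hA.infoRent_nonneg hP.rent_regularity he₀, hw.le_self hP hx,
        hA.deriv_le_deriv_one he₀, hP.budget.1]
    · have := hw.maxSlope_line hx hy
      rw [zero_add, hp₀, minAudit, sub_sub_cancel]
      exact this
  have hcost := H.le_cost _ _ _ _ himp
  rw [reducedCost_eq, reducedCost_eq] at hcost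
  have hcost' : P.cA e + (1 - e) * P.cP p ≤ P.cA e₀ + (1 - e₀) * P.cP p₀ := by linarith
  have hcP := hP.cost_principal.strictly_increasing hp₀I I.p_mem hltp
  have h1e : 0 < 1 - e := sub_pos.2 H.lt_one
  rcases le_or_gt e₀ e with hee | hee
  · have h1 := mul_lt_mul_of_pos_left hcP h1e
    have h2 : P.firstBestEffort p₀ ≤ P.firstBestEffort p :=
      hP.firstBest_strictMonoOn.monotoneOn hp₀I I.p_mem hltp.le
    have h3 := H.firstBest_le hP hx (hw.le_self hP hx) hRpos
    have hρe : infoRent P.cA e < infoRent P.cA e₀ := by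
      have := mul_lt_mul_of_pos_right hltp hxτ
      linarith
    exact absurd (hρ.monotoneOn he₀ I.e_mem hee) (not_le.2 hρe)
  · set a := costDeriv 1 P.cP p₀
    have ha : 0 < a := hP.cost_principal.deriv_pos hp0 hp₀I.2
    -- This function compares the saving in effort costs between t and `e₀` with a lower bound for
    -- the extra audit costs. It vanishes at `e₀`, and its derivative is positive below `e₀` because
    -- `auditMargin` is decreasing and nonnegative at `e₀`; hence it is negative at `e`.
    have hd : ∀ t ∈ Icc (0 : ℝ) 1, HasDerivWithinAt
        (fun t => M * (P.cA e₀ - P.cA t - (e₀ - t) * P.cP p₀)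
          - (1 - t) * (a * (infoRent P.cA e₀ - infoRent P.cA t)))
        (auditMargin P.cA a (P.cP p₀) M t + a * (infoRent P.cA e₀ - infoRent P.cA t))
        (Icc 0 1) t := by
      intro t ht
      have h1 := (((hA.hasDerivWithinAt ht).const_sub (P.cA e₀)).sub
        (((hasDerivWithinAt_id t (Icc 0 1)).const_sub e₀).mul_const (P.cP p₀))).const_mul M
      have h2 := ((hasDerivWithinAt_id t (Icc 0 1)).const_sub 1).mul
        (((hA.hasDerivWithinAt_infoRent ht).const_sub (infoRent P.cA e₀)).const_mul a)
      refine HasDerivWithinAt.congr_deriv (show HasDerivWithinAt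
        (fun t => M * (P.cA e₀ - P.cA t - (e₀ - t) * P.cP p₀)
          - (1 - t) * (a * (infoRent P.cA e₀ - infoRent P.cA t))) _ _ t from h1.sub h2) ?_
      simp only [auditMargin, id]
      ring
    obtain ⟨ξ, hξ, h4⟩ := exists_slope_eq_of_hasDerivWithinAt_unit hd I.e_mem.1 hee he₀.2
    have hξI : ξ ∈ Icc (0 : ℝ) 1 := ⟨I.e_mem.1.trans hξ.1.le, hξ.2.le.trans he₀.2⟩
    have h5 := hP.auditMargin_strictAntiOn (κ := P.cP p₀) ha
      (hP.cost_principal.deriv_le_deriv_one hp₀I) (show P.xlow + P.τ ≤ M by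
        linarith [hx.1, hz.1]) hξI he₀ hξ.2
    have h6 := mul_pos ha (sub_pos.2 (hρ hξI he₀ hξ.2))
    have h7 := mul_pos (show 0 < auditMargin P.cA a (P.cP p₀) M ξ
      + a * (infoRent P.cA e₀ - infoRent P.cA ξ) by linarith) (sub_pos.2 hee)
    rw [← h4] at h7
    simp only [sub_self, zero_mul, mul_zero] at h7
    have h8 := mul_le_mul_of_nonneg_left hρM ha.le
    have h9 := mul_le_mul_of_nonneg_left (hP.cost_principal.tangent_le hp₀I I.p_mem) hMpos.le
    have h10 : a * (infoRent P.cA e₀ - infoRent P.cA e) ≤ M * (P.cP p - P.cP p₀) := by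
      linarith
    have h11 := mul_le_mul_of_nonneg_left h10 h1e.le
    have h12 : M * (P.cA e₀ - P.cA e - (e₀ - e) * P.cP p₀)
        < M * ((1 - e) * (P.cP p - P.cP p₀)) := by linarith
    have h13 := lt_of_mul_lt_mul_left h12 hMpos.le
    linarith

/-- The first-order condition for raising audits by η: the line of slope s - η can be lifted until
it touches `w` at some z, which permits η(z + τ) more refund and correspondingly less rent.
Optimality gives an inequality for each small η, and compactness yields a limit as η tends to zero.
-/
theorem isHighPoint (hx : x ∈ P.types) (hp : 0 < p) (hm : middleGap P w x < 0)
    (hh : highGap P w x ≤ 0) (hpe : p = minAudit P w x) : IsHighPoint P w x := by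
  have I := H.implementable
  have hA := hP.cost_agent
  have hρ := hA.infoRent_strictMonoOn hP.rent_regularity
  have hxτ : 0 < x + P.τ := by linarith [hP.types_nonneg hx, hP.funds_pos]
  obtain ⟨hR, hfl⟩ := H.refund_of_highGap_nonpos hw hP hx hp hm hh
  have hh0 := H.h_eq_zero hw hP hx hpe hp
  rw [hh0, zero_add] at hR
  have hRpos : 0 < R := by rw [hR]; exact mul_pos hp hxτ
  have hfb := H.firstBest_le hP hx (hw.le_self hP hx) hRpos
  have he0 : 0 < e := ((hP.secondBest_pos hp I.p_mem.2).trans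
    (hP.secondBest_lt_firstBest hp I.p_mem.2)).trans_le hfb
  have hρe := hA.infoRent_pos hP.rent_regularity he0 I.e_mem.2
  set s := maxSlope P w x with hs
  have hps : p = 1 - s := hpe
  have hs0 : 0 < s := hw.maxSlope_pos hP hx
  have hs1 : s < 1 := by linarith
  obtain ⟨z₀, hz₀, hcz₀⟩ := hw.exists_contact hP hx hs1
  set M := P.xhigh + P.τ with hM
  have hMpos : 0 < M := by linarith [hx.2]
  -- The bounds keep the probability of no audit at least s/2, the new `h` payable, and the
  -- remaining rent nonnegative, in this order.
  set η₀ := min (s / 2) (min (s / 2 * (x + P.τ) / M) (infoRent P.cA e / M)) with hη₀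
  have hη₀pos : 0 < η₀ := lt_min (by linarith) (lt_min (by positivity) (div_pos hρe hMpos))
  have hη₀1 : η₀ ≤ s / 2 := min_le_left _ _
  have hη₀2 : η₀ * M ≤ s / 2 * (x + P.τ) := by
    rw [← le_div_iff₀ hMpos]; exact (min_le_right _ _).trans (min_le_left _ _)
  have hη₀3 : η₀ * M ≤ infoRent P.cA e := by
    rw [← le_div_iff₀ hMpos]; exact (min_le_right _ _).trans (min_le_right _ _)
  have hsub : Icc x P.xhigh ⊆ P.types := Icc_subset_Icc_left hx.1
  let C : Set (ℝ × ℝ × ℝ × ℝ × ℝ) :=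
    Ici 0 ×ˢ (({0} : Set ℝ) ×ˢ (Ici 0 ×ˢ (Ici 0 ×ˢ Ici 0)))
  let box : Set (ℝ × ℝ × ℝ × ℝ) :=
    Icc 0 η₀ ×ˢ (Icc x P.xhigh ×ˢ (Icc (0 : ℝ) 1 ×ˢ Icc (0 : ℝ) 1))
  let f : ℝ × ℝ × ℝ × ℝ → ℝ × ℝ × ℝ × ℝ × ℝ := fun q =>
    (q.1 * M - (w q.2.1 - s * (q.2.1 - x)),
      infoRent P.cA q.2.2.1 - infoRent P.cA e + q.1 * (q.2.1 + P.τ),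
      q.2.2.2 - q.2.2.1, e - q.2.2.2,
      (1 - q.2.2.1) * costDeriv 1 P.cP (p + q.1) * (q.2.2.2 * costDeriv 2 P.cA q.2.2.2)
        - (costDeriv 1 P.cA q.2.2.1 - P.cP p) * (q.2.1 + P.τ))
  have hbox : IsCompact box :=
    isCompact_Icc.prod (isCompact_Icc.prod (isCompact_Icc.prod isCompact_Icc))
  have hf : ContinuousOn f box := by
    have c0 : ContinuousOn (fun q : ℝ × ℝ × ℝ × ℝ => p + q.1) box := by fun_prop
    have c1 : ContinuousOn (fun q : ℝ × ℝ × ℝ × ℝ => q.2.1) box := by fun_prop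
    have c2 : ContinuousOn (fun q : ℝ × ℝ × ℝ × ℝ => q.2.2.1) box := by fun_prop
    have c3 : ContinuousOn (fun q : ℝ × ℝ × ℝ × ℝ => q.2.2.2) box := by fun_prop
    have m2 : MapsTo (fun q : ℝ × ℝ × ℝ × ℝ => q.2.2.1) box (Icc 0 1) := fun q hq => hq.2.2.1
    have d1 := hw.continuousOn.comp c1 fun q hq => hsub hq.2.1
    have d2 := hA.infoRent_continuousOn.comp c2 m2
    have d3 := (hA.continuousOn_costDeriv (k := 1) (by norm_num)).comp c2 m2
    have d4 := (hA.continuousOn_costDeriv (k := 2) (by norm_num)).comp c3 fun q hq => hq.2.2.2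
    have d5 := (hP.cost_principal.continuousOn_costDeriv (k := 1) (by norm_num)).comp c0
      fun q hq => (⟨by linarith [I.p_mem.1, hq.1.1], by linarith [hq.1.2]⟩ :
        p + q.1 ∈ Icc (0 : ℝ) 1)
    simp only [Function.comp_def] at d1 d2 d3 d4 d5
    have c4 : ContinuousOn (fun q : ℝ × ℝ × ℝ × ℝ => q.1) box := continuousOn_fst
    have c5 : ContinuousOn (fun q : ℝ × ℝ × ℝ × ℝ => q.2.1 + P.τ) box := c1.add continuousOn_const
    exact ((c4.mul continuousOn_const).sub (d1.sub (continuousOn_const.mul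
      (c1.sub continuousOn_const)))).prodMk (((d2.sub continuousOn_const).add (c4.mul c5)).prodMk
      ((c3.sub c2).prodMk ((continuousOn_const.sub c3).prodMk
      ((((continuousOn_const.sub c2).mul d5).mul (c3.mul d4)).sub
        ((d3.sub continuousOn_const).mul c5)))))
  have hK : IsCompact (box ∩ f ⁻¹' C) := hbox.of_isClosed_subset
    (hf.preimage_isClosed_of_isClosed hbox.isClosed (isClosed_Ici.prod (isClosed_singleton.prod
      (isClosed_Ici.prod (isClosed_Ici.prod isClosed_Ici))))) inter_subset_left
  have hclosed := (hK.image continuous_fst).isClosed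
  have hvar : Ioc 0 η₀ ⊆ Prod.fst '' (box ∩ f ⁻¹' C) := by
    intro η hη
    have hηs : η ≤ s / 2 := hη.2.trans hη₀1
    -- The minimizer z limits the lift; `h = η * (z - x)` does not exceed it because the line of
    -- slope s is below `w` at z.
    obtain ⟨z, hz, hmin⟩ := isCompact_Icc.exists_isMinOn (nonempty_Icc.2 hx.2)
      (show ContinuousOn (fun z => w z - (s - η) * (z - x)) (Icc x P.xhigh) from
        (hw.continuousOn.mono hsub).sub (by fun_prop))
    have hzM : z + P.τ ≤ M := by linarith [hz.2]
    have hzτ : 0 < z + P.τ := by linarith [hz.1]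
    have hηM : η * M ≤ η₀ * M := mul_le_mul_of_nonneg_right hη.2 hMpos.le
    have hηz : η * (z + P.τ) ≤ η * M := mul_le_mul_of_nonneg_left hzM hη.1.le
    have hηz0 : 0 < η * (z + P.τ) := mul_pos hη.1 hzτ
    have hηx : η * (z - x) ≤ η * M := mul_le_mul_of_nonneg_left (by linarith) hη.1.le
    have hηx0 : 0 ≤ η * (z - x) := mul_nonneg hη.1.le (sub_nonneg.2 hz.1)
    have hline := hw.maxSlope_line hx hz
    rw [← hs] at hline
    have hρ1 := hρ.monotoneOn I.e_mem (right_mem_Icc.2 zero_le_one) I.e_mem.2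
    obtain ⟨ht, ht2⟩ := unitInv_spec hA.infoRent_continuousOn hA.infoRent_zero
      (y := infoRent P.cA e - η * (z + P.τ)) ⟨by linarith, by linarith⟩
    set t := unitInv (infoRent P.cA) (infoRent P.cA e - η * (z + P.τ))
    have hte : t < e := (hρ.lt_iff_lt ht I.e_mem).1 (by linarith)
    obtain ⟨ξ, hξ, h6⟩ := exists_slope_eq_of_hasDerivWithinAt_unit
      (fun _ he => hA.hasDerivWithinAt_infoRent he) ht.1 hte I.e_mem.2
    have hξI : ξ ∈ Icc (0 : ℝ) 1 := ⟨ht.1.trans hξ.1.le, hξ.2.le.trans I.e_mem.2⟩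
    have hpη : p + η ∈ Icc (0 : ℝ) 1 := ⟨by linarith [hη.1], by linarith⟩
    have himp : IsImplementable P w x t (p + η) (R + η * (z + P.τ)) (η * (z - x)) := by
      refine ⟨ht, hpη, hηx0, ?_, ?_, ?_, ?_, by linarith, fun y hy => ?_⟩
      · have := mul_pos hη.1 hxτ
        linarith
      · rw [hR]; linarith
      · have := mul_le_mul_of_nonneg_right hηs hxτ.le
        rw [hps]
        linarith
      · linarith [I.budget, hA.deriv_sub_infoRent_le ht I.e_mem hte.le]
      · have h1 : w z - (s - η) * (z - x) ≤ w y - (s - η) * (y - x) := hmin hy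
        rw [hps]
        linarith
    have hcost := H.le_cost _ _ _ _ himp
    rw [reducedCost_eq, reducedCost_eq] at hcost
    have h7 := hA.tangent_le ht I.e_mem
    have h8 := hP.cost_principal.tangent_le hpη I.p_mem
    have h9 := mul_le_mul_of_nonneg_left h8 (sub_nonneg.2 ht.2)
    have h10 : (costDeriv 1 P.cA t - P.cP p) * (e - t)
        ≤ (1 - t) * costDeriv 1 P.cP (p + η) * η := by linarith
    have hξ2 : 0 ≤ ξ * costDeriv 2 P.cA ξ := mul_nonneg hξI.1 (hA.deriv_two_nonneg hξI)
    have h11 := mul_le_mul_of_nonneg_right h10 hξ2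
    have h12 : ξ * costDeriv 2 P.cA ξ * (e - t) = η * (z + P.τ) := by linarith
    have h13 : η * ((costDeriv 1 P.cA t - P.cP p) * (z + P.τ)) ≤
        η * ((1 - t) * costDeriv 1 P.cP (p + η) * (ξ * costDeriv 2 P.cA ξ)) := by
      linear_combination h11 - (costDeriv 1 P.cA t - P.cP p) * h12
    have h14 := le_of_mul_le_mul_left h13 hη.1
    have h15 : w z - (s - η) * (z - x) ≤ w z₀ - (s - η) * (z₀ - x) := hmin hz₀
    have h16 : η * (z₀ - x) ≤ η * M :=
      mul_le_mul_of_nonneg_left (by linarith [hz₀.2]) hη.1.le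
    refine ⟨(η, z, t, ξ), ⟨⟨⟨hη.1.le, hη.2⟩, hz, ht, hξI⟩, ?_, ?_, ?_, ?_, ?_⟩, rfl⟩
    · show 0 ≤ η * M - (w z - s * (z - x))
      linarith
    · show infoRent P.cA t - infoRent P.cA e + η * (z + P.τ) = 0
      linarith
    · exact sub_nonneg.2 hξ.1.le
    · exact sub_nonneg.2 hξ.2.le
    · exact sub_nonneg.2 h14
  -- The feasible values of η form a closed set containing `Ioc 0 η₀`. At η = 0 the remaining
  -- conditions say that z is a contact point and that both efforts t and ξ equal e.
  have h0mem : (0 : ℝ) ∈ Prod.fst '' (box ∩ f ⁻¹' C) := by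
    have h1 := hclosed.closure_subset_iff.2 hvar
    rw [closure_Ioc hη₀pos.ne] at h1
    exact h1 ⟨le_rfl, hη₀pos.le⟩
  obtain ⟨⟨η, z, t, ξ⟩, ⟨⟨-, hz, ht, hξ⟩, g1, g2, g3, g4, g5⟩, rfl⟩ := h0mem
  replace g1 : 0 ≤ 0 * M - (w z - s * (z - x)) := g1
  replace g2 : infoRent P.cA t - infoRent P.cA e + 0 * (z + P.τ) = 0 := g2
  replace g3 : 0 ≤ ξ - t := g3
  replace g4 : 0 ≤ e - ξ := g4
  replace g5 : 0 ≤ (1 - t) * costDeriv 1 P.cP (p + 0) * (ξ * costDeriv 2 P.cA ξ)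
        - (costDeriv 1 P.cA t - P.cP p) * (z + P.τ) := g5
  have hte : t = e := hρ.injOn ht I.e_mem (by linarith)
  have hξe : ξ = e := by linarith
  subst hte
  subst hξe
  refine ⟨z, hz, le_antisymm (by linarith) (hw.maxSlope_line hx hz), ξ, ht, ?_, ?_⟩
  · rw [residualRent, ← hpe]; linarith
  · rw [← hpe, auditMargin]
    rw [add_zero] at g5
    linarith

end IsPointwiseOptimal

/-! ### From the optimal plans to the five intervals -/

namespace TaxMechanism

variable {P : AuditProblem} {m : TaxMechanism} (hP : P.IsValid) (hm : IsTight P m)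
  (hw : IsOptimalProfile P (concealment P m))
include hP hm hw

theorem IsTight.eP_pos {x : ℝ} (hx : x ∈ P.types) (hlt : x < P.xhigh) : 0 < m.eP x :=
  (hm.isPointwiseOptimal hP hx).p_pos hP hx (hw.slope_lt_one x hx hlt)

/-- Excess audits come with a refund of at least p(x + τ), which cannot exceed x. -/
theorem IsTight.eP_le {x : ℝ} (hx : x ∈ P.types) :
    m.eP x ≤ max (minAudit P (concealment P m) P.xlow) (P.xhigh / (P.xhigh + P.τ)) := by
  have H := hm.isPointwiseOptimal hP hx
  rcases H.minAudit_le.eq_or_lt with h | h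
  · exact h ▸ (hw.minAudit_antitone hP.xlow_mem hx.1).trans (le_max_left _ _)
  · refine le_trans ?_ (le_max_right _ _)
    obtain ⟨h1, h2⟩ := H.of_minAudit_lt hw hP hx h
    have h3 := H.refund_le hP hx (hw.le_self hP hx)
    have h4 := H.implementable.p_mem
    have h5 := mul_le_mul_of_nonneg_left hx.2 (sub_nonneg.2 h4.2)
    have h6 := hP.types_nonneg hP.xhigh_mem
    rw [le_div_iff₀ (by linarith [hP.funds_pos])]
    linarith

theorem IsTight.exists_eP_le : ∃ p < 1, ∀ x ∈ P.types, m.eP x ≤ p := by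
  have h1 := hP.types_nonneg hP.xhigh_mem
  have h2 := hP.funds_pos
  exact ⟨_, max_lt (hw.minAudit_mem hP hP.xlow_mem).2
    ((div_lt_one (by linarith)).2 (by linarith)), fun x hx => hm.eP_le hP hw hx⟩

theorem IsTight.sSup_eP_lt_one : sSup (m.eP '' Icc P.xlow P.xhigh) < 1 := by
  obtain ⟨p, hp, h⟩ := hm.exists_eP_le hP hw
  exact (csSup_le ((nonempty_Icc.2 hP.xlow_lt_xhigh.le).image _)
    (forall_mem_image.2 h)).trans_lt hp

theorem IsTight.eP_mem_Ioo {x : ℝ} (hx : x ∈ P.types) (hlt : x < P.xhigh) :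
    m.eP x ∈ Ioo (0 : ℝ) 1 := by
  obtain ⟨p, hp, h⟩ := hm.exists_eP_le hP hw
  exact ⟨hm.eP_pos hP hw hx hlt, (h x hx).trans_lt hp⟩

/-- A type z strictly between the bottom and the threshold splits the bound: lower types are audited
at least with the positive probability `minAudit` at z and get the corresponding rent, higher types
get at least the concealment payoff at z. -/
theorem IsTight.sInf_utility_pos : 0 < sInf (utility P m '' Icc P.xlow P.xhigh) := by
  set w := concealment P m with hw_def
  have hl := hw.threshold_mem hP
  obtain ⟨z, hz1, hz2⟩ := exists_between hl.1
  have hz : z ∈ P.types := ⟨hz1.le, (hz2.trans hl.2).le⟩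
  have hA := hP.cost_agent
  have hpz := hw.minAudit_pos hz hz2
  have hpzI := hw.minAudit_mem_Icc hP hz
  have hsz := hP.secondBest_mem hpzI
  refine lt_of_lt_of_le (lt_min (hw.pos hz hz1) (hA.infoRent_pos hP.rent_regularity
    (hP.secondBest_pos hpz hpzI.2) hsz.2))
    (le_csInf ((nonempty_Icc.2 hP.xlow_lt_xhigh.le).image _) ?_)
  rintro _ ⟨x, hx, rfl⟩
  have H := hm.isPointwiseOptimal hP hx
  rw [hm.utility_eq hP hx]
  rcases le_total x z with h | h
  · refine (min_le_right _ _).trans ?_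
    have h1 := H.secondBest_le hP hx (hw.le_self hP hx)
    have h2 := hP.secondBest_strictMonoOn.monotoneOn hpzI H.implementable.p_mem
      ((hw.minAudit_antitone hx h).trans H.minAudit_le)
    have h3 := (hA.infoRent_strictMonoOn hP.rent_regularity).monotoneOn hsz
      H.implementable.e_mem (h2.trans h1)
    linarith [H.refund_nonneg]
  · exact (min_le_left _ _).trans ((hw.monotoneOn hz hx h).trans H.implementable.floor)

theorem IsTight.sub_loss_lt_utility_iff {x : ℝ} (hx : x ∈ P.types) :
    x - loss P m x < utility P m x ↔ 0 < lowGap P (concealment P m) x := by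
  rw [hm.utility_eq hP hx]
  exact (hm.isPointwiseOptimal hP hx).floor_lt_iff hw hP hx

theorem IsTight.utility_eq_sub_loss {x : ℝ} (hx : x ∈ P.types)
    (h : lowGap P (concealment P m) x ≤ 0) : utility P m x = x - loss P m x := by
  refine le_antisymm (not_lt.1 fun h' =>
    h.not_gt ((hm.sub_loss_lt_utility_iff hP hw hx).1 h')) ?_
  rw [hm.utility_eq hP hx]
  exact (hm.isPointwiseOptimal hP hx).implementable.floor

theorem IsTight.refunds_eq_zero {x : ℝ} (hx : x ∈ P.types) (hlt : x < P.xhigh)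
    (h : 0 ≤ middleGap P (concealment P m) x) : m.rP x = 0 ∧ m.r0 x = 0 := by
  have hp := hm.eP_mem_Ioo hP hw hx hlt
  have hR := ((hm.isPointwiseOptimal hP hx).refund_eq_zero_iff hw hP hx hp.1).2 h
  have h1 := mul_nonneg hp.1.le (hm.1.1.rP_mem x hx).1
  have h2 := mul_nonneg (sub_nonneg.2 hp.2.le) (hm.1.1.r0_mem x hx).1
  rw [refundNA, add_eq_zero_iff_of_nonneg h1 h2] at hR
  exact ⟨(mul_eq_zero.1 hR.1).resolve_left hp.1.ne',
    (mul_eq_zero.1 hR.2).resolve_left (sub_pos.2 hp.2).ne'⟩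

theorem IsTight.refunds_of_highGap_pos {x : ℝ} (hx : x ∈ P.types) (hlt : x < P.xhigh)
    (hmid : middleGap P (concealment P m) x < 0) (hhigh : 0 < highGap P (concealment P m) x) :
    m.rP x ∈ Ioo 0 (x + P.τ) ∧ m.r0 x = 0 := by
  have hp := hm.eP_mem_Ioo hP hw hx hlt
  obtain ⟨-, h1, h2, h3⟩ := (hm.isPointwiseOptimal hP hx).of_highGap_pos hw hP hx hp.1 hmid hhigh
  rw [refundNA, h1, add_zero] at h2 h3
  exact ⟨⟨pos_of_mul_pos_right h2 hp.1.le, lt_of_mul_lt_mul_left h3 hp.1.le⟩,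
    (mul_eq_zero.1 h1).resolve_left (sub_pos.2 hp.2).ne'⟩

theorem IsTight.rP_eq_of_highGap_nonpos {x : ℝ} (hx : x ∈ P.types) (hlt : x < P.xhigh)
    (hmid : middleGap P (concealment P m) x < 0) (hhigh : highGap P (concealment P m) x ≤ 0) :
    m.rP x = x + P.τ := by
  have hp := hm.eP_mem_Ioo hP hw hx hlt
  have h1 := ((hm.isPointwiseOptimal hP hx).refund_of_highGap_nonpos hw hP hx hp.1 hmid hhigh).1
  rw [refundNA] at h1
  exact mul_left_cancel₀ hp.1.ne' (by linarith)

theorem IsTight.r0_eq_zero_of_isHighPoint {x : ℝ} (hx : x ∈ P.types) (hlow : P.xlow < x)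
    (hlt : x < P.xhigh) (hhigh : IsHighPoint P (concealment P m) x) : m.r0 x = 0 := by
  have hp := hm.eP_mem_Ioo hP hw hx hlt
  have H := hm.isPointwiseOptimal hP hx
  exact (mul_eq_zero.1 (H.h_eq_zero hw hP hx (H.eq_minAudit_of_isHighPoint hw hP hx hlow hhigh)
    hp.1)).resolve_left (sub_pos.2 hp.2).ne'

theorem IsTight.r0_pos_of_not_isHighPoint {x : ℝ} (hx : x ∈ P.types) (hlt : x < P.xhigh)
    (hmid : middleGap P (concealment P m) x < 0) (hgap : highGap P (concealment P m) x ≤ 0)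
    (hhigh : ¬ IsHighPoint P (concealment P m) x) : 0 < m.r0 x := by
  have hp := hm.eP_mem_Ioo hP hw hx hlt
  have H := hm.isPointwiseOptimal hP hx
  have h1 := H.minAudit_le.lt_of_ne' fun h => hhigh (H.isHighPoint hw hP hx hp.1 hmid hgap h)
  exact pos_of_mul_pos_right (H.of_minAudit_lt hw hP hx h1).2 (sub_nonneg.2 hp.2.le)

/-- The first three boundaries are zeros of the gaps, and `d` is the largest high point above `c`.
It is attained by compactness, and it lies below the top because minimal audits are positive at high
points but vanish from the threshold on. -/
theorem IsTight.exists_fiveIntervalsCover : ∃ a b c d : ℝ, FiveIntervalsCover P m a b c d := by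
  obtain ⟨a, b, c, hLa, hab, hbc, hcl, ha, hb, hc⟩ :=
    hw.exists_lowGap_middleGap_highGap_eq_zero hP
  have hl := hw.threshold_mem hP
  have haT : a ∈ P.types := ⟨hLa.le, by linarith [hl.2]⟩
  have hbT : b ∈ P.types := ⟨by linarith, by linarith [hl.2]⟩
  have hcT : c ∈ P.types := ⟨by linarith, by linarith [hl.2]⟩
  have hlow := hw.lowGap_strictAntiOn hP
  have hmid := hw.middleGap_strictAntiOn hP
  have hhigh := hw.highGap_strictAntiOn hP
  obtain ⟨y, hcy, hyH, hy⟩ := hw.exists_isHighPoint_gt hP hcT hcl hc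
  set S := {x | x ∈ Icc c P.xhigh ∧ IsHighPoint P (concealment P m) x} with hS
  have hScpt : IsCompact S := hw.isCompact_isHighPoint hP hcT
  have hSy : y ∈ S := ⟨⟨hcy.le, hyH⟩, hy⟩
  obtain ⟨hdI, hd⟩ := hScpt.sSup_mem ⟨y, hSy⟩
  set d := sSup S
  have hcd : c < d := hcy.trans_le (le_csSup hScpt.bddAbove hSy)
  have hdT : d ∈ P.types := ⟨by linarith, hdI.2⟩
  have hdH : d < P.xhigh := (hw.lt_of_minAudit_pos hP hdT
    (hw.minAudit_pos_of_isHighPoint hP hdT (by linarith) hd)).trans hl.2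
  have hbind : ∀ x ∈ P.types, a ≤ x → utility P m x = x - loss P m x := fun x hx hax =>
    hm.utility_eq_sub_loss hP hw hx ((hlow.antitoneOn haT hx hax).trans ha.le)
  have hzero : ∀ x ∈ P.types, x ≤ b → m.rP x = 0 ∧ m.r0 x = 0 := fun x hx hxb =>
    hm.refunds_eq_zero hP hw hx (by linarith [hl.2])
      (hb.ge.trans (hmid.antitoneOn hx hbT hxb))
  have hneg : ∀ x ∈ P.types, b < x → middleGap P (concealment P m) x < 0 := fun x hx hbx =>
    (hmid hbT hx hbx).trans_eq hb
  have hnonpos : ∀ x ∈ P.types, c ≤ x → highGap P (concealment P m) x ≤ 0 := fun x hx hcx =>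
    (hhigh.antitoneOn hcT hx hcx).trans hc.le
  refine ⟨a, b, c, d, ⟨hLa, hab, hbc, hcd, hdH⟩,
    fun x hx => hm.eP_mem_Ioo hP hw ⟨hx.1, hx.2.le⟩ hx.2, fun x hx => ?_, fun x hx => ?_,
    fun x hx => ?_, fun x hx => ?_, fun x hx => ?_⟩
  · have hxT : x ∈ P.types := ⟨hx.1, hx.2.le.trans haT.2⟩
    exact ⟨(hm.sub_loss_lt_utility_iff hP hw hxT).2 (ha ▸ hlow hxT haT hx.2),
      hzero x hxT (hx.2.trans hab).le⟩
  · have hxT : x ∈ P.types := ⟨hLa.le.trans hx.1, hx.2.trans hbT.2⟩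
    exact ⟨hbind x hxT hx.1, hzero x hxT hx.2⟩
  · have hxT : x ∈ P.types := ⟨hbT.1.trans hx.1.le, hx.2.le.trans hcT.2⟩
    exact ⟨hbind x hxT (hab.trans hx.1).le, hm.refunds_of_highGap_pos hP hw hxT
      (hx.2.trans_le hcT.2) (hneg x hxT hx.1) (hc ▸ hhigh hxT hcT hx.2)⟩
  · have hxT : x ∈ P.types := ⟨hcT.1.trans hx.1, hx.2.trans hdT.2⟩
    have hxH := hx.2.trans_lt hdH
    have hLx : P.xlow < x := by linarith [hx.1]
    have hgap := hnonpos x hxT hx.1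
    exact ⟨hbind x hxT (by linarith [hx.1]),
      hm.rP_eq_of_highGap_nonpos hP hw hxT hxH (hneg x hxT (hbc.trans_le hx.1)) hgap,
      hm.r0_eq_zero_of_isHighPoint hP hw hxT hLx hxH
        (hw.isHighPoint_of_le hP hxT hdT hLx hx.2 hgap hd)⟩
  · have hcx := hcd.trans hx.1
    have hxT : x ∈ P.types := ⟨hcT.1.trans hcx.le, hx.2.le⟩
    have hgap := hnonpos x hxT hcx.le
    have hmidx := hneg x hxT (hbc.trans hcx)
    exact ⟨hbind x hxT (by linarith),
      hm.rP_eq_of_highGap_nonpos hP hw hxT hx.2 hmidx hgap,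
      hm.r0_pos_of_not_isHighPoint hP hw hxT hx.2 hmidx hgap fun h =>
        hx.1.not_ge (le_csSup hScpt.bddAbove ⟨⟨hcx.le, hx.2.le⟩, h⟩)⟩

end TaxMechanism

end

theorem theorem3 (P : AuditProblem) (hP : P.IsValid) (hF : P.F {P.xhigh} = 0) :
    (∀ m : TaxMechanism, TaxMechanism.IsTight P m → TaxMechanism.IsOptimal P m →
      0 < sInf (TaxMechanism.utility P m '' Set.Icc P.xlow P.xhigh) ∧
      sSup (m.eP '' Set.Icc P.xlow P.xhigh) < 1 ∧
      (∀ x ∈ Set.Ico P.xlow P.xhigh, 0 < m.eP x) ∧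
      TaxMechanism.HasRandomAudits P m ∧
      (∃ a b c d : ℝ, TaxMechanism.FiveIntervalsCover P m a b c d)) ∧
    (∀ m : TaxMechanism, TaxMechanism.IsDebtWithRelief P m → ¬ TaxMechanism.IsOptimal P m) := by
  refine ⟨fun m hm ho => ?_, fun m h => h.not_isOptimal hP hF⟩
  have hw := hm.isOptimalProfile hP hF ho
  exact ⟨hm.sInf_utility_pos hP hw, hm.sSup_eP_lt_one hP hw,
    fun x hx => hm.eP_pos hP hw ⟨hx.1, hx.2.le⟩ hx.2,
    ⟨P.xlow, hP.xlow_mem, hm.eP_mem_Ioo hP hw hP.xlow_mem hP.xlow_lt_xhigh⟩,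
    hm.exists_fiveIntervalsCover hP hw⟩
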